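/- There are absolute constants $a,b>0$ such that for every $c\in\mathbb N$ there are a randomized word-RAM program $P$ and constants $K>0$, $d,\gamma\in\mathbb N$, $\gamma\ge 1$ (depending only on $c$), with the following property. Let $n\ge 1$, let $A=(a_0,\dots,a_{n-1})$ be a sequence of integers, let $\mathsf{lis}(A)$ be the length of a longest strictly increasing subsequence of $A$, and define $\lambda\in[1/n,1]$ by $\mathsf{lis}(A)=n\lambda$. The program is given $n$ and access to $A$, but not $\lambda$. With probability at least $1-n^{-c}$ over its random choices, $P$ halts after at most $$K\,\lambda^{-7}\sqrt n\,(1+\log n)^d=\tilde O(\lambda^{-7}\sqrt n)$$ steps (rounded up to an integer) and outputs a natural number $\mathsf{est}$ with $$a\,\lambda^3\,\mathsf{lis}(A)\;\le\;\mathsf{est}\;\le\;b\,\mathsf{lis}(A).$$ Here the machine is a word RAM with words of $\gamma(\lfloor\log_2 n\rfloor+1)=O(\log n)$ bits. In one step it can perform a constant number of the following: arithmetic and comparison of words, reading and writing of randomly addressed memory cells (initially zero), comparing two entries $a_i<a_j$ of the input at given positions $i,j$, drawing a uniformly random element of $\{0,\dots,m-1\}$ for a word $m$, and branching. One fixed program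 $P$ (for given $c$) serves all $n$ and all $A$. -/

import Mathlib

/-- `lis A` is the length of a longest (strictly) increasing subsequence of `A`: the largest
cardinality of a set of positions on which `A` is strictly increasing. -/
noncomputable def lis {n : ℕ} (A : Fin n → ℤ) : ℕ := by
  classical
  exact (Finset.univ.filter (fun s : Finset (Fin n) => StrictMonoOn A (s : Set (Fin n)))).sup
    Finset.card

/-! A randomized word RAM, programmed in a small imperative language. The machine has finitely many
variables and arrays in use by any given program; each variable and each array cell holds one word,
that is, a natural number below `W`. The input sequence is available through unit-time comparisons
of two entries at given positions. -/

namespace RandomRAM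

/-- The binary word operations. `sub` is truncated at zero; `lt` and `eq` return `0` or `1`. -/
inductive BinOp where
  | add | sub | mul | div | mod | lt | eq

def BinOp.eval : BinOp → ℕ → ℕ → ℕ
  | .add, x, y => x + y
  | .sub, x, y => x - y
  | .mul, x, y => x * y
  | .div, x, y => x / y
  | .mod, x, y => x % y
  | .lt, x, y => if x < y then 1 else 0
  | .eq, x, y => if x = y then 1 else 0

inductive Expr where
  /-- a constant -/
  | const (k : ℕ)
  /-- the value of a variable -/
  | var (x : ℕ)
  /-- `load a e` is the content of cell `e` of the array named `a` -/
  | load (a : ℕ) (e : Expr)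
  /-- a binary word operation -/
  | bin (op : BinOp) (e₁ e₂ : Expr)
  /-- `inputLt e₁ e₂` compares two input entries: it is `1` if `e₁` and `e₂` are positions of the
  input sequence, counted from `0`, and the entry at `e₁` is less than the entry at `e₂`;
  otherwise it is `0` -/
  | inputLt (e₁ e₂ : Expr)

/-- Programs. -/
inductive Cmd where
  | skip
  /-- `assign x e`: variable `x` receives the value of `e` -/
  | assign (x : ℕ) (e : Expr)
  /-- `store a i e`: cell `i` of array `a` receives the value of `e` -/
  | store (a : ℕ) (i e : Expr)
  /-- `rand x e`: variable `x` receives a fresh uniformly random element of `{0, …, e - 1}`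
  (`0` if `e` is zero) -/
  | rand (x : ℕ) (e : Expr)
  | seq (c₁ c₂ : Cmd)
  /-- `ite e c₁ c₂`: run `c₁` if `e` is nonzero, otherwise `c₂` -/
  | ite (e : Expr) (c₁ c₂ : Cmd)
  /-- `loop e c`: repeat `c` while `e` is nonzero -/
  | loop (e : Expr) (c : Cmd)

/-- The contents of the variables and of the arrays. -/
structure Store where
  vars : ℕ → ℕ
  arrays : ℕ → ℕ → ℕ

def Store.setVar (s : Store) (x v : ℕ) : Store :=
  { s with vars := Function.update s.vars x v }

def Store.setCell (s : Store) (a i v : ℕ) : Store :=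
  { s with arrays := Function.update s.arrays a (Function.update (s.arrays a) i v) }

/-- The value of an expression on input `A`; constants and results of operations are
reduced modulo `W`. -/
def Expr.eval {n : ℕ} (W : ℕ) (A : Fin n → ℤ) (s : Store) : Expr → ℕ
  | .const k => k % W
  | .var x => s.vars x
  | .load a e => s.arrays a (e.eval W A s)
  | .bin op e₁ e₂ => op.eval (e₁.eval W A s) (e₂.eval W A s) % W
  | .inputLt e₁ e₂ =>
      let i := e₁.eval W A s
      let j := e₂.eval W A s
      if h : i < n ∧ j < n then (if A ⟨i, h.1⟩ < A ⟨j, h.2⟩ then 1 else 0) else 0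

/-- The uniform distribution on `{0, …, m - 1}`; concentrated at `0` if `m = 0`. -/
noncomputable def uniformBelow : ℕ → PMF ℕ
  | 0 => PMF.pure 0
  | m + 1 => (PMF.uniformOfFintype (Fin (m + 1))).map Fin.val

/-- The commands that remain to be executed, in order, and the current store. The machine has
halted when no command remains. -/
abbrev Config := List Cmd × Store

/-- One step of the machine. A step evaluates a bounded number of expressions of the program, whose
sizes do not depend on the input, so that its cost is a constant for each program. -/
noncomputable def step {n : ℕ} (W : ℕ) (A : Fin n → ℤ) : Config → PMF Config
  | ([], s) => PMF.pure ([], s)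
  | (.skip :: k, s) => PMF.pure (k, s)
  | (.assign x e :: k, s) => PMF.pure (k, s.setVar x (e.eval W A s))
  | (.store a i e :: k, s) => PMF.pure (k, s.setCell a (i.eval W A s) (e.eval W A s))
  | (.rand x e :: k, s) => (uniformBelow (e.eval W A s)).map (fun v => (k, s.setVar x v))
  | (.seq c₁ c₂ :: k, s) => PMF.pure (c₁ :: c₂ :: k, s)
  | (.ite e c₁ c₂ :: k, s) => PMF.pure (if e.eval W A s ≠ 0 then (c₁ :: k, s) else (c₂ :: k, s))
  | (.loop e c :: k, s) =>
      PMF.pure (if e.eval W A s ≠ 0 then (c :: .loop e c :: k, s) else (k, s))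

/-- The distribution of the configuration after `t` steps from a given configuration. -/
noncomputable def runFrom {n : ℕ} (W : ℕ) (A : Fin n → ℤ) : ℕ → Config → PMF Config
  | 0, cfg => PMF.pure cfg
  | t + 1, cfg => (step W A cfg).bind (runFrom W A t)

/-- Initially variable `0` holds the input length; everything else is zero. -/
def initStore (n : ℕ) : Store where
  vars := fun x => if x = 0 then n else 0
  arrays := fun _ _ => 0

/-- Words of `γ * (⌊log₂ n⌋ + 1)` bits. -/
def wordBound (γ n : ℕ) : ℕ := 2 ^ (γ * (Nat.log 2 n + 1))

/-- The probability that `P`, on the input sequence `A` and with words of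
`γ * (⌊log₂ n⌋ + 1)` bits, halts within `t` steps with an output in `S`. The output is the value of
variable `1` on halting. -/
noncomputable def successProb (P : Cmd) (γ : ℕ) {n : ℕ} (A : Fin n → ℤ) (t : ℕ) (S : Set ℕ) : ℝ :=
  ((runFrom (wordBound γ n) A t ([P], initStore n)).toOuterMeasure
    {cfg : Config | cfg.1 = [] ∧ cfg.2.vars 1 ∈ S}).toReal

end RandomRAM

/-! Let q be the integer part of √n. The first q² positions are cut into q columns of width q, and a
guess g for 1/λ is doubled until a randomized test accepts. The test samples 16g positions in each
column. Each ordered pair of samples of one column spans an interval of values, which makes 256g²q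
intervals (those with reversed ends are discarded). A longest chain of intervals is extracted
greedily 2048g³ times, and each extracted chain becomes a colour. The quality of a colour in a
column is the length of a longest increasing subsequence of that column inside the hull of its
intervals of this colour.

Qualities never overshoot: since a colour is a chain, its hulls in successive columns lie above each
other, so optimal subsequences in the hulls can be concatenated, and the qualities of one colour add
up to at most the optimum (`sum_quality_le`).

Qualities are large for a good guess. Let O be a longest increasing subsequence, and drop the
elements that are not enclosed by sampled elements of O in their column. Within a column the
probabilities of being dropped decay geometrically, so with probability at least 1/2 fewer than
q²/(2g) elements are lost (`sum_one_sub_pow_le`, `avgList_lost_le`). What is left of a column lies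
in the interval spanned by its extreme samples from O, and these intervals form a chain. Its
uncoloured part is no longer than any extracted chain, so it meets at most q/(8g) columns; the
coloured part is paid for by the qualities (`card_retained_le`). Hence for g ≥ 1/λ some colour has
total quality at least q²/(8192g⁴) (`exists_large_quality`).

The total quality of a colour is estimated from 65536·E·g⁴ random columns, where E is a multiple of
log n. Chernoff bounds (`avgList_large_le`, `avgList_small_le`) show that a trial accepts with
probability at least 1/4 if g ≥ 1/λ, and with probability at most 2048g³/2^E if the optimum is at
most q²/(131072g⁴). With 3E trials per guess, the search with high probability accepts at some g ≤
2/λ, and only if the optimum exceeds q²/(131072g⁴) (`search_trans`). It also stops once 256g² > q,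
where the output is bounded by a constant. In either case the output q²/g⁴ + 1 lies between constant
multiples of λ³ times the optimum and of the optimum (`le_output`, `output_le`). The dominant cost
is 2048g³ colours times 65536·E·g⁴ columns times q positions, hence g⁷√n up to logarithms.

On the machine, code without draws has a big-step semantics (`Big`, `Runs`) with explicit step
counts. Randomness is treated backwards: `loss` is the probability of failing, `Trans` bounds it
before a command by its bounds afterwards, and `avgList` averages over a block of draws. -/

namespace RandomRAM

open scoped ENNReal

/-! ### Big-step semantics of commands without random choices -/

section Det

variable {n : ℕ} {W : ℕ} {A : Fin n → ℤ}

/-- `Big W A c s t s'`: the command `c`, started in `s`, ends in `s'` after exactly `t` steps,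
without drawing random numbers. -/
inductive Big (W : ℕ) (A : Fin n → ℤ) : Cmd → Store → ℕ → Store → Prop
  | skip (s) : Big W A .skip s 1 s
  | assign (x e s) : Big W A (.assign x e) s 1 (s.setVar x (e.eval W A s))
  | store (a i e s) : Big W A (.store a i e) s 1 (s.setCell a (i.eval W A s) (e.eval W A s))
  | seq {c₁ c₂ s s₁ s₂ t₁ t₂} : Big W A c₁ s t₁ s₁ → Big W A c₂ s₁ t₂ s₂ →
      Big W A (.seq c₁ c₂) s (t₁ + t₂ + 1) s₂
  | ite_true {e c₁ c₂ s s' t} : e.eval W A s ≠ 0 → Big W A c₁ s t s' →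
      Big W A (.ite e c₁ c₂) s (t + 1) s'
  | ite_false {e c₁ c₂ s s' t} : e.eval W A s = 0 → Big W A c₂ s t s' →
      Big W A (.ite e c₁ c₂) s (t + 1) s'
  | loop_true {e c s s₁ s₂ t₁ t₂} : e.eval W A s ≠ 0 → Big W A c s t₁ s₁ →
      Big W A (.loop e c) s₁ t₂ s₂ → Big W A (.loop e c) s (t₁ + t₂ + 1) s₂
  | loop_false {e c s} : e.eval W A s = 0 → Big W A (.loop e c) s 1 s

theorem runFrom_succ (t : ℕ) (cfg : Config) :
    runFrom W A (t + 1) cfg = (step W A cfg).bind (runFrom W A t) := rfl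

/-- Each step is a point mass, so executing `c` merely shifts time. The step count is exact to make
this an equality of distributions; upper bounds only enter with `Runs`. -/
theorem Big.runFrom_eq {c : Cmd} {s s' : Store} {T : ℕ} (h : Big W A c s T s') :
    ∀ (k : List Cmd) (t : ℕ), runFrom W A (T + t) (c :: k, s) = runFrom W A t (k, s') := by
  induction h with
  | skip s => intro k t; rw [Nat.add_comm, runFrom_succ]; simp [step]
  | assign x e s => intro k t; rw [Nat.add_comm, runFrom_succ]; simp [step]
  | store a i e s => intro k t; rw [Nat.add_comm, runFrom_succ]; simp [step]
  | @seq c₁ c₂ s s₁ s₂ t₁ t₂ _ _ ih₁ ih₂ =>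
    intro k t
    rw [show t₁ + t₂ + 1 + t = (t₁ + (t₂ + t)) + 1 by omega, runFrom_succ]
    simp [step, ih₁, ih₂]
  | @ite_true e c₁ c₂ s s' t' he _ ih =>
    intro k t
    rw [show t' + 1 + t = (t' + t) + 1 by omega, runFrom_succ]
    simp [step, ih, he]
  | @ite_false e c₁ c₂ s s' t' he _ ih =>
    intro k t
    rw [show t' + 1 + t = (t' + t) + 1 by omega, runFrom_succ]
    simp [step, ih, he]
  | @loop_true e c s s₁ s₂ t₁ t₂ he _ _ ih₁ ih₂ =>
    intro k t
    rw [show t₁ + t₂ + 1 + t = (t₁ + (t₂ + t)) + 1 by omega, runFrom_succ]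
    simp [step, ih₁, ih₂, he]
  | loop_false he => intro k t; rw [Nat.add_comm, runFrom_succ]; simp [step, he]

/-- Whether a command contains an assignment to the variable `z`. -/
def Cmd.writesVar (z : ℕ) : Cmd → Bool
  | .skip => false
  | .assign x _ => x == z
  | .store _ _ _ => false
  | .rand x _ => x == z
  | .seq c₁ c₂ => c₁.writesVar z || c₂.writesVar z
  | .ite _ c₁ c₂ => c₁.writesVar z || c₂.writesVar z
  | .loop _ c => c.writesVar z

/-- Whether a command contains a store to the array `z`. -/
def Cmd.writesArr (z : ℕ) : Cmd → Bool
  | .skip => false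
  | .assign _ _ => false
  | .store a _ _ => a == z
  | .rand _ _ => false
  | .seq c₁ c₂ => c₁.writesArr z || c₂.writesArr z
  | .ite _ c₁ c₂ => c₁.writesArr z || c₂.writesArr z
  | .loop _ c => c.writesArr z

/-- `s'` agrees with `s` on everything that `c` does not write. -/
def Frame (c : Cmd) (s s' : Store) : Prop :=
  (∀ z, c.writesVar z = false → s'.vars z = s.vars z) ∧
    ∀ z, c.writesArr z = false → s'.arrays z = s.arrays z

/-- The set of written names is computable from the syntax, so later proofs recover untouched values
by `rfl` or `decide`, and specifications mention only what changes. -/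
theorem Big.frame {c : Cmd} {s s' : Store} {T : ℕ} (h : Big W A c s T s') : Frame c s s' := by
  induction h with
  | skip s => exact ⟨fun _ _ => rfl, fun _ _ => rfl⟩
  | assign x e s =>
    refine ⟨fun z hz => ?_, fun _ _ => rfl⟩
    simp only [Cmd.writesVar, beq_eq_false_iff_ne] at hz
    simp [Store.setVar, Function.update_of_ne hz.symm]
  | store a i e s =>
    refine ⟨fun _ _ => rfl, fun z hz => ?_⟩
    simp only [Cmd.writesArr, beq_eq_false_iff_ne] at hz
    simp [Store.setCell, Function.update_of_ne hz.symm]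
  | seq _ _ ih₁ ih₂ =>
    refine ⟨fun z hz => ?_, fun z hz => ?_⟩
    · simp only [Cmd.writesVar, Bool.or_eq_false_iff] at hz
      rw [ih₂.1 z hz.2, ih₁.1 z hz.1]
    · simp only [Cmd.writesArr, Bool.or_eq_false_iff] at hz
      rw [ih₂.2 z hz.2, ih₁.2 z hz.1]
  | ite_true _ _ ih =>
    refine ⟨fun z hz => ?_, fun z hz => ?_⟩
    · simp only [Cmd.writesVar, Bool.or_eq_false_iff] at hz
      exact ih.1 z hz.1
    · simp only [Cmd.writesArr, Bool.or_eq_false_iff] at hz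
      exact ih.2 z hz.1
  | ite_false _ _ ih =>
    refine ⟨fun z hz => ?_, fun z hz => ?_⟩
    · simp only [Cmd.writesVar, Bool.or_eq_false_iff] at hz
      exact ih.1 z hz.2
    · simp only [Cmd.writesArr, Bool.or_eq_false_iff] at hz
      exact ih.2 z hz.2
  | loop_true _ _ _ ih₁ ih₂ =>
    refine ⟨fun z hz => ?_, fun z hz => ?_⟩
    · rw [ih₂.1 z hz, ih₁.1 z hz]
    · rw [ih₂.2 z hz, ih₁.2 z hz]
  | loop_false _ => exact ⟨fun _ _ => rfl, fun _ _ => rfl⟩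

/-- `c`, started in `s`, halts within `T` steps in a state that satisfies `Q`. -/
def Runs (W : ℕ) (A : Fin n → ℤ) (c : Cmd) (s : Store) (T : ℕ) (Q : Store → Prop) : Prop :=
  ∃ t ≤ T, ∃ s', Big W A c s t s' ∧ Q s'

variable {c c₁ c₂ : Cmd} {e : Expr} {s : Store} {T T₁ T₂ : ℕ} {Q Q' : Store → Prop}

theorem Runs.mono (h : Runs W A c s T₁ Q) (hT : T₁ ≤ T₂) (hQ : ∀ s', Q s' → Q' s') :
    Runs W A c s T₂ Q' := by
  obtain ⟨t, ht, s', hb, hq⟩ := h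
  exact ⟨t, ht.trans hT, s', hb, hQ _ hq⟩

theorem Runs.framed (h : Runs W A c s T Q) :
    Runs W A c s T (fun s' => Q s' ∧ Frame c s s') := by
  obtain ⟨t, ht, s', hb, hq⟩ := h
  exact ⟨t, ht, s', hb, hq, hb.frame⟩

theorem Runs.skip (h : Q s) : Runs W A .skip s 1 Q := ⟨1, le_rfl, s, .skip s, h⟩

theorem Runs.assign {x : ℕ} (h : Q (s.setVar x (e.eval W A s))) :
    Runs W A (.assign x e) s 1 Q := ⟨1, le_rfl, _, .assign x e s, h⟩

theorem Runs.store {a : ℕ} {i : Expr} (h : Q (s.setCell a (i.eval W A s) (e.eval W A s))) :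
    Runs W A (.store a i e) s 1 Q := ⟨1, le_rfl, _, .store a i e s, h⟩

theorem Runs.seq (h : Runs W A c₁ s T₁ (fun s' => Runs W A c₂ s' T₂ Q)) :
    Runs W A (.seq c₁ c₂) s (T₁ + T₂ + 1) Q := by
  obtain ⟨t₁, ht₁, s₁, hb₁, t₂, ht₂, s₂, hb₂, hq⟩ := h
  exact ⟨_, by omega, s₂, .seq hb₁ hb₂, hq⟩

theorem Runs.ite (h₁ : e.eval W A s ≠ 0 → Runs W A c₁ s T Q)
    (h₂ : e.eval W A s = 0 → Runs W A c₂ s T Q) : Runs W A (.ite e c₁ c₂) s (T + 1) Q := by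
  by_cases he : e.eval W A s = 0
  · obtain ⟨t, ht, s', hb, hq⟩ := h₂ he
    exact ⟨_, by omega, s', .ite_false he hb, hq⟩
  · obtain ⟨t, ht, s', hb, hq⟩ := h₁ he
    exact ⟨_, by omega, s', .ite_true he hb, hq⟩

/-- A loop whose body decreases a natural-number measure. -/
theorem Runs.loop_of_measure {I : ℕ → Store → Prop} {Tb : ℕ}
    (hbody : ∀ m s, I m s → e.eval W A s ≠ 0 →
      Runs W A c s Tb (fun s' => ∃ m', m' < m ∧ I m' s'))
    (hend : ∀ m s, I m s → e.eval W A s = 0 → Q s) {m : ℕ} (h : I m s) :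
    Runs W A (.loop e c) s (m * (Tb + 1) + 1) Q := by
  induction m using Nat.strong_induction_on generalizing s with
  | _ m ih =>
    by_cases he : e.eval W A s = 0
    · exact ⟨1, by omega, s, .loop_false he, hend _ _ h he⟩
    · obtain ⟨t₁, ht₁, s₁, hb₁, m', hm', hI⟩ := hbody m s h he
      obtain ⟨t₂, ht₂, s₂, hb₂, hq⟩ := ih m' hm' hI
      refine ⟨_, ?_, s₂, .loop_true he hb₁ hb₂, hq⟩
      have := Nat.mul_le_mul_right (Tb + 1) (show m' + 1 ≤ m by omega)
      have h2 : (m' + 1) * (Tb + 1) = m' * (Tb + 1) + Tb + 1 := by ring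
      omega

/-- `for x = 0, …, (value of y) - 1 do c`. -/
def Cmd.forLt (x y : ℕ) (c : Cmd) : Cmd :=
  .seq (.assign x (.const 0))
    (.loop (.bin .lt (.var x) (.var y)) (.seq c (.assign x (.bin .add (.var x) (.const 1)))))

@[simp] theorem Store.vars_setVar (s : Store) (x v z : ℕ) :
    (s.setVar x v).vars z = if z = x then v else s.vars z := by
  simp [Store.setVar, Function.update_apply]

@[simp] theorem Store.arrays_setVar (s : Store) (x v : ℕ) :
    (s.setVar x v).arrays = s.arrays := rfl

@[simp] theorem Store.vars_setCell (s : Store) (a i v : ℕ) :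
    (s.setCell a i v).vars = s.vars := rfl

@[simp] theorem Store.arrays_setCell (s : Store) (a i v b j : ℕ) :
    (s.setCell a i v).arrays b j = if b = a ∧ j = i then v else s.arrays b j := by
  simp only [Store.setCell, Function.update_apply]
  by_cases h : b = a <;> by_cases h' : j = i <;> simp [h, h']

theorem Store.arrays_setCell_ne (s : Store) {a b : ℕ} (i v : ℕ) (h : b ≠ a) :
    (s.setCell a i v).arrays b = s.arrays b := by
  simp [Store.setCell, Function.update_of_ne h]

theorem eval_lt_var (s : Store) (x y : ℕ) (hW : 1 < W) :
    (Expr.bin .lt (.var x) (.var y)).eval W A s = if s.vars x < s.vars y then 1 else 0 := by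
  change (if s.vars x < s.vars y then 1 else 0) % W = _
  split_ifs
  · exact Nat.mod_eq_of_lt hW
  · exact Nat.zero_mod _

/-- Rule for counting loops: besides the invariant, the frame of the whole loop is available. -/
theorem Runs.forLt {x y N Tb : ℕ} {Inv : ℕ → Store → Prop} (hW : 1 < W) (hN : s.vars y = N)
    (hNW : N < W) (hxy : x ≠ y) (hcx : c.writesVar x = false) (hcy : c.writesVar y = false)
    (h0 : Inv 0 (s.setVar x 0))
    (hbody : ∀ i < N, ∀ s', Frame (Cmd.forLt x y c) s s' → s'.vars x = i → s'.vars y = N →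
      Inv i s' → Runs W A c s' Tb (fun s'' => Inv (i + 1) (s''.setVar x (i + 1))))
    (hQ : ∀ s', Frame (Cmd.forLt x y c) s s' → s'.vars x = N → s'.vars y = N → Inv N s' → Q s') :
    Runs W A (Cmd.forLt x y c) s (N * (Tb + 3) + 3) Q := by
  have hfy : (Cmd.forLt x y c).writesVar y = false := by
    simp [Cmd.forLt, Cmd.writesVar, hxy, hcy]
  have key : ∀ d i s', i + d = N → Frame (Cmd.forLt x y c) s s' → s'.vars x = i → Inv i s' →
      Runs W A (.loop (.bin .lt (.var x) (.var y))
        (.seq c (.assign x (.bin .add (.var x) (.const 1))))) s' (d * (Tb + 3) + 1) Q := by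
    intro d
    induction d with
    | zero =>
      intro i s' hi hf hx hI
      have hy : s'.vars y = N := by rw [hf.1 y hfy, hN]
      refine ⟨1, by omega, s', .loop_false ?_, hQ s' hf (by omega) hy ?_⟩
      · rw [eval_lt_var _ _ _ hW, hx, hy, if_neg (by omega)]
      · rwa [show N = i by omega]
    | succ d ih =>
      intro i s' hi hf hx hI
      have hy : s'.vars y = N := by rw [hf.1 y hfy, hN]
      obtain ⟨t₁, ht₁, s₁, hb₁, hI₁⟩ := hbody i (by omega) s' hf hx hy hI
      have hf₁ := hb₁.frame
      have hx₁ : s₁.vars x = i := by rw [hf₁.1 x hcx, hx]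
      have hass : Big W A (.assign x (.bin .add (.var x) (.const 1))) s₁ 1
          (s₁.setVar x (i + 1)) := by
        have := Big.assign (W := W) (A := A) x (.bin .add (.var x) (.const 1)) s₁
        simpa [Expr.eval, BinOp.eval, hx₁, Nat.mod_eq_of_lt hW,
          Nat.mod_eq_of_lt (show i + 1 < W by omega)] using this
      have hframe : Frame (Cmd.forLt x y c) s (s₁.setVar x (i + 1)) := by
        refine ⟨fun z hz => ?_, fun z hz => ?_⟩
        · have hz' := hz
          simp only [Cmd.forLt, Cmd.writesVar, Bool.or_eq_false_iff, beq_eq_false_iff_ne] at hz'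
          rw [Store.vars_setVar, if_neg (fun h => hz'.1 h.symm), hf₁.1 z hz'.2.1, hf.1 z hz]
        · have hz' := hz
          simp only [Cmd.forLt, Cmd.writesArr, Bool.or_eq_false_iff] at hz'
          rw [Store.arrays_setVar, hf₁.2 z hz'.2.1, hf.2 z hz]
      obtain ⟨t₂, ht₂, s₂, hb₂, hq⟩ :=
        ih (i + 1) (s₁.setVar x (i + 1)) (by omega) hframe (by simp) hI₁
      refine ⟨(t₁ + 1 + 1) + t₂ + 1, ?_, s₂, .loop_true ?_ (.seq hb₁ hass) hb₂, hq⟩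
      · have : (d + 1) * (Tb + 3) = d * (Tb + 3) + Tb + 3 := by ring
        omega
      · rw [eval_lt_var _ _ _ hW, hx, hy, if_pos (by omega)]
        exact one_ne_zero
  have hass : Big W A (.assign x (.const 0)) s 1 (s.setVar x 0) := by
    have := Big.assign (W := W) (A := A) x (.const 0) s
    simpa [Expr.eval] using this
  have hframe : Frame (Cmd.forLt x y c) s (s.setVar x 0) := by
    refine ⟨fun z hz => ?_, fun z hz => rfl⟩
    simp only [Cmd.forLt, Cmd.writesVar, Bool.or_eq_false_iff, beq_eq_false_iff_ne] at hz
    rw [Store.vars_setVar, if_neg (fun h => hz.1 h.symm)]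
  obtain ⟨t, ht, s', hb, hq⟩ := key N 0 (s.setVar x 0) (by omega) hframe (by simp) h0
  exact ⟨_, by omega, s', .seq hass hb, hq⟩

end Det

/-! ### The failure probability of a configuration -/

section Loss

variable {n : ℕ} (W : ℕ) (A : Fin n → ℤ) (S : Set ℕ)

/-- The halted configurations with an output in `S`. -/
def goal : Set Config := {cfg | cfg.1 = [] ∧ cfg.2.vars 1 ∈ S}

/-- The probability of not having halted with an output in `S` after `t` steps. -/
noncomputable def loss (t : ℕ) (cfg : Config) : ℝ≥0∞ :=
  (runFrom W A t cfg).toOuterMeasure (goal S)ᶜ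

theorem loss_le_one (t : ℕ) (cfg : Config) : loss W A S t cfg ≤ 1 := by
  rw [loss, PMF.toOuterMeasure_apply, ← (runFrom W A t cfg).tsum_coe]
  exact ENNReal.tsum_le_tsum fun x => Set.indicator_le_self _ _ x

theorem loss_succ (t : ℕ) (cfg : Config) :
    loss W A S (t + 1) cfg = ∑' c', step W A cfg c' * loss W A S t c' := by
  rw [loss, runFrom_succ, PMF.toOuterMeasure_bind_apply]
  rfl

open Classical in
theorem loss_halted (t : ℕ) (s : Store) :
    loss W A S t ([], s) = if s.vars 1 ∈ S then 0 else 1 := by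
  have h : ∀ t, runFrom W A t ([], s) = PMF.pure ([], s) := by
    intro t
    induction t with
    | zero => rfl
    | succ t ih => rw [runFrom_succ]; simp [step, ih]
  rw [loss, h, PMF.toOuterMeasure_pure_apply]
  by_cases hs : s.vars 1 ∈ S <;> simp [goal, hs]

theorem loss_zero_cons (c : Cmd) (k : List Cmd) (s : Store) : loss W A S 0 (c :: k, s) = 1 := by
  rw [loss, runFrom, PMF.toOuterMeasure_pure_apply]
  simp [goal]

/-- Halted configurations are fixed points, so extra time can only turn failures into successes.
This is what allows all running times to be rounded up. -/
theorem loss_succ_le (t : ℕ) (cfg : Config) : loss W A S (t + 1) cfg ≤ loss W A S t cfg := by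
  induction t generalizing cfg with
  | zero =>
    obtain ⟨k, s⟩ := cfg
    cases k with
    | nil => rw [loss_halted, loss_halted]
    | cons c k => rw [loss_zero_cons]; exact loss_le_one _ _ _ _ _
  | succ t ih =>
    rw [loss_succ, loss_succ W A S t]
    exact ENNReal.tsum_le_tsum fun x => by gcongr; exact ih x

theorem loss_antitone (cfg : Config) : Antitone fun t => loss W A S t cfg :=
  antitone_nat_of_succ_le fun t => loss_succ_le W A S t cfg

theorem one_sub_loss_le_successProb {P : Cmd} {γ : ℕ} (t : ℕ) {r : ℝ} (hr : 0 ≤ r)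
    (h : loss (wordBound γ n) A S t ([P], initStore n) ≤ ENNReal.ofReal r) :
    1 - r ≤ successProb P γ A t S := by
  set μ := runFrom (wordBound γ n) A t ([P], initStore n) with hμ
  have hsum : μ.toOuterMeasure (goal S) + loss (wordBound γ n) A S t ([P], initStore n) = 1 := by
    rw [loss, ← hμ, PMF.toOuterMeasure_apply, PMF.toOuterMeasure_apply, ← ENNReal.tsum_add,
      ← μ.tsum_coe]
    exact tsum_congr fun x => by
      rw [← Pi.add_apply ((goal S).indicator μ), Set.indicator_self_add_compl]
  have hle : μ.toOuterMeasure (goal S) ≤ 1 := by rw [← hsum]; exact le_self_add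
  have h1 : (1 : ℝ≥0∞) ≤ μ.toOuterMeasure (goal S) + ENNReal.ofReal r := by
    rw [← hsum]; gcongr
  have h2 := ENNReal.toReal_mono (by
    exact ENNReal.add_ne_top.2 ⟨ne_top_of_le_ne_top ENNReal.one_ne_top hle, ENNReal.ofReal_ne_top⟩)
    h1
  rw [ENNReal.toReal_add (ne_top_of_le_ne_top ENNReal.one_ne_top hle) ENNReal.ofReal_ne_top,
    ENNReal.toReal_ofReal hr, ENNReal.toReal_one] at h2
  change 1 - r ≤ (μ.toOuterMeasure (goal S)).toReal
  linarith

/-- `c`, started in `s`, within `T` steps reaches states in which the expectation of `post` is at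
most `r`; expressed through the failure probability of the whole run. -/
def Trans (c : Cmd) (s : Store) (T : ℕ) (post : Store → ℝ≥0∞) (r : ℝ≥0∞) : Prop :=
  ∀ (k : List Cmd) (t : ℕ), (∀ s', loss W A S t (k, s') ≤ post s') →
    loss W A S (T + t) (c :: k, s) ≤ r

variable {W A S} {c c₁ c₂ : Cmd} {e : Expr} {s : Store} {T T₁ T₂ : ℕ} {Q : Store → Prop}
  {post : Store → ℝ≥0∞} {r : ℝ≥0∞}

theorem Trans.of_runs (h : Runs W A c s T Q) (hr : ∀ s', Q s' → post s' ≤ r) :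
    Trans W A S c s T post r := by
  intro k t hp
  obtain ⟨t', ht', s', hb, hq⟩ := h
  calc loss W A S (T + t) (c :: k, s) ≤ loss W A S (t' + t) (c :: k, s) :=
        loss_antitone W A S _ (by omega)
    _ = loss W A S t (k, s') := by rw [loss, hb.runFrom_eq, loss]
    _ ≤ r := (hp s').trans (hr s' hq)

theorem Trans.mono (h : Trans W A S c s T₁ post r) (hT : T₁ ≤ T₂) {r' : ℝ≥0∞} (hr : r ≤ r') :
    Trans W A S c s T₂ post r' := fun k t hp =>
  ((loss_antitone W A S _ (by omega : T₁ + t ≤ T₂ + t)).trans (h k t hp)).trans hr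

theorem loss_seq (t : ℕ) (k : List Cmd) (s : Store) :
    loss W A S (t + 1) (.seq c₁ c₂ :: k, s) = loss W A S t (c₁ :: c₂ :: k, s) := by
  rw [loss, runFrom_succ]; simp [step, loss]

theorem Trans.seq {mid : Store → ℝ≥0∞} (h₁ : Trans W A S c₁ s T₁ mid r)
    (h₂ : ∀ s', Trans W A S c₂ s' T₂ post (mid s')) :
    Trans W A S (.seq c₁ c₂) s (T₁ + T₂ + 1) post r := by
  intro k t hp
  rw [show T₁ + T₂ + 1 + t = T₁ + (T₂ + t) + 1 by omega, loss_seq]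
  exact h₁ _ _ fun s' => h₂ s' k t hp

theorem Trans.seq_runs (h₁ : Runs W A c₁ s T₁ Q)
    (h₂ : ∀ s', Q s' → Trans W A S c₂ s' T₂ post r) :
    Trans W A S (.seq c₁ c₂) s (T₁ + T₂ + 1) post r := by
  intro k t hp
  obtain ⟨t', ht', s', hb, hq⟩ := h₁
  rw [show T₁ + T₂ + 1 + t = T₁ + (T₂ + t) + 1 by omega, loss_seq]
  refine (loss_antitone W A S _ (show t' + (T₂ + t) ≤ T₁ + (T₂ + t) by omega)).trans ?_
  simp only [loss]
  rw [hb.runFrom_eq]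
  exact h₂ s' hq k t hp

theorem Trans.ite (h₁ : e.eval W A s ≠ 0 → Trans W A S c₁ s T post r)
    (h₂ : e.eval W A s = 0 → Trans W A S c₂ s T post r) :
    Trans W A S (.ite e c₁ c₂) s (T + 1) post r := by
  intro k t hp
  rw [show T + 1 + t = (T + t) + 1 by omega]
  by_cases he : e.eval W A s = 0
  · have : loss W A S (T + t + 1) (.ite e c₁ c₂ :: k, s) = loss W A S (T + t) (c₂ :: k, s) := by
      rw [loss, runFrom_succ]; simp [step, loss, he]
    rw [this]; exact h₂ he k t hp
  · have : loss W A S (T + t + 1) (.ite e c₁ c₂ :: k, s) = loss W A S (T + t) (c₁ :: k, s) := by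
      rw [loss, runFrom_succ]; simp [step, loss, he]
    rw [this]; exact h₁ he k t hp

theorem Trans.loop_true {mid : Store → ℝ≥0∞} (he : e.eval W A s ≠ 0)
    (h₁ : Trans W A S c s T₁ mid r) (h₂ : ∀ s', Trans W A S (.loop e c) s' T₂ post (mid s')) :
    Trans W A S (.loop e c) s (T₁ + T₂ + 1) post r := by
  intro k t hp
  have : loss W A S (T₁ + (T₂ + t) + 1) (.loop e c :: k, s) =
      loss W A S (T₁ + (T₂ + t)) (c :: .loop e c :: k, s) := by
    rw [loss, runFrom_succ]; simp [step, loss, he]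
  rw [show T₁ + T₂ + 1 + t = T₁ + (T₂ + t) + 1 by omega, this]
  exact h₁ _ _ fun s' => h₂ s' k t hp

theorem Trans.loop_false (he : e.eval W A s = 0) (hr : post s ≤ r) :
    Trans W A S (.loop e c) s 1 post r :=
  Trans.of_runs (Q := fun s' => s' = s) ⟨1, le_rfl, s, .loop_false he, rfl⟩ (by rintro _ rfl; exact hr)

theorem Trans.one : Trans W A S c s T post 1 := fun _ _ _ => loss_le_one _ _ _ _ _

theorem loss_rand {m x : ℕ} (he : e.eval W A s = m + 1) (t : ℕ) (k : List Cmd) :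
    loss W A S (t + 1) (.rand x e :: k, s) =
      ∑ v : Fin (m + 1), ((m + 1 : ℕ) : ℝ≥0∞)⁻¹ * loss W A S t (k, s.setVar x v) := by
  have : runFrom W A (t + 1) (.rand x e :: k, s) =
      (PMF.uniformOfFintype (Fin (m + 1))).bind
        (fun v => runFrom W A t (k, s.setVar x v)) := by
    rw [runFrom_succ]
    simp [step, he, uniformBelow, PMF.map, PMF.bind_bind, PMF.pure_bind]
  rw [loss, this, PMF.toOuterMeasure_bind_apply, tsum_fintype]
  simp [PMF.uniformOfFintype_apply, loss]

/-- The average of `p` over all lists of length `k` with entries below `q`. -/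
noncomputable def avgList (q : ℕ) : ℕ → (List ℕ → ℝ≥0∞) → ℝ≥0∞
  | 0, p => p []
  | k + 1, p => ∑ v ∈ Finset.range q, (q : ℝ≥0∞)⁻¹ * avgList q k (fun l => p (v :: l))

theorem avgList_mono {q : ℕ} (k : ℕ) {p p' : List ℕ → ℝ≥0∞}
    (h : ∀ l, l.length = k → (∀ v ∈ l, v < q) → p l ≤ p' l) : avgList q k p ≤ avgList q k p' := by
  induction k generalizing p p' with
  | zero => exact h [] rfl (by simp)
  | succ k ih =>
    refine Finset.sum_le_sum fun v hv => ?_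
    gcongr
    exact ih fun l hl hl' => h (v :: l) (by simp [hl]) (by
      simpa using ⟨Finset.mem_range.1 hv, hl'⟩)

/-- Fills cells `0, …, (value of y) - 1` of the array `a` with random numbers below the value of
the variable `z`, using `x` as a counter and `w` for the number drawn. -/
def Cmd.fill (a x y z w : ℕ) : Cmd :=
  Cmd.forLt x y (.seq (.rand w (.var z)) (.store a (.var x) (.var w)))

/-- The state `s'` results from `s` by filling the array `a` with `l`. -/
def Filled (a x w : ℕ) (l : List ℕ) (s s' : Store) : Prop :=
  (∀ z, z ≠ x → z ≠ w → s'.vars z = s.vars z) ∧ (∀ b, b ≠ a → s'.arrays b = s.arrays b) ∧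
    ∀ (j : ℕ) (h : j < l.length), s'.arrays a j = l[j]

theorem Trans.fill {a x y z w N q : ℕ} {p : List ℕ → ℝ≥0∞} (hW : 1 < W) (hN : s.vars y = N)
    (hNW : N < W) (hq : s.vars z = q) (hq0 : 0 < q) (hxy : x ≠ y) (hxz : x ≠ z) (hxw : x ≠ w)
    (hwy : w ≠ y) (hwz : w ≠ z)
    (hp : ∀ l s', l.length = N → (∀ v ∈ l, v < q) → Filled a x w l s s' → post s' ≤ p l) :
    Trans W A S (Cmd.fill a x y z w) s (N * 6 + 3) post (avgList q N p) := by
  -- The numbers already drawn are fixed in the cells below `i`, and `p'` is the bound as a function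
  -- of the `d` numbers still to come.
  have key : ∀ d i s' (p' : List ℕ → ℝ≥0∞), i + d = N → s'.vars x = i → s'.vars y = N →
      s'.vars z = q →
      (∀ l s'', l.length = d → (∀ v ∈ l, v < q) → (∀ z, z ≠ x → z ≠ w → s''.vars z = s'.vars z) →
        (∀ b, b ≠ a → s''.arrays b = s'.arrays b) → (∀ j < i, s''.arrays a j = s'.arrays a j) →
        (∀ (j : ℕ) (h : j < l.length), s''.arrays a (i + j) = l[j]) → post s'' ≤ p' l) →
      Trans W A S (.loop (.bin .lt (.var x) (.var y))
        (.seq (.seq (.rand w (.var z)) (.store a (.var x) (.var w)))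
          (.assign x (.bin .add (.var x) (.const 1))))) s' (d * 6 + 1) post (avgList q d p') := by
    intro d
    induction d with
    | zero =>
      intro i s' p' hi hx hy hz hp'
      refine Trans.loop_false ?_ (hp' [] s' rfl (by simp) (fun _ _ _ => rfl) (fun _ _ => rfl)
        (fun _ _ => rfl) (by simp))
      rw [eval_lt_var _ _ _ hW, hx, hy, if_neg (by omega)]
    | succ d ih =>
      intro i s' p' hi hx hy hz hp' k t hpost
      obtain ⟨m, rfl⟩ : ∃ m, q = m + 1 := ⟨q - 1, by omega⟩
      have hlt : (Expr.bin .lt (.var x) (.var y)).eval W A s' ≠ 0 := by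
        rw [eval_lt_var _ _ _ hW, hx, hy, if_pos (by omega)]; exact one_ne_zero
      -- One iteration costs six steps: the loop test, two unfoldings of `seq`, the draw, the store
      -- and the increment.
      have hstep : loss W A S ((d * 6 + 1 + t + 1 + 1 + 1 + 1 + 1 + 1))
          (.loop (.bin .lt (.var x) (.var y))
          (.seq (.seq (.rand w (.var z)) (.store a (.var x) (.var w)))
          (.assign x (.bin .add (.var x) (.const 1)))) :: k, s') =
          ∑ v : Fin (m + 1), ((m + 1 : ℕ) : ℝ≥0∞)⁻¹ * loss W A S (d * 6 + 1 + t)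
            (.loop (.bin .lt (.var x) (.var y))
            (.seq (.seq (.rand w (.var z)) (.store a (.var x) (.var w)))
            (.assign x (.bin .add (.var x) (.const 1)))) :: k,
            (((s'.setVar w v).setCell a i v).setVar x (i + 1))) := by
        rw [loss, runFrom_succ, step, if_pos hlt, PMF.pure_bind, ← loss, loss_seq, loss_seq,
          loss_rand (m := m) (by simpa [Expr.eval] using hz)]
        refine Finset.sum_congr rfl fun v _ => ?_
        congr 1
        rw [loss, runFrom_succ, step, PMF.pure_bind, runFrom_succ, step, PMF.pure_bind, ← loss]
        simp [Expr.eval, BinOp.eval, hxw, hx, Nat.mod_eq_of_lt hW,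
          Nat.mod_eq_of_lt (show i + 1 < W by omega)]
      rw [show (d + 1) * 6 + 1 + t = d * 6 + 1 + t + 1 + 1 + 1 + 1 + 1 + 1 by ring, hstep, avgList,
        Finset.sum_range]
      refine Finset.sum_le_sum fun v _ => ?_
      gcongr
      refine ih (i + 1) _ (fun l => p' (v :: l)) (by omega) (by simp) ?_ ?_ ?_ k t hpost
      · simp [Ne.symm hxy, Ne.symm hwy, hy]
      · simp [Ne.symm hxz, Ne.symm hwz, hz]
      · intro l s'' hl hv h1 h2 h3 h4
        refine hp' (v :: l) s'' (by simp [hl]) (List.forall_mem_cons.2 ⟨v.2, hv⟩) ?_ ?_ ?_ ?_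
        · intro z' hz1 hz2; rw [h1 z' hz1 hz2]; simp [hz1, hz2]
        · intro b hb; rw [h2 b hb, Store.arrays_setVar, Store.arrays_setCell_ne _ _ _ hb]; rfl
        · intro j hj; rw [h3 j (by omega)]; simp [hj.ne]
        · intro j hj
          cases j with
          | zero => rw [Nat.add_zero, h3 i (by omega)]; simp
          | succ j =>
            have := h4 j (by simpa using hj)
            rw [show i + (j + 1) = i + 1 + j by omega, this]; simp
  intro k t hpost
  have := key N 0 (s.setVar x 0) p (by omega) (by simp) (by simp [Ne.symm hxy, hN])
    (by simp [Ne.symm hxz, hq]) ?_ k t hpost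
  · rw [show N * 6 + 3 + t = N * 6 + 1 + t + 1 + 1 by ring, Cmd.fill, Cmd.forLt, loss_seq, loss,
      runFrom_succ, step, PMF.pure_bind, ← loss]
    simpa [Expr.eval] using this
  · intro l s' hl hv h1 h2 h3 h4
    refine hp l s' hl hv ⟨fun z' hz1 hz2 => by rw [h1 z' hz1 hz2]; simp [hz1], fun b hb => ?_,
      fun j hj => by simpa using h4 j hj⟩
    rw [h2 b hb]; rfl

end Loss

end RandomRAM

/-! ### Increasing subsequences -/

section Inc

open Finset

/-- A key that breaks ties: the increasing subsequences of `A` are those of the keys, and different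
positions have different keys. -/
def tieKey {n : ℕ} (A : Fin n → ℤ) (p : ℕ) : ℤ := if h : p < n then A ⟨p, h⟩ * n - p else 0

/-- Scaling by `n` separates different entries by at least `n`, while the subtracted positions
differ by less than `n`; equal entries get keys that decrease with the position, so a tie never
counts as an increase. -/
theorem tieKey_lt_iff {n : ℕ} (A : Fin n → ℤ) {i j : ℕ} (hij : i < j) (hj : j < n) :
    tieKey A i < tieKey A j ↔ A ⟨i, hij.trans hj⟩ < A ⟨j, hj⟩ := by
  rw [tieKey, tieKey, dif_pos (hij.trans hj), dif_pos hj]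
  constructor
  · intro h
    by_contra! h'
    have : A ⟨j, hj⟩ * n ≤ A ⟨i, hij.trans hj⟩ * n := by gcongr
    omega
  · intro h
    have : (A ⟨i, hij.trans hj⟩ + 1) * n ≤ A ⟨j, hj⟩ * n := by gcongr; omega
    have h2 : (A ⟨i, hij.trans hj⟩ + 1) * n = A ⟨i, hij.trans hj⟩ * n + n := by ring
    omega

theorem tieKey_ne {n : ℕ} (A : Fin n → ℤ) {i j : ℕ} (hij : i < j) (hj : j < n) :
    tieKey A i ≠ tieKey A j := by
  rw [tieKey, tieKey, dif_pos (hij.trans hj), dif_pos hj]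
  intro h
  have h1 : (A ⟨i, hij.trans hj⟩ - A ⟨j, hj⟩) * n = i - j := by linarith
  rcases lt_trichotomy (A ⟨i, hij.trans hj⟩) (A ⟨j, hj⟩) with h' | h' | h'
  · have : (A ⟨i, hij.trans hj⟩ + 1) * n ≤ A ⟨j, hj⟩ * n := by gcongr; omega
    have h2 : (A ⟨i, hij.trans hj⟩ + 1) * n = A ⟨i, hij.trans hj⟩ * n + n := by ring
    omega
  · rw [h'] at h; omega
  · have : A ⟨j, hj⟩ * n ≤ A ⟨i, hij.trans hj⟩ * n := by gcongr
    omega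

/-- The machine can only compare input entries, so this reduces key comparison to such comparisons;
`Expr.leKey` implements the right-hand side. -/
theorem tieKey_le_iff {n : ℕ} (A : Fin n → ℤ) {i j : ℕ} (hi : i < n) (hj : j < n) :
    tieKey A i ≤ tieKey A j ↔ if i < j then A ⟨i, hi⟩ < A ⟨j, hj⟩ else ¬ A ⟨j, hj⟩ < A ⟨i, hi⟩ := by
  split_ifs with h
  · rw [← tieKey_lt_iff A h hj]
    exact ⟨fun h' => lt_of_le_of_ne h' (tieKey_ne A h hj), le_of_lt⟩
  · rcases (not_lt.1 h).eq_or_lt with rfl | h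
    · simp
    · rw [← tieKey_lt_iff A h hi, not_lt]

/-- The largest size of a subset of `I` on which `f` is strictly increasing. -/
noncomputable def maxInc (f : ℕ → ℤ) (I : Finset ℕ) : ℕ := by
  classical
  exact (I.powerset.filter fun s : Finset ℕ => StrictMonoOn f (s : Set ℕ)).sup card

theorem card_le_maxInc {f : ℕ → ℤ} {I s : Finset ℕ} (hs : s ⊆ I)
    (hf : StrictMonoOn f (s : Set ℕ)) : s.card ≤ maxInc f I := by
  classical
  exact le_sup (f := card) (mem_filter.2 ⟨mem_powerset.2 hs, hf⟩)

theorem exists_card_eq_maxInc (f : ℕ → ℤ) (I : Finset ℕ) :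
    ∃ s ⊆ I, StrictMonoOn f (s : Set ℕ) ∧ s.card = maxInc f I := by
  classical
  obtain ⟨s, hs, h⟩ := exists_mem_eq_sup
    (I.powerset.filter fun s : Finset ℕ => StrictMonoOn f (s : Set ℕ))
    ⟨∅, mem_filter.2 ⟨by simp, by simp [StrictMonoOn]⟩⟩ card
  rw [mem_filter, mem_powerset] at hs
  exact ⟨s, hs.1, hs.2, h.symm⟩

theorem maxInc_mono {f : ℕ → ℤ} {I J : Finset ℕ} (h : I ⊆ J) : maxInc f I ≤ maxInc f J := by
  obtain ⟨s, hs, hf, hc⟩ := exists_card_eq_maxInc f I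
  exact hc ▸ card_le_maxInc (hs.trans h) hf

theorem maxInc_le_card (f : ℕ → ℤ) (I : Finset ℕ) : maxInc f I ≤ I.card := by
  obtain ⟨s, hs, -, hc⟩ := exists_card_eq_maxInc f I
  exact hc ▸ card_le_card hs

theorem lis_eq_maxInc {n : ℕ} (A : Fin n → ℤ) : lis A = maxInc (tieKey A) (range n) := by
  classical
  apply le_antisymm
  · refine Finset.sup_le fun s hs => ?_
    have hs' : StrictMonoOn A (s : Set (Fin n)) := (mem_filter.1 hs).2
    rw [← card_map Fin.valEmbedding]
    refine card_le_maxInc (fun p hp => ?_) ?_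
    · obtain ⟨a, -, rfl⟩ := mem_map.1 hp
      exact mem_range.2 a.2
    · intro a ha b hb hab
      obtain ⟨a, ha', rfl⟩ := mem_map.1 (mem_coe.1 ha)
      obtain ⟨b, hb', rfl⟩ := mem_map.1 (mem_coe.1 hb)
      exact (tieKey_lt_iff A hab b.2).2 (hs' ha' hb' hab)
  · obtain ⟨s, hs, hf, hc⟩ := exists_card_eq_maxInc (tieKey A) (range n)
    rw [← hc]
    have hlt : ∀ p ∈ s, p < n := fun p hp => mem_range.1 (hs hp)
    rw [← card_attachFin s hlt]
    refine le_sup (f := card) (mem_filter.2 ⟨mem_univ _, ?_⟩)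
    intro a ha b hb hab
    rw [mem_coe, mem_attachFin] at ha hb
    exact (tieKey_lt_iff A hab b.2).1 (hf ha hb hab)

theorem lis_pos {n : ℕ} (hn : 0 < n) (A : Fin n → ℤ) : 0 < lis A := by
  rw [lis_eq_maxInc]
  refine lt_of_lt_of_le ?_ (card_le_maxInc (s := {0}) (by simpa using hn) (by simp [StrictMonoOn]))
  simp

theorem lis_le {n : ℕ} (A : Fin n → ℤ) : lis A ≤ n := by
  rw [lis_eq_maxInc]
  exact (maxInc_le_card _ _).trans (by simp)

end Inc

/-! ### Chains of intervals -/

section Chains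

open Finset

variable {lo hi : ℕ → ℤ} {alive : ℕ → Prop} {m len : ℕ} {F : ℕ → ℕ}

/-- The intervals `(lo t, hi t]`, `t ∈ C`, are ordered like their indices. -/
def IsIntervalChain (lo hi : ℕ → ℤ) (C : Finset ℕ) : Prop :=
  ∀ t ∈ C, ∀ t' ∈ C, t < t' → hi t ≤ lo t'

/-- `F t` is the largest length of a chain of alive intervals that ends with the interval `t`,
and `len` is the largest of these lengths. -/
structure IsHeight (lo hi : ℕ → ℤ) (alive : ℕ → Prop) (m : ℕ) (F : ℕ → ℕ) (len : ℕ) : Prop where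
  pos : ∀ t < m, alive t → 0 < F t
  dead : ∀ t < m, ¬ alive t → F t = 0
  step : ∀ t < m, alive t → ∀ t' < t, alive t' → hi t' ≤ lo t → F t' < F t
  pred : ∀ t < m, alive t → 1 < F t → ∃ t' < t, alive t' ∧ hi t' ≤ lo t ∧ F t' + 1 = F t
  le : ∀ t < m, F t ≤ len
  top : 0 < len → ∃ t < m, alive t ∧ F t = len

/-- Heights strictly increase along a chain and take values between 1 and `len`. -/
theorem IsHeight.card_le (h : IsHeight lo hi alive m F len) {C : Finset ℕ}
    (hm : ∀ t ∈ C, t < m) (ha : ∀ t ∈ C, alive t) (hC : IsIntervalChain lo hi C) :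
    C.card ≤ len := by
  have hmono : ∀ t ∈ C, ∀ t' ∈ C, t < t' → F t < F t' := fun t ht t' ht' htt =>
    h.step t' (hm _ ht') (ha _ ht') t htt (ha _ ht) (hC t ht t' ht' htt)
  have : C.card ≤ (Icc 1 len).card := by
    refine card_le_card_of_injOn F (fun t ht => ?_) ?_
    · exact mem_coe.2 (mem_Icc.2 ⟨h.pos t (hm t ht) (ha t ht), h.le t (hm t ht)⟩)
    · intro t ht t' ht' heq
      rcases lt_trichotomy t t' with hlt | rfl | hlt
      · exact absurd heq (hmono t ht t' ht' hlt).ne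
      · rfl
      · exact absurd heq (hmono t' ht' t ht hlt).ne'
  simpa using this

theorem IsHeight.exists_chain (h : IsHeight lo hi alive m F len)
    (hle : ∀ t < m, alive t → lo t ≤ hi t) :
    ∃ C : Finset ℕ, (∀ t ∈ C, t < m ∧ alive t) ∧ IsIntervalChain lo hi C ∧ C.card = len := by
  rcases Nat.eq_zero_or_pos len with rfl | hpos
  · exact ⟨∅, by simp, by simp [IsIntervalChain], rfl⟩
  -- A chain is built by following `pred` downwards. All its right ends are kept at most `hi t`, so
  -- that the next interval, which starts above `hi t`, fits after every member and not just the
  -- last.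
  have key : ∀ k t, t < m → alive t → F t = k + 1 → ∃ C : Finset ℕ,
      (∀ t' ∈ C, t' < m ∧ alive t' ∧ t' ≤ t ∧ hi t' ≤ hi t) ∧ IsIntervalChain lo hi C ∧
        C.card = k + 1 := by
    intro k
    induction k with
    | zero =>
      intro t ht ha hF
      exact ⟨{t}, by simp [ht, ha], by simp [IsIntervalChain], rfl⟩
    | succ k ih =>
      intro t ht ha hF
      obtain ⟨t', ht', ha', hhi, hF'⟩ := h.pred t ht ha (by omega)
      obtain ⟨C, hC, hCc, hcard⟩ := ih t' (by omega) ha' (by omega)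
      have htC : t ∉ C := fun hmem => by have := (hC t hmem).2.2.1; omega
      refine ⟨insert t C, ?_, ?_, by rw [card_insert_of_notMem htC, hcard]⟩
      · intro u hu
        rcases mem_insert.1 hu with rfl | hu
        · exact ⟨ht, ha, le_rfl, le_rfl⟩
        · obtain ⟨h1, h2, h3, h4⟩ := hC u hu
          exact ⟨h1, h2, by omega, h4.trans (hhi.trans (hle t ht ha))⟩
      · intro u hu v hv huv
        rcases mem_insert.1 hu with hu' | hu'
        · rcases mem_insert.1 hv with hv' | hv'
          · omega
          · have := (hC v hv').2.2.1; omega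
        · rcases mem_insert.1 hv with hv' | hv'
          · rw [hv']; exact (hC u hu').2.2.2.trans hhi
          · exact hCc u hu' v hv' huv
  obtain ⟨t, ht, ha, hF⟩ := h.top hpos
  obtain ⟨C, hC, hCc, hcard⟩ := key (len - 1) t ht ha (by omega)
  exact ⟨C, fun t' ht' => ⟨(hC t' ht').1, (hC t' ht').2.1⟩, hCc, by omega⟩

/-- For points instead of intervals, the longest chain is a longest increasing subsequence. -/
theorem IsHeight.len_eq_maxInc {f : ℕ → ℤ} {b : ℕ}
    (hf : ∀ i < m, ∀ j < m, i < j → f (b + i) ≠ f (b + j))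
    (hlo : ∀ t < m, lo t = f (b + t)) (hhi : ∀ t < m, hi t = f (b + t))
    (h : IsHeight lo hi alive m F len) {I : Finset ℕ}
    (hI : ∀ p, p ∈ I ↔ ∃ t < m, alive t ∧ p = b + t) : len = maxInc f I := by
  classical
  apply le_antisymm
  · obtain ⟨C, hC, hCc, hcard⟩ := h.exists_chain fun t ht _ => by rw [hlo t ht, hhi t ht]
    rw [← hcard, ← card_map (addLeftEmbedding b)]
    refine card_le_maxInc (fun p hp => ?_) ?_
    · obtain ⟨t, ht, rfl⟩ := mem_map.1 hp
      exact (hI _).2 ⟨t, (hC t ht).1, (hC t ht).2, rfl⟩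
    · intro u hu v hv huv
      obtain ⟨t, ht, rfl⟩ := mem_map.1 (mem_coe.1 hu)
      obtain ⟨t', ht', rfl⟩ := mem_map.1 (mem_coe.1 hv)
      simp only [addLeftEmbedding_apply] at huv ⊢
      have := hCc t ht t' ht' (by omega)
      rw [hhi t (hC t ht).1, hlo t' (hC t' ht').1] at this
      exact lt_of_le_of_ne this (hf _ (hC t ht).1 _ (hC t' ht').1 (by omega))
  · obtain ⟨s, hs, hsf, hcard⟩ := exists_card_eq_maxInc f I
    have hs' : ∀ p ∈ s, b ≤ p ∧ p - b < m ∧ alive (p - b) := by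
      intro p hp
      obtain ⟨t, ht, ha, rfl⟩ := (hI p).1 (hs hp)
      simpa using ⟨ht, ha⟩
    rw [← hcard, ← card_image_of_injOn (f := fun p => p - b) (fun u hu v hv huv => by
      have := (hs' u hu).1; have := (hs' v hv).1; simp only at huv; omega)]
    refine h.card_le ?_ ?_ ?_
    · intro t ht
      obtain ⟨p, hp, rfl⟩ := mem_image.1 ht
      exact (hs' p hp).2.1
    · intro t ht
      obtain ⟨p, hp, rfl⟩ := mem_image.1 ht
      exact (hs' p hp).2.2
    · intro t ht t' ht' htt
      obtain ⟨p, hp, rfl⟩ := mem_image.1 ht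
      obtain ⟨p', hp', rfl⟩ := mem_image.1 ht'
      obtain ⟨hp1, hp2, -⟩ := hs' p hp
      obtain ⟨hp1', hp2', -⟩ := hs' p' hp'
      rw [hhi _ hp2, hlo _ hp2', show b + (p - b) = p by omega, show b + (p' - b) = p' by omega]
      exact (hsf hp hp' (by omega)).le

/-- After `x` rounds of extracting longest chains from the intervals with `lo ≤ hi`: colour `0`
marks the intervals that remain, `y + 1` those of the `y`th chain, `X + 1` the discarded ones. -/
structure IsColouring (lo hi : ℕ → ℤ) (m X x : ℕ) (col : ℕ → ℕ) : Prop where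
  le : ∀ t < m, col t ≤ x ∨ col t = X + 1
  discard : ∀ t < m, col t = X + 1 ↔ ¬ lo t ≤ hi t
  chain : ∀ y < x, IsIntervalChain lo hi ((range m).filter fun t => col t = y + 1)
  card_le : ∀ C : Finset ℕ, (∀ t ∈ C, t < m ∧ col t = 0) → IsIntervalChain lo hi C →
    ∀ y < x, C.card ≤ ((range m).filter fun t => col t = y + 1).card

variable {X x : ℕ} {col col' : ℕ → ℕ}

/-- Extraction only shrinks the set of uncoloured intervals, so the maximality of earlier colours
persists, and the new colour is maximal because its size is the greatest height. -/
theorem IsColouring.succ (h : IsColouring lo hi m X x col) (hx : x < X)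
    (hF : IsHeight lo hi (fun t => col t = 0) m F len) {C : Finset ℕ}
    (hC : ∀ t ∈ C, t < m ∧ col t = 0) (hchain : IsIntervalChain lo hi C) (hcard : C.card = len)
    (hcol : ∀ t < m, col' t = if t ∈ C then x + 1 else col t) :
    IsColouring lo hi m X (x + 1) col' := by
  classical
  have hold : ∀ y < x, (range m).filter (fun t => col' t = y + 1) =
      (range m).filter fun t => col t = y + 1 := by
    intro y hy
    refine filter_congr fun t ht => ?_
    rw [hcol t (mem_range.1 ht)]
    split_ifs with htC
    · rw [(hC t htC).2]; omega
    · rfl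
  have hnew : (range m).filter (fun t => col' t = x + 1) = C := by
    ext t
    rw [mem_filter, mem_range]
    constructor
    · rintro ⟨ht, hc⟩
      rw [hcol t ht] at hc
      split_ifs at hc with htC
      · exact htC
      · have := h.le t ht; omega
    · intro htC
      exact ⟨(hC t htC).1, by rw [hcol t (hC t htC).1, if_pos htC]⟩
  refine ⟨fun t ht => ?_, fun t ht => ?_, fun y hy => ?_, fun D hD hDc y hy => ?_⟩
  · rw [hcol t ht]
    split_ifs
    · exact Or.inl le_rfl
    · have := h.le t ht; omega
  · rw [hcol t ht, ← h.discard t ht]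
    split_ifs with htC
    · rw [(hC t htC).2]; omega
    · rfl
  · rcases Nat.lt_succ_iff_lt_or_eq.1 hy with hy | rfl
    · rw [hold y hy]; exact h.chain y hy
    · rw [hnew]; exact hchain
  · have hD' : ∀ t ∈ D, t < m ∧ col t = 0 := by
      intro t ht
      refine ⟨(hD t ht).1, ?_⟩
      have := (hD t ht).2
      rw [hcol t (hD t ht).1] at this
      split_ifs at this
      exact this
    rcases Nat.lt_succ_iff_lt_or_eq.1 hy with hy | rfl
    · rw [hold y hy]; exact h.card_le D hD' hDc y hy
    · rw [hnew, hcard]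
      exact hF.card_le (fun t ht => (hD' t ht).1) (fun t ht => (hD' t ht).2) hDc

/-- The `X` colour classes are disjoint subsets of `range m`, each at least as large as an
uncoloured chain. This is the reason for extracting longest chains. -/
theorem IsColouring.card_mul_le (h : IsColouring lo hi m X X col) {C : Finset ℕ}
    (hC : ∀ t ∈ C, t < m ∧ col t = 0) (hchain : IsIntervalChain lo hi C) : C.card * X ≤ m := by
  calc C.card * X = ∑ y ∈ range X, C.card := by simp [mul_comm]
    _ ≤ ∑ y ∈ range X, ((range m).filter fun t => col t = y + 1).card :=
      sum_le_sum fun y hy => h.card_le C hC hchain y (mem_range.1 hy)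
    _ = ((range X).biUnion fun y => (range m).filter fun t => col t = y + 1).card := by
      rw [card_biUnion]
      intro y _ z _ hyz
      refine disjoint_filter.2 fun t _ h1 h2 => hyz (by omega)
    _ ≤ (range m).card := card_le_card (biUnion_subset.2 fun y _ => filter_subset _ _)
    _ = m := card_range m

end Chains

/-! ### Cells spanned by samples, and their chains -/

section Cells

open Finset

/-- The positions of column `i` (of width `q`) in the hull of the intervals of colour `x + 1` that
belong to column `i` (which has `s²` intervals). -/
noncomputable def hullRegion (f : ℕ → ℤ) (clo chi col : ℕ → ℕ) (q s x i : ℕ) : Finset ℕ := by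
  classical
  exact (Ico (i * q) (i * q + q)).filter fun p =>
    (∃ r < s * s, col (i * (s * s) + r) = x + 1 ∧ f (clo (i * (s * s) + r)) < f p) ∧
      ∃ r < s * s, col (i * (s * s) + r) = x + 1 ∧ f p ≤ f (chi (i * (s * s) + r))

theorem mem_hullRegion {f : ℕ → ℤ} {clo chi col : ℕ → ℕ} {q s x i p : ℕ} :
    p ∈ hullRegion f clo chi col q s x i ↔ (i * q ≤ p ∧ p < i * q + q) ∧
    (∃ r < s * s, col (i * (s * s) + r) = x + 1 ∧ f (clo (i * (s * s) + r)) < f p) ∧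
      ∃ r < s * s, col (i * (s * s) + r) = x + 1 ∧ f p ≤ f (chi (i * (s * s) + r)) := by
  classical
  rw [hullRegion, mem_filter, mem_Ico]

/-- The quality of colour `x` in column `i`. -/
noncomputable def quality (f : ℕ → ℤ) (clo chi col : ℕ → ℕ) (q s x i : ℕ) : ℕ :=
  maxInc f (hullRegion f clo chi col q s x i)

variable {f : ℕ → ℤ} {clo chi col : ℕ → ℕ} {q s X x : ℕ}

theorem quality_le (i : ℕ) : quality f clo chi col q s x i ≤ q := by
  classical
  refine (maxInc_le_card _ _).trans ?_
  refine (card_le_card (t := Ico (i * q) (i * q + q)) fun p hp => ?_).trans (by simp)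
  exact mem_Ico.2 (mem_hullRegion.1 hp).1

/-- Along a chain every right end lies below all later left ends, so the hull of the colour in one
column lies entirely below its hull in any later column. Optimal subsequences of the columns
therefore concatenate. -/
theorem sum_quality_le
    (h : IsColouring (fun t => f (clo t)) (fun t => f (chi t)) (q * (s * s)) X X col)
    (hx : x < X) :
    ∑ i ∈ range q, quality f clo chi col q s x i ≤ maxInc f (range (q * q)) := by
  classical
  choose S hS hSf hSc using fun i => exists_card_eq_maxInc f (hullRegion f clo chi col q s x i)
  have hcol : ∀ i p, p ∈ S i → i * q ≤ p ∧ p < i * q + q := fun i p hp =>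
    (mem_hullRegion.1 (hS i hp)).1
  have hlt : ∀ i < q, ∀ j < q, i < j → ∀ p ∈ S i, ∀ p' ∈ S j, p < p' ∧ f p < f p' := by
    intro i hi j hj hij p hp p' hp'
    obtain ⟨h1, -, r, hr, hc, hle⟩ := mem_hullRegion.1 (hS i hp)
    obtain ⟨h2, ⟨r', hr', hc', hle'⟩, -⟩ := mem_hullRegion.1 (hS j hp')
    have hq : i * q + q ≤ j * q := by
      calc i * q + q = (i + 1) * q := by ring
        _ ≤ j * q := Nat.mul_le_mul_right _ hij
    have hs1 : i * (s * s) + s * s ≤ j * (s * s) := by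
      calc i * (s * s) + s * s = (i + 1) * (s * s) := by ring
        _ ≤ j * (s * s) := Nat.mul_le_mul_right _ hij
    have hs2 : j * (s * s) + s * s ≤ q * (s * s) := by
      calc j * (s * s) + s * s = (j + 1) * (s * s) := by ring
        _ ≤ q * (s * s) := Nat.mul_le_mul_right _ hj
    refine ⟨by omega, ?_⟩
    have := h.chain x hx (i * (s * s) + r) (mem_filter.2 ⟨mem_range.2 (by omega), hc⟩)
      (j * (s * s) + r') (mem_filter.2 ⟨mem_range.2 (by omega), hc'⟩) (by omega)
    exact lt_of_le_of_lt hle (lt_of_le_of_lt this hle')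
  have hdisj : ∀ i ∈ range q, ∀ j ∈ range q, i ≠ j → Disjoint (S i) (S j) := by
    intro i hi j hj hij
    rw [Finset.disjoint_left]
    intro p hp hp'
    rcases lt_or_gt_of_ne hij with h' | h'
    · exact absurd (hlt i (mem_range.1 hi) j (mem_range.1 hj) h' p hp p hp').1 (lt_irrefl _)
    · exact absurd (hlt j (mem_range.1 hj) i (mem_range.1 hi) h' p hp' p hp).1 (lt_irrefl _)
  calc ∑ i ∈ range q, quality f clo chi col q s x i = ∑ i ∈ range q, (S i).card :=
        sum_congr rfl fun i _ => (hSc i).symm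
    _ = ((range q).biUnion S).card := (card_biUnion hdisj).symm
    _ ≤ _ := by
      refine card_le_maxInc (fun p hp => ?_) ?_
      · obtain ⟨i, hi, hp⟩ := mem_biUnion.1 hp
        have := hcol i p hp
        have : i * q + q ≤ q * q := by
          calc i * q + q = (i + 1) * q := by ring
            _ ≤ q * q := Nat.mul_le_mul_right _ (mem_range.1 hi)
        exact mem_range.2 (by omega)
      · intro p hp p' hp' hpp
        obtain ⟨i, hi, hp⟩ := mem_biUnion.1 (mem_coe.1 hp)
        obtain ⟨j, hj, hp'⟩ := mem_biUnion.1 (mem_coe.1 hp')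
        rcases lt_trichotomy i j with h' | rfl | h'
        · exact (hlt i (mem_range.1 hi) j (mem_range.1 hj) h' p hp p' hp').2
        · exact hSf i hp hp' hpp
        · have := (hlt j (mem_range.1 hj) i (mem_range.1 hi) h' p' hp' p hp).1
          omega

/-- The position of the `a`th sample of column `i`, for the sampled offsets `ω`. -/
def samplePos (q s : ℕ) (ω : ℕ → ℕ) (i a : ℕ) : ℕ := i * q + ω (i * s + a)

/-- The elements of `O` between the first and the last sampled element of `O` in their column. -/
noncomputable def retained (q s : ℕ) (ω : ℕ → ℕ) (O : Finset ℕ) : Finset ℕ := by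
  classical
  exact O.filter fun p =>
    (∃ a < s, samplePos q s ω (p / q) a ∈ O ∧ samplePos q s ω (p / q) a < p) ∧
      ∃ b < s, samplePos q s ω (p / q) b ∈ O ∧ p ≤ samplePos q s ω (p / q) b

theorem mem_retained {ω : ℕ → ℕ} {O : Finset ℕ} {p : ℕ} : p ∈ retained q s ω O ↔ p ∈ O ∧
    (∃ a < s, samplePos q s ω (p / q) a ∈ O ∧ samplePos q s ω (p / q) a < p) ∧
      ∃ b < s, samplePos q s ω (p / q) b ∈ O ∧ p ≤ samplePos q s ω (p / q) b := by
  classical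
  rw [retained, mem_filter]

/-- In every column with retained elements, the extreme samples from `O` span an interval containing
all of them, and since `O` is increasing these intervals form a chain. Columns whose interval stayed
uncoloured are few because uncoloured chains are short; each costs at most `q`. The retained
elements of any other column are an increasing subsequence in the hull of its colour, so its quality
covers them. -/
theorem card_retained_le {ω : ℕ → ℕ} (hω : ∀ j < q * s, ω j < q) {O : Finset ℕ}
    (hO : O ⊆ range (q * q)) (hOf : StrictMonoOn f (O : Set ℕ))
    (hclo : ∀ t < q * (s * s), clo t = samplePos q s ω (t / (s * s)) (t / s % s))
    (hchi : ∀ t < q * (s * s), chi t = samplePos q s ω (t / (s * s)) (t % s))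
    (h : IsColouring (fun t => f (clo t)) (fun t => f (chi t)) (q * (s * s)) X X col)
    {v : ℕ} (hv : ∀ x < X, ∑ i ∈ range q, quality f clo chi col q s x i ≤ v) :
    ∃ l, l * X ≤ q * (s * s) ∧ (retained q s ω O).card ≤ l * q + X * v := by
  classical
  set R := retained q s ω O with hR
  let Ri : ℕ → Finset ℕ := fun i => R.filter fun p => p / q = i
  have hq : ∀ p ∈ R, 0 < q := by
    intro p hp
    have := mem_range.1 (hO (mem_retained.1 hp).1)
    exact Nat.pos_of_ne_zero fun h0 => by simp [h0] at this
  have hdiv : ∀ p ∈ R, p / q < q := fun p hp =>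
    Nat.div_lt_of_lt_mul (mem_range.1 (hO (mem_retained.1 hp).1))
  -- the extreme samples of a column
  have hex : ∀ i, (Ri i).Nonempty → ∃ a < s, ∃ b < s, samplePos q s ω i a ∈ O ∧
      samplePos q s ω i b ∈ O ∧
      ∀ p ∈ Ri i, samplePos q s ω i a < p ∧ p ≤ samplePos q s ω i b := by
    intro i ⟨p, hp⟩
    obtain ⟨hpR, rfl⟩ := mem_filter.1 hp
    obtain ⟨-, ⟨a, ha, haO, hap⟩, b, hb, hbO, hbp⟩ := mem_retained.1 hpR
    obtain ⟨a', ha', hmin⟩ := exists_min_image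
      ((range s).filter fun a => samplePos q s ω (p / q) a ∈ O) (samplePos q s ω (p / q))
      ⟨a, mem_filter.2 ⟨mem_range.2 ha, haO⟩⟩
    obtain ⟨b', hb', hmax⟩ := exists_max_image
      ((range s).filter fun a => samplePos q s ω (p / q) a ∈ O) (samplePos q s ω (p / q))
      ⟨b, mem_filter.2 ⟨mem_range.2 hb, hbO⟩⟩
    rw [mem_filter, mem_range] at ha' hb'
    refine ⟨a', ha'.1, b', hb'.1, ha'.2, hb'.2, fun p' hp' => ?_⟩
    obtain ⟨hpR', hpi⟩ := mem_filter.1 hp'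
    obtain ⟨-, ⟨a₂, ha₂, haO₂, hap₂⟩, b₂, hb₂, hbO₂, hbp₂⟩ := mem_retained.1 hpR'
    rw [hpi] at haO₂ hap₂ hbO₂ hbp₂
    exact ⟨(hmin a₂ (mem_filter.2 ⟨mem_range.2 ha₂, haO₂⟩)).trans_lt hap₂,
      hbp₂.trans (hmax b₂ (mem_filter.2 ⟨mem_range.2 hb₂, hbO₂⟩))⟩
  choose! a ha b hb haO hbO hab using hex
  let I := (range q).filter fun i => (Ri i).Nonempty
  have hI : ∀ i ∈ I, i < q ∧ (Ri i).Nonempty := fun i hi => by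
    simpa [I] using hi
  -- The index of the interval from sample `a i` to sample `b i` of column `i`; the intervals are
  -- numbered by column and then by pair, in base `s`.
  let T : ℕ → ℕ := fun i => i * (s * s) + (a i * s + b i)
  have hr : ∀ i ∈ I, a i * s + b i < s * s := by
    intro i hi
    have h1 := ha i (hI i hi).2
    have h2 := hb i (hI i hi).2
    calc a i * s + b i < a i * s + s := by omega
      _ = (a i + 1) * s := by ring
      _ ≤ s * s := Nat.mul_le_mul_right _ h1
  have hTlt : ∀ i ∈ I, T i < q * (s * s) := by
    intro i hi
    have h1 := hr i hi
    calc T i < i * (s * s) + s * s := by simp only [T]; omega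
      _ = (i + 1) * (s * s) := by ring
      _ ≤ q * (s * s) := Nat.mul_le_mul_right _ (hI i hi).1
  have hTlo : ∀ i ∈ I, clo (T i) = samplePos q s ω i (a i) := by
    intro i hi
    have h1 := hr i hi
    have h2 := ha i (hI i hi).2
    have h3 := hb i (hI i hi).2
    rw [hclo _ (hTlt i hi)]
    congr 1
    · rw [show T i = (a i * s + b i) + i * (s * s) by simp only [T]; ring,
        Nat.add_mul_div_right _ _ (by omega), Nat.div_eq_of_lt h1, zero_add]
    · rw [show T i = b i + (a i + s * i) * s by simp only [T]; ring,
        Nat.add_mul_div_right _ _ (by omega), Nat.div_eq_of_lt h3, zero_add,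
        Nat.add_mul_mod_self_left, Nat.mod_eq_of_lt h2]
  have hThi : ∀ i ∈ I, chi (T i) = samplePos q s ω i (b i) := by
    intro i hi
    have h1 := hr i hi
    have h3 := hb i (hI i hi).2
    rw [hchi _ (hTlt i hi)]
    congr 1
    · rw [show T i = (a i * s + b i) + i * (s * s) by simp only [T]; ring,
        Nat.add_mul_div_right _ _ (by omega), Nat.div_eq_of_lt h1, zero_add]
    · rw [show T i = b i + (a i + s * i) * s by simp only [T]; ring,
        Nat.add_mul_mod_self_right, Nat.mod_eq_of_lt h3]
  have hRiO : ∀ i, ∀ p ∈ Ri i, p ∈ O ∧ p / q = i := fun i p hp =>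
    ⟨(mem_retained.1 (mem_filter.1 hp).1).1, (mem_filter.1 hp).2⟩
  have halive : ∀ i ∈ I, f (clo (T i)) ≤ f (chi (T i)) := by
    intro i hi
    rw [hTlo i hi, hThi i hi]
    obtain ⟨p, hp⟩ := (hI i hi).2
    have := hab i ⟨p, hp⟩ p hp
    exact (hOf (haO i ⟨p, hp⟩) (hbO i ⟨p, hp⟩) (by omega)).le
  have hTmono : ∀ i ∈ I, ∀ j ∈ I, i < j → T i < T j := by
    intro i hi j hj hij
    have h1 := hr i hi
    have : i * (s * s) + s * s ≤ j * (s * s) := by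
      calc i * (s * s) + s * s = (i + 1) * (s * s) := by ring
        _ ≤ j * (s * s) := Nat.mul_le_mul_right _ hij
    simp only [T]; omega
  have hωa : ∀ i ∈ I, ∀ a' < s, samplePos q s ω i a' < i * q + q := by
    intro i hi a' ha'
    have : i * s + a' < q * s := by
      calc i * s + a' < i * s + s := by omega
        _ = (i + 1) * s := by ring
        _ ≤ q * s := Nat.mul_le_mul_right _ (hI i hi).1
    have := hω _ this
    simp only [samplePos]; omega
  have hTchain : ∀ i ∈ I, ∀ j ∈ I, i < j → f (chi (T i)) ≤ f (clo (T j)) := by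
    intro i hi j hj hij
    rw [hThi i hi, hTlo j hj]
    refine (hOf (hbO i (hI i hi).2) (haO j (hI j hj).2) ?_).le
    have h1 := hωa i hi (b i) (hb i (hI i hi).2)
    have : i * q + q ≤ j * q := by
      calc i * q + q = (i + 1) * q := by ring
        _ ≤ j * q := Nat.mul_le_mul_right _ hij
    have h2 : j * q ≤ samplePos q s ω j (a j) := Nat.le_add_right _ _
    omega
  have hTinj : Set.InjOn T (I : Set ℕ) := by
    intro i hi j hj hij
    rcases lt_trichotomy i j with h' | h' | h'
    · exact absurd hij (hTmono i hi j hj h').ne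
    · exact h'
    · exact absurd hij (hTmono j hj i hi h').ne'
  -- The witness `l` is the number of columns whose interval was never coloured.
  let I₀ := I.filter fun i => col (T i) = 0
  refine ⟨I₀.card, ?_, ?_⟩
  · rw [← card_image_of_injOn (hTinj.mono fun i hi => (mem_filter.1 (mem_coe.1 hi)).1)]
    refine h.card_mul_le (fun t ht => ?_) ?_
    · obtain ⟨i, hi, rfl⟩ := mem_image.1 ht
      exact ⟨hTlt i (mem_filter.1 hi).1, (mem_filter.1 hi).2⟩
    · intro t ht t' ht' htt
      obtain ⟨i, hi, rfl⟩ := mem_image.1 ht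
      obtain ⟨j, hj, rfl⟩ := mem_image.1 ht'
      have hi := (mem_filter.1 hi).1
      have hj := (mem_filter.1 hj).1
      rcases lt_trichotomy i j with h' | h' | h'
      · exact hTchain i hi j hj h'
      · subst h'; omega
      · have := hTmono j hj i hi h'; omega
  · have hRcard : R.card = ∑ i ∈ range q, (Ri i).card :=
      card_eq_sum_card_fiberwise fun p hp => mem_coe.2 (mem_range.2 (hdiv p hp))
    have hRiq : ∀ i, (Ri i).card ≤ q := by
      intro i
      refine (card_le_card (t := Ico (i * q) (i * q + q)) fun p hp => ?_).trans (by simp)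
      have hp' := (mem_filter.1 hp)
      have := hq p hp'.1
      rw [mem_Ico, ← hp'.2]
      have h1 := Nat.div_add_mod p q
      have h2 := Nat.mod_lt p this
      rw [mul_comm] at h1
      omega
    have hsum : ∑ i ∈ range q, (Ri i).card = ∑ i ∈ I, (Ri i).card := by
      refine (sum_subset (filter_subset _ _) fun i hi hi' => ?_).symm
      rw [card_eq_zero, ← not_nonempty_iff_eq_empty]
      exact fun hne => hi' (mem_filter.2 ⟨hi, hne⟩)
    -- These intervals have their ends in the right order, so none of them was discarded.
    have hcolT : ∀ i ∈ I, col (T i) ≤ X := by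
      intro i hi
      rcases h.le (T i) (hTlt i hi) with h' | h'
      · exact h'
      · exact absurd (halive i hi) ((h.discard _ (hTlt i hi)).1 h')
    have hqual : ∀ i ∈ I, ∀ x, col (T i) = x + 1 →
        (Ri i).card ≤ quality f clo chi col q s x i := by
      intro i hi x hx
      refine card_le_maxInc (fun p hp => ?_) (hOf.mono fun p hp => (hRiO i p hp).1)
      obtain ⟨h1, h2⟩ := hab i (hI i hi).2 p hp
      have hpO := hRiO i p hp
      refine mem_hullRegion.2 ⟨?_, ⟨a i * s + b i, hr i hi, hx, ?_⟩, a i * s + b i, hr i hi, hx, ?_⟩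
      · have h3 := Nat.div_add_mod p q
        have h4 := Nat.mod_lt p (hq p (mem_filter.1 hp).1)
        rw [hpO.2, mul_comm] at h3
        omega
      · change f (clo (T i)) < f p
        rw [hTlo i hi]
        exact hOf (haO i (hI i hi).2) hpO.1 h1
      · change f p ≤ f (chi (T i))
        rw [hThi i hi]
        exact hOf.monotoneOn hpO.1 (hbO i (hI i hi).2) h2
    rw [hRcard, hsum, ← sum_filter_add_sum_filter_not I (fun i => col (T i) = 0)]
    refine Nat.add_le_add ?_ ?_
    · calc ∑ i ∈ I₀, (Ri i).card ≤ ∑ i ∈ I₀, q := sum_le_sum fun i _ => hRiq i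
        _ = I₀.card * q := by simp
    · calc ∑ i ∈ I.filter (fun i => ¬ col (T i) = 0), (Ri i).card
          = ∑ x ∈ range X, ∑ i ∈ (I.filter fun i => ¬ col (T i) = 0).filter
              (fun i => col (T i) - 1 = x), (Ri i).card := by
            refine (sum_fiberwise_of_maps_to (fun i hi => ?_) _).symm
            obtain ⟨hi, hne⟩ := mem_filter.1 hi
            have := hcolT i hi
            exact mem_range.2 (by omega)
        _ ≤ ∑ x ∈ range X, ∑ i ∈ range q, quality f clo chi col q s x i := by
            refine sum_le_sum fun x _ => ?_
            refine (sum_le_sum fun i hi => ?_).trans (sum_le_sum_of_subset (fun i hi => ?_))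
            · obtain ⟨hi, hx⟩ := mem_filter.1 hi
              obtain ⟨hi, hne⟩ := mem_filter.1 hi
              exact hqual i hi x (by omega)
            · obtain ⟨hi, hx⟩ := mem_filter.1 hi
              obtain ⟨hi, hne⟩ := mem_filter.1 hi
              exact mem_range.2 (hI i hi).1
        _ ≤ ∑ x ∈ range X, v := sum_le_sum fun x hx => hv x (mem_range.1 hx)
        _ = X * v := by simp

end Cells

namespace RandomRAM

open scoped ENNReal
open Finset

/-! ### Averages over independent uniform draws -/

section Average

variable {q : ℕ}

theorem avgList_const_mul (k : ℕ) (c : ℝ≥0∞) (p : List ℕ → ℝ≥0∞) :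
    avgList q k (fun l => c * p l) = c * avgList q k p := by
  induction k generalizing p with
  | zero => rfl
  | succ k ih =>
    simp only [avgList, ih, mul_sum]
    exact sum_congr rfl fun v _ => by ring

theorem avgList_add (k : ℕ) (p p' : List ℕ → ℝ≥0∞) :
    avgList q k (fun l => p l + p' l) = avgList q k p + avgList q k p' := by
  induction k generalizing p p' with
  | zero => rfl
  | succ k ih => simp only [avgList, ih, mul_add, sum_add_distrib]

theorem avgList_zero (k : ℕ) : avgList q k (fun _ => 0) = 0 := by
  induction k with
  | zero => rfl
  | succ k ih => simp [avgList, ih]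

theorem avgList_sum {ι : Type*} (k : ℕ) (s : Finset ι) (p : ι → List ℕ → ℝ≥0∞) :
    avgList q k (fun l => ∑ i ∈ s, p i l) = ∑ i ∈ s, avgList q k (p i) := by
  classical
  induction s using Finset.induction_on with
  | empty => simp [avgList_zero]
  | insert a s ha ih => simp only [sum_insert ha, avgList_add, ih]

/-- Independence of the coordinates. The default value of `getD` is never used, since only lists of
length `k` are averaged. -/
theorem avgList_prod (k : ℕ) (f : ℕ → ℕ → ℝ≥0∞) :
    avgList q k (fun l => ∏ j ∈ range k, f j (l.getD j 0)) =
      ∏ j ∈ range k, ∑ v ∈ range q, (q : ℝ≥0∞)⁻¹ * f j v := by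
  induction k generalizing f with
  | zero => simp [avgList]
  | succ k ih =>
    rw [prod_range_succ', avgList]
    simp only [prod_range_succ', List.getD_cons_succ, List.getD_cons_zero]
    simp only [mul_comm _ (f 0 _), avgList_const_mul]
    rw [ih fun j => f (j + 1), mul_comm, sum_mul]
    exact sum_congr rfl fun v _ => by ring

theorem avgList_one (hq : 0 < q) (k : ℕ) : avgList q k (fun _ => 1) = 1 := by
  have := avgList_prod (q := q) k fun _ _ => 1
  simpa [ENNReal.mul_inv_cancel, hq.ne'] using this

theorem avgList_const (hq : 0 < q) (k : ℕ) (c : ℝ≥0∞) : avgList q k (fun _ => c) = c := by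
  have := avgList_const_mul (q := q) k c fun _ => 1
  simpa [avgList_one hq] using this

/-- The average of a product over a block of coordinates. -/
theorem avgList_prod_block (hq : 0 < q) {k b N : ℕ} (h : b + N ≤ k) (f : ℕ → ℝ≥0∞) :
    avgList q k (fun l => ∏ y ∈ range N, f (l.getD (b + y) 0)) =
      (∑ v ∈ range q, (q : ℝ≥0∞)⁻¹ * f v) ^ N := by
  have hblock : ∀ F : ℕ → ℝ≥0∞, ∏ j ∈ range k, (if b ≤ j ∧ j < b + N then F j else 1) =
      ∏ y ∈ range N, F (b + y) := by
    intro F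
    rw [prod_ite, prod_const_one, mul_one]
    refine (prod_bij (fun y _ => b + y) (fun y hy => ?_) (fun _ _ _ _ h => by simpa using h)
      (fun j hj => ?_) (fun _ _ => rfl)).symm
    · have := mem_range.1 hy
      exact mem_filter.2 ⟨mem_range.2 (by omega), by omega⟩
    · have := mem_filter.1 hj
      exact ⟨j - b, mem_range.2 (by omega), by omega⟩
  -- Coordinates outside the block are given the factor 1, whose average is 1.
  have := avgList_prod (q := q) k fun j v => if b ≤ j ∧ j < b + N then f v else 1
  rw [show (fun l : List ℕ => ∏ y ∈ range N, f (l.getD (b + y) 0)) = fun l =>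
    ∏ j ∈ range k, (if b ≤ j ∧ j < b + N then f (l.getD j 0) else 1) from
    funext fun l => (hblock fun j => f (l.getD j 0)).symm, this]
  rw [← card_range N, ← prod_const, card_range,
    ← hblock fun _ => ∑ v ∈ range q, (q : ℝ≥0∞)⁻¹ * f v]
  refine prod_congr rfl fun j _ => ?_
  split_ifs
  · rfl
  · simp [ENNReal.mul_inv_cancel, hq.ne']

theorem sum_inv_mul_ofReal (hq : 0 < q) {f : ℕ → ℝ} (hf : ∀ v, 0 ≤ f v) :
    ∑ v ∈ range q, (q : ℝ≥0∞)⁻¹ * ENNReal.ofReal (f v) =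
      ENNReal.ofReal ((∑ v ∈ range q, f v) / q) := by
  rw [← mul_sum, ← ENNReal.ofReal_sum_of_nonneg fun v _ => hf v, ← ENNReal.ofReal_natCast q,
    ← ENNReal.ofReal_inv_of_pos (by exact_mod_cast hq), ← ENNReal.ofReal_mul (by positivity)]
  congr 1
  rw [div_eq_inv_mul]

end Average

/-! ### Exponential tail bounds for sampled sums -/

section Chernoff

variable {q k b N E S : ℕ} {g : ℕ → ℕ}

/-- The moment generating function: for z in [0,1], concavity of powers gives β^z ≤ 1 + (β−1)z, then
1 + x ≤ exp x, and independence multiplies the factors. -/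
theorem avgList_rpow_le (hq : 0 < q) (h : b + N ≤ k) (hg : ∀ v < q, g v ≤ q)
    (hS : S = ∑ v ∈ range q, g v) {β : ℝ} (hβ : 0 < β) :
    avgList q k (fun l => ∏ y ∈ range N, ENNReal.ofReal (β ^ ((g (l.getD (b + y) 0) : ℝ) / q))) ≤
      ENNReal.ofReal (Real.exp ((β - 1) * (N * (S / (q * q))))) := by
  have hq' : (0 : ℝ) < q := by exact_mod_cast hq
  rw [avgList_prod_block hq h fun v => ENNReal.ofReal (β ^ ((g v : ℝ) / q)),
    sum_inv_mul_ofReal hq fun v => by positivity, ← ENNReal.ofReal_pow (by positivity)]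
  apply ENNReal.ofReal_le_ofReal
  have h1 : (∑ v ∈ range q, β ^ ((g v : ℝ) / q)) / q ≤ 1 + (β - 1) * (S / (q * q)) := by
    rw [div_le_iff₀ hq']
    calc ∑ v ∈ range q, β ^ ((g v : ℝ) / q)
        ≤ ∑ v ∈ range q, (1 + (g v : ℝ) / q * (β - 1)) := by
          refine sum_le_sum fun v hv => ?_
          have hv' : (g v : ℝ) ≤ q := by exact_mod_cast hg v (mem_range.1 hv)
          have := rpow_one_add_le_one_add_mul_self (s := β - 1) (by linarith)
            (p := (g v : ℝ) / q) (by positivity) ((div_le_one hq').2 hv')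
          simpa using this
      _ = (1 + (β - 1) * (S / (q * q))) * q := by
          rw [sum_add_distrib, ← sum_mul, ← sum_div, hS]
          push_cast
          simp only [sum_const, card_range, nsmul_eq_mul]
          field_simp
  calc ((∑ v ∈ range q, β ^ ((g v : ℝ) / q)) / q) ^ N
      ≤ (Real.exp ((β - 1) * (S / (q * q)))) ^ N := by
        gcongr
        refine h1.trans ?_
        rw [add_comm]
        exact Real.add_one_le_exp _
    _ = _ := by rw [← Real.exp_nat_mul]; congr 1; ring

/-- Exponential Markov bound at the threshold 2E. It serves both tails: `β = 2` for large sums and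
`β = 1/2` for small ones. -/
theorem indicator_le_prod {β : ℝ} (hβ : 0 < β) (l : List ℕ) {P : Prop}
    [Decidable P]
    (hP : P → 1 ≤ β ^ ((∑ y ∈ range N, (g (l.getD (b + y) 0) : ℝ)) / q - 2 * E)) :
    (if P then 1 else 0 : ℝ≥0∞) ≤ ENNReal.ofReal (β ^ (-(2 * E : ℝ))) *
      ∏ y ∈ range N, ENNReal.ofReal (β ^ ((g (l.getD (b + y) 0) : ℝ) / q)) := by
  split_ifs with h
  · rw [← ENNReal.ofReal_prod_of_nonneg fun y _ => by positivity, ← ENNReal.ofReal_mul (by positivity),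
      ← Real.rpow_sum_of_pos hβ, ← Real.rpow_add hβ, ← sum_div]
    rw [← ENNReal.ofReal_one]
    apply ENNReal.ofReal_le_ofReal
    convert hP h using 2
    ring
  · exact zero_le

open Classical in
-- In units of `q` the mean is at most E/2 and the threshold is 2E, so with β = 2 the bound is
-- 2^(−2E)·exp(E/2), and exp(1/2) ≤ 2.
theorem avgList_large_le (hq : 0 < q) (h : b + N ≤ k) (hg : ∀ v < q, g v ≤ q)
    (hS : 2 * (N * ∑ v ∈ range q, g v) ≤ q * q * E) :
    avgList q k (fun l => if 2 * E * q ≤ ∑ y ∈ range N, g (l.getD (b + y) 0) then 1 else 0) ≤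
      ENNReal.ofReal ((1 / 2) ^ E) := by
  have hq' : (0 : ℝ) < q := by exact_mod_cast hq
  refine (avgList_mono k fun l _ _ => indicator_le_prod (E := E) (g := g) (N := N) (b := b) (q := q) (β := 2) two_pos l
    fun hP => ?_).trans ?_
  · apply Real.one_le_rpow one_le_two
    rw [sub_nonneg, le_div_iff₀ hq']
    exact_mod_cast hP
  · rw [avgList_const_mul]
    refine (mul_le_mul_right (avgList_rpow_le hq h hg rfl two_pos) _).trans ?_
    rw [← ENNReal.ofReal_mul (by positivity)]
    apply ENNReal.ofReal_le_ofReal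
    have h1 : ((2 : ℝ) - 1) * (N * ((∑ v ∈ range q, g v : ℕ) / (q * q))) ≤ E * (1 / 2) := by
      have : (2 : ℝ) * (N * (∑ v ∈ range q, g v : ℕ)) ≤ q * q * E := by exact_mod_cast hS
      rw [mul_div_assoc', mul_div_assoc', div_le_iff₀ (by positivity)]
      linarith
    calc (2 : ℝ) ^ (-(2 * E : ℝ)) * Real.exp ((2 - 1) * (N * ((∑ v ∈ range q, g v : ℕ) / (q * q))))
        ≤ (2 : ℝ) ^ (-(2 * E : ℝ)) * Real.exp (E * (1 / 2)) := by gcongr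
      _ ≤ (2 : ℝ) ^ (-(2 * E : ℝ)) * 2 ^ E := by
        rw [Real.exp_nat_mul]
        gcongr
        have := Real.exp_bound_div_one_sub_of_interval (x := 1 / 2) (by norm_num) (by norm_num)
        norm_num at this
        simpa using this
      _ = (1 / 2) ^ E := by
        rw [Real.rpow_neg two_pos.le, show (2 * E : ℝ) = ((2 * E : ℕ) : ℝ) by push_cast; ring,
          Real.rpow_natCast, one_div, inv_pow, two_mul, pow_add]
        field_simp

open Classical in
-- Here the mean is at least 8E in units of `q`. With β = 1/2 the bound is 4^E·exp(−4E) ≤ 4^(−E),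
-- using only e ≥ 2. A constant failure probability suffices because trials are repeated.
theorem avgList_small_le (hq : 0 < q) (h : b + N ≤ k) (hg : ∀ v < q, g v ≤ q) (hE : 0 < E)
    (hS : 8 * (q * q * E) ≤ N * ∑ v ∈ range q, g v) :
    avgList q k (fun l => if 2 * E * q ≤ ∑ y ∈ range N, g (l.getD (b + y) 0) then 0 else 1) ≤
      ENNReal.ofReal (1 / 4) := by
  have hq' : (0 : ℝ) < q := by exact_mod_cast hq
  have hflip : ∀ l : List ℕ, (if 2 * E * q ≤ ∑ y ∈ range N, g (l.getD (b + y) 0) then 0 else 1 :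
      ℝ≥0∞) = if ∑ y ∈ range N, g (l.getD (b + y) 0) < 2 * E * q then 1 else 0 := by
    intro l; by_cases h : 2 * E * q ≤ ∑ y ∈ range N, g (l.getD (b + y) 0)
    · rw [if_pos h, if_neg (not_lt.2 h)]
    · rw [if_neg h, if_pos (not_le.1 h)]
  simp only [hflip]
  refine (avgList_mono k fun l _ _ => indicator_le_prod (E := E) (g := g) (N := N) (b := b) (q := q) (β := 1 / 2) (by norm_num) l
    fun hP => ?_).trans ?_
  · apply Real.one_le_rpow_of_pos_of_le_one_of_nonpos (by norm_num) (by norm_num)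
    rw [sub_nonpos, div_le_iff₀ hq']
    exact_mod_cast hP.le
  · rw [avgList_const_mul]
    refine (mul_le_mul_right (avgList_rpow_le hq h hg rfl (by norm_num)) _).trans ?_
    rw [← ENNReal.ofReal_mul (by positivity)]
    apply ENNReal.ofReal_le_ofReal
    have h1 : ((1 / 2 : ℝ) - 1) * (N * ((∑ v ∈ range q, g v : ℕ) / (q * q))) ≤ E * (-4) := by
      have : (8 : ℝ) * (q * q * E) ≤ (N * (∑ v ∈ range q, g v : ℕ)) := by exact_mod_cast hS
      rw [mul_div_assoc', mul_div_assoc', div_le_iff₀ (by positivity)]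
      linarith
    calc (1 / 2 : ℝ) ^ (-(2 * E : ℝ)) *
          Real.exp ((1 / 2 - 1) * (N * ((∑ v ∈ range q, g v : ℕ) / (q * q))))
        ≤ (1 / 2 : ℝ) ^ (-(2 * E : ℝ)) * Real.exp (E * (-4)) := by gcongr
      _ ≤ 4 ^ E * (1 / 16) ^ E := by
        rw [Real.exp_nat_mul]
        have h2 : (1 / 2 : ℝ) ^ (-(2 * E : ℝ)) = 4 ^ E := by
          rw [Real.rpow_neg (by norm_num), show (2 * E : ℝ) = ((2 * E : ℕ) : ℝ) by push_cast; ring,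
            Real.rpow_natCast, pow_mul, ← inv_pow]
          norm_num
        rw [h2]
        gcongr
        have h3 : (2 : ℝ) ≤ Real.exp 1 := by
          have := Real.add_one_le_exp 1; linarith
        rw [Real.exp_neg, show (4 : ℝ) = ((4 : ℕ) : ℝ) * 1 by norm_num, Real.exp_nat_mul, one_div]
        gcongr
        calc (16 : ℝ) = 2 ^ 4 := by norm_num
          _ ≤ _ := by gcongr
      _ = (1 / 4) ^ E := by rw [← mul_pow]; norm_num
      _ ≤ (1 / 4) ^ 1 := pow_le_pow_of_le_one (by norm_num) (by norm_num) hE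
      _ = 1 / 4 := pow_one _

end Chernoff

/-! ### Few elements of an increasing subsequence are lost by sampling -/

section Sampling

variable {q s : ℕ}

/-- By Bernoulli, 1 − k/q ≤ (1 − 1/q)^k, so the sum over distinct `k` is dominated by a geometric
series with ratio (1 − 1/q)^s ≤ q/(q+s). -/
theorem sum_one_sub_pow_le (hq : 0 < q) (hs : 0 < s) (K : Finset ℕ) (hK : ∀ k ∈ K, k ≤ q) :
    ∑ k ∈ K, (1 - (k : ℝ) / q) ^ s ≤ 1 + (q : ℝ) / s := by
  have hq' : (1 : ℝ) ≤ q := by exact_mod_cast hq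
  have hq0 : (0 : ℝ) < q := by linarith
  have hs' : (0 : ℝ) < s := by exact_mod_cast hs
  set r : ℝ := (1 - 1 / (q : ℝ)) ^ s with hr
  have hb : 0 ≤ 1 - 1 / (q : ℝ) := by
    rw [sub_nonneg, div_le_one hq0]; exact hq'
  have hr0 : 0 ≤ r := by positivity
  have hr1 : r ≤ q / (q + s) := by
    have h1 : 1 - 1 / (q : ℝ) ≤ Real.exp (-(1 / q)) := Real.one_sub_le_exp_neg _
    have h2 : (1 : ℝ) + s / q ≤ Real.exp (s * (1 / q)) := by
      have := Real.add_one_le_exp ((s : ℝ) * (1 / q))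
      have h3 : (s : ℝ) * (1 / q) = s / q := by ring
      linarith
    calc r ≤ Real.exp (-(1 / q)) ^ s := by rw [hr]; gcongr
      _ = (Real.exp ((s : ℝ) * (1 / q)))⁻¹ := by rw [← Real.exp_nat_mul, ← Real.exp_neg]; congr 1; ring
      _ ≤ (1 + (s : ℝ) / q)⁻¹ := by gcongr
      _ = q / (q + s) := by field_simp
  have hrlt : r < 1 := hr1.trans_lt (by rw [div_lt_one (by positivity)]; linarith)
  calc ∑ k ∈ K, (1 - (k : ℝ) / q) ^ s ≤ ∑ k ∈ K, r ^ k := by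
        refine sum_le_sum fun k hk => ?_
        rw [hr, ← pow_mul, mul_comm, pow_mul]
        have hk' : (k : ℝ) ≤ q := by exact_mod_cast hK k hk
        have h0 : 0 ≤ 1 - (k : ℝ) / q := by rw [sub_nonneg, div_le_one hq0]; exact hk'
        gcongr
        have := one_add_mul_le_pow (a := -(1 / (q : ℝ))) (by linarith) k
        calc 1 - (k : ℝ) / q = 1 + k * -(1 / q) := by ring
          _ ≤ _ := this
          _ = _ := by rw [← sub_eq_add_neg]
    _ ≤ ∑' k, r ^ k := (summable_geometric_of_lt_one hr0 hrlt).sum_le_tsum _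
        fun k _ => by positivity
    _ = (1 - r)⁻¹ := tsum_geometric_of_lt_one hr0 hrlt
    _ ≤ (1 - (q : ℝ) / (q + s))⁻¹ := by
        have : (0 : ℝ) < 1 - (q : ℝ) / (q + s) := by
          rw [sub_pos, div_lt_one (by positivity)]; linarith
        gcongr
    _ = 1 + q / s := by
        have : 1 - (q : ℝ) / (q + s) = s / (q + s) := by field_simp; ring
        rw [this, inv_div]; field_simp; ring

open Classical in
theorem avgList_avoid_le (hq : 0 < q) {i : ℕ} (hi : i < q) {Z : Finset ℕ}
    (hZ : Z ⊆ Ico (i * q) (i * q + q)) :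
    avgList q (q * s) (fun l => if ∀ a < s, samplePos q s (fun j => l.getD j 0) i a ∉ Z
      then 1 else 0) ≤ ENNReal.ofReal ((1 - (Z.card : ℝ) / q) ^ s) := by
  have hq0 : (0 : ℝ) < q := by exact_mod_cast hq
  have hblock : i * s + s ≤ q * s := by
    calc i * s + s = (i + 1) * s := by ring
      _ ≤ q * s := Nat.mul_le_mul_right _ hi
  have hprod : ∀ l : List ℕ, (if ∀ a < s, samplePos q s (fun j => l.getD j 0) i a ∉ Z
      then 1 else 0 : ℝ≥0∞) = ∏ a ∈ range s, ENNReal.ofReal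
        (if i * q + l.getD (i * s + a) 0 ∉ Z then 1 else 0) := by
    intro l
    split_ifs with h
    · refine (prod_eq_one fun a ha => ?_).symm
      have := h a (mem_range.1 ha)
      rw [samplePos] at this
      rw [if_pos this, ENNReal.ofReal_one]
    · push Not at h
      obtain ⟨a, ha, hmem⟩ := h
      refine (prod_eq_zero (mem_range.2 ha) ?_).symm
      rw [samplePos] at hmem
      rw [if_neg (not_not.2 hmem), ENNReal.ofReal_zero]
  simp only [hprod]
  rw [avgList_prod_block hq hblock fun v => ENNReal.ofReal (if i * q + v ∉ Z then 1 else 0),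
    sum_inv_mul_ofReal hq (fun v => by split_ifs <;> norm_num)]
  rw [← ENNReal.ofReal_pow (div_nonneg (sum_nonneg fun v _ => by split_ifs <;> norm_num) hq0.le)]
  apply le_of_eq
  congr 2
  have hcard : Z.card = ((range q).filter fun v => i * q + v ∈ Z).card := by
    refine (card_bij (fun v _ => i * q + v) (fun v hv => (mem_filter.1 hv).2)
      (fun _ _ _ _ h => by simpa using h) fun z hz => ?_).symm
    have := mem_Ico.1 (hZ hz)
    refine ⟨z - i * q, mem_filter.2 ⟨mem_range.2 (by omega), ?_⟩, by omega⟩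
    rwa [show i * q + (z - i * q) = z by omega]
  rw [sum_boole, div_eq_iff hq0.ne', hcard, sub_mul, div_mul_cancel₀ _ hq0.ne', one_mul]
  have := card_filter_add_card_filter_not (s := range q) (fun v => i * q + v ∈ Z)
  rw [card_range] at this
  rw [eq_sub_iff_add_eq, add_comm]
  exact_mod_cast this

open Classical in
/-- If the sets `Z x` have different sizes for the `x` in the same column, only few `x` in each
column are expected to have a set `Z x` without samples. -/
theorem sum_avgList_avoid_le (hq : 0 < q) (hs : 0 < s) {O : Finset ℕ} (hO : O ⊆ range (q * q))
    {Z : ℕ → Finset ℕ} (hZ : ∀ x ∈ O, Z x ⊆ Ico (x / q * q) (x / q * q + q))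
    (hinj : ∀ x ∈ O, ∀ y ∈ O, x / q = y / q → x < y → (Z x).card ≠ (Z y).card) :
    ∑ x ∈ O, avgList q (q * s) (fun l =>
        if ∀ a < s, samplePos q s (fun j => l.getD j 0) (x / q) a ∉ Z x then 1 else 0) ≤
      ENNReal.ofReal (q * (1 + q / s)) := by
  have hq0 : (0 : ℝ) < q := by exact_mod_cast hq
  have hcol : ∀ x ∈ O, x / q < q := fun x hx => Nat.div_lt_of_lt_mul (mem_range.1 (hO hx))
  have hZq : ∀ x ∈ O, (Z x).card ≤ q := fun x hx => (card_le_card (hZ x hx)).trans (by simp)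
  have hnn : ∀ x ∈ O, (0 : ℝ) ≤ (1 - ((Z x).card : ℝ) / q) ^ s := by
    intro x hx
    have : ((Z x).card : ℝ) ≤ q := by exact_mod_cast hZq x hx
    have : 0 ≤ 1 - ((Z x).card : ℝ) / q := by rw [sub_nonneg, div_le_one hq0]; exact this
    positivity
  calc _ ≤ ∑ x ∈ O, ENNReal.ofReal ((1 - ((Z x).card : ℝ) / q) ^ s) :=
        sum_le_sum fun x hx => avgList_avoid_le hq (hcol x hx) (hZ x hx)
    _ = ENNReal.ofReal (∑ x ∈ O, (1 - ((Z x).card : ℝ) / q) ^ s) :=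
        (ENNReal.ofReal_sum_of_nonneg hnn).symm
    _ ≤ _ := by
      apply ENNReal.ofReal_le_ofReal
      rw [← sum_fiberwise_of_maps_to (t := range q) (g := fun x => x / q)
        (fun x hx => mem_range.2 (hcol x hx))]
      calc _ ≤ ∑ i ∈ range q, (1 + (q : ℝ) / s) := by
            refine sum_le_sum fun i _ => ?_
            have hinj' : Set.InjOn (fun x => (Z x).card) (O.filter fun x => x / q = i : Finset ℕ) := by
              intro x hx y hy hxy
              obtain ⟨hx, hxi⟩ := mem_filter.1 (mem_coe.1 hx)
              obtain ⟨hy, hyi⟩ := mem_filter.1 (mem_coe.1 hy)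
              rcases lt_trichotomy x y with h | h | h
              · exact absurd hxy (hinj x hx y hy (hxi.trans hyi.symm) h)
              · exact h
              · exact absurd hxy.symm (hinj y hy x hx (hyi.trans hxi.symm) h)
            have := sum_image (f := fun k : ℕ => (1 - (k : ℝ) / q) ^ s) hinj'
            rw [← this]
            refine sum_one_sub_pow_le hq hs _ fun k hk => ?_
            obtain ⟨x, hx, rfl⟩ := mem_image.1 hk
            exact hZq x (mem_filter.1 hx).1
        _ = _ := by simp; ring

/-- An element is lost only if no sample hits the elements of `O` before it in its column, or none
hits those from it onwards. Within a column these segments have pairwise different sizes, so each of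
the two kinds of loss has expectation at most 1 + q/s per column. -/
theorem avgList_card_sdiff_retained_le (hq : 0 < q) (hs : 0 < s) {O : Finset ℕ}
    (hO : O ⊆ range (q * q)) :
    avgList q (q * s) (fun l => ((O \ retained q s (fun j => l.getD j 0) O).card : ℝ≥0∞)) ≤
      ENNReal.ofReal (2 * (q * (1 + q / s))) := by
  classical
  let Z₁ : ℕ → Finset ℕ := fun x => O.filter fun y => y / q = x / q ∧ y < x
  let Z₂ : ℕ → Finset ℕ := fun x => O.filter fun y => y / q = x / q ∧ x ≤ y
  have hsub : ∀ x y : ℕ, y / q = x / q → y ∈ Ico (x / q * q) (x / q * q + q) := by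
    intro x y hxy
    have h1 := Nat.div_add_mod y q
    have h2 := Nat.mod_lt y hq
    rw [hxy, mul_comm] at h1
    rw [mem_Ico]; omega
  have h₁ := sum_avgList_avoid_le hq hs hO (Z := Z₁)
    (fun x _ y hy => hsub x y (mem_filter.1 hy).2.1) (by
      intro x hx y hy hxy hlt
      refine (card_lt_card ⟨fun z hz => ?_, fun h => ?_⟩).ne
      · obtain ⟨hz, h1, h2⟩ := mem_filter.1 hz
        exact mem_filter.2 ⟨hz, h1.trans hxy, by omega⟩
      · have := (mem_filter.1 (h (mem_filter.2 ⟨hx, hxy, hlt⟩))).2.2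
        omega)
  have h₂ := sum_avgList_avoid_le hq hs hO (Z := Z₂)
    (fun x _ y hy => hsub x y (mem_filter.1 hy).2.1) (by
      intro x hx y hy hxy hlt
      refine (card_lt_card ⟨fun z hz => ?_, fun h => ?_⟩).ne'
      · obtain ⟨hz, h1, h2⟩ := mem_filter.1 hz
        exact mem_filter.2 ⟨hz, h1.trans hxy.symm, by omega⟩
      · have := (mem_filter.1 (h (mem_filter.2 ⟨hx, rfl, le_rfl⟩))).2.2
        omega)
  rw [two_mul, ENNReal.ofReal_add (by positivity) (by positivity)]
  refine le_trans ?_ (add_le_add h₁ h₂)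
  rw [← avgList_sum, ← avgList_sum, ← avgList_add]
  refine avgList_mono _ fun l hl hlq => ?_
  have hω : ∀ j, l.getD j 0 < q := by
    intro j
    rcases lt_or_ge j l.length with h | h
    · rw [List.getD_eq_getElem _ _ h]; exact hlq _ (List.getElem_mem h)
    · rw [List.getD_eq_default _ _ h]; exact hq
  have hdiv : ∀ i a, samplePos q s (fun j => l.getD j 0) i a / q = i := by
    intro i a
    rw [samplePos, mul_comm, Nat.mul_add_div hq, Nat.div_eq_of_lt (hω _), add_zero]
  rw [← sum_add_distrib]
  calc ((O \ retained q s (fun j => l.getD j 0) O).card : ℝ≥0∞)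
      = ∑ x ∈ O, if x ∈ retained q s (fun j => l.getD j 0) O then 0 else 1 := by
        rw [sdiff_eq_filter, card_filter]
        push_cast
        exact sum_congr rfl fun x _ => by split_ifs <;> simp_all
    _ ≤ _ := by
      refine sum_le_sum fun x hx => ?_
      by_cases hx' : x ∈ retained q s (fun j => l.getD j 0) O
      · rw [if_pos hx']; exact zero_le
      · rw [if_neg hx']
        by_cases h1 : ∀ a < s, samplePos q s (fun j => l.getD j 0) (x / q) a ∉ Z₁ x
        · rw [if_pos h1]; exact le_self_add
        · by_cases h2 : ∀ a < s, samplePos q s (fun j => l.getD j 0) (x / q) a ∉ Z₂ x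
          · rw [if_pos h2]; exact le_add_self
          · push Not at h1 h2
            obtain ⟨a, ha, hZa⟩ := h1
            obtain ⟨b, hb, hZb⟩ := h2
            refine absurd (mem_retained.2 ⟨hx, ⟨a, ha, ?_⟩, b, hb, ?_⟩) hx'
            · exact ⟨(mem_filter.1 hZa).1, (mem_filter.1 hZa).2.2⟩
            · exact ⟨(mem_filter.1 hZb).1, (mem_filter.1 hZb).2.2⟩

open Classical in
/-- With probability at least `1/2`, fewer than `q² / (2 g)` elements are not retained. -/
theorem avgList_lost_le {g : ℕ} (hg : 0 < g) (hgq : 256 * (g * g) ≤ q) (hs : s = 16 * g)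
    {O : Finset ℕ} (hO : O ⊆ range (q * q)) :
    avgList q (q * s) (fun l => if q * q ≤ 2 * g *
      (O \ retained q s (fun j => l.getD j 0) O).card then 1 else 0) ≤ ENNReal.ofReal (1 / 2) := by
  have hgg : g ≤ g * g := Nat.le_mul_self g
  have hq : 0 < q := by omega
  have hq0 : (0 : ℝ) < q := by exact_mod_cast hq
  have hg0 : (0 : ℝ) < g := by exact_mod_cast hg
  -- Markov's inequality. With `s = 16 * g` the resulting bound is 4g/q + 1/4, and the first term is
  -- at most 1/4 because `16 * g ≤ q`.
  have hstep : ∀ l : List ℕ, l.length = q * s → (∀ v ∈ l, v < q) →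
      (if q * q ≤ 2 * g * (O \ retained q s (fun j => l.getD j 0) O).card then 1 else 0 : ℝ≥0∞) ≤
      ENNReal.ofReal (2 * g / (q * q)) * (O \ retained q s (fun j => l.getD j 0) O).card := by
    intro l _ _
    split_ifs with h
    · rw [← ENNReal.ofReal_natCast, ← ENNReal.ofReal_mul (by positivity), ← ENNReal.ofReal_one]
      apply ENNReal.ofReal_le_ofReal
      rw [div_mul_eq_mul_div, le_div_iff₀ (by positivity), one_mul]
      exact_mod_cast h
    · exact zero_le
  refine (avgList_mono _ hstep).trans ?_
  rw [avgList_const_mul]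
  refine (mul_le_mul_right (avgList_card_sdiff_retained_le hq (by omega) hO) _).trans ?_
  rw [← ENNReal.ofReal_mul (by positivity)]
  apply ENNReal.ofReal_le_ofReal
  have h16 : (16 : ℝ) * g ≤ q := by exact_mod_cast (by omega : 16 * g ≤ q)
  subst hs
  push_cast
  have : 2 * (g : ℝ) / (q * q) * (2 * (q * (1 + q / (16 * g)))) = 4 * g / q + 1 / 4 := by
    field_simp; ring
  rw [this]
  have : 4 * (g : ℝ) / q ≤ 1 / 4 := by rw [div_le_iff₀ hq0]; linarith
  linarith

end Sampling

end RandomRAM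

/-! ### Adding one interval -/

section Snoc

variable {lo hi : ℕ → ℤ} {alive : ℕ → Prop} {m len len' p : ℕ} {F F' : ℕ → ℕ}

theorem IsHeight.zero : IsHeight lo hi alive 0 F 0 :=
  ⟨by simp, by simp, by simp, by simp, by simp, by simp⟩

theorem IsHeight.snoc_dead (h : IsHeight lo hi alive m F len) (hm : ¬ alive m)
    (hF : ∀ t < m, F' t = F t) (hFm : F' m = 0) : IsHeight lo hi alive (m + 1) F' len := by
  refine ⟨fun t ht ha => ?_, fun t ht ha => ?_, fun t ht ha t' ht' ha' hle => ?_,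
    fun t ht ha hlt => ?_, fun t ht => ?_, fun hpos => ?_⟩
  · rcases Nat.lt_succ_iff_lt_or_eq.1 ht with ht | rfl
    · rw [hF t ht]; exact h.pos t ht ha
    · exact absurd ha hm
  · rcases Nat.lt_succ_iff_lt_or_eq.1 ht with ht | rfl
    · rw [hF t ht]; exact h.dead t ht ha
    · exact hFm
  · rcases Nat.lt_succ_iff_lt_or_eq.1 ht with ht | rfl
    · rw [hF t ht, hF t' (ht'.trans ht)]; exact h.step t ht ha t' ht' ha' hle
    · exact absurd ha hm
  · rcases Nat.lt_succ_iff_lt_or_eq.1 ht with ht | rfl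
    · rw [hF t ht] at hlt ⊢
      obtain ⟨t', ht', h1, h2, h3⟩ := h.pred t ht ha hlt
      exact ⟨t', ht', h1, h2, by rw [hF t' (ht'.trans ht), h3]⟩
    · exact absurd ha hm
  · rcases Nat.lt_succ_iff_lt_or_eq.1 ht with ht | rfl
    · rw [hF t ht]; exact h.le t ht
    · rw [hFm]; exact Nat.zero_le _
  · obtain ⟨t, ht, ha, hFt⟩ := h.top hpos
    exact ⟨t, ht.trans (Nat.lt_succ_self m), ha, by rw [hF t ht, hFt]⟩

/-- Here `p` is the greatest height of an interval that may precede interval `m`, or 0 if there is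
none. The inequality `p ≤ F t` suffices because `hp'` forces equality. -/
theorem IsHeight.snoc_alive (h : IsHeight lo hi alive m F len) (hm : alive m)
    (hp : p = 0 ∨ ∃ t < m, alive t ∧ p ≤ F t ∧ hi t ≤ lo m)
    (hp' : ∀ t < m, alive t → hi t ≤ lo m → F t ≤ p)
    (hF : ∀ t < m, F' t = F t) (hFm : F' m = p + 1) (hlen : len' = max len (p + 1)) :
    IsHeight lo hi alive (m + 1) F' len' := by
  refine ⟨fun t ht ha => ?_, fun t ht ha => ?_, fun t ht ha t' ht' ha' hle => ?_,
    fun t ht ha hlt => ?_, fun t ht => ?_, fun hpos => ?_⟩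
  · rcases Nat.lt_succ_iff_lt_or_eq.1 ht with ht | rfl
    · rw [hF t ht]; exact h.pos t ht ha
    · omega
  · rcases Nat.lt_succ_iff_lt_or_eq.1 ht with ht | rfl
    · rw [hF t ht]; exact h.dead t ht ha
    · exact absurd hm ha
  · rcases Nat.lt_succ_iff_lt_or_eq.1 ht with ht | rfl
    · rw [hF t ht, hF t' (ht'.trans ht)]; exact h.step t ht ha t' ht' ha' hle
    · rw [hF t' ht', hFm]
      exact Nat.lt_succ_of_le (hp' t' ht' ha' hle)
  · rcases Nat.lt_succ_iff_lt_or_eq.1 ht with ht | rfl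
    · rw [hF t ht] at hlt ⊢
      obtain ⟨t', ht', h1, h2, h3⟩ := h.pred t ht ha hlt
      exact ⟨t', ht', h1, h2, by rw [hF t' (ht'.trans ht), h3]⟩
    · rcases hp with rfl | ⟨t', ht', h1, h2, h3⟩
      · omega
      · have := hp' t' ht' h1 h3
        exact ⟨t', ht', h1, h3, by rw [hF t' ht', hFm]; omega⟩
  · rcases Nat.lt_succ_iff_lt_or_eq.1 ht with ht | rfl
    · rw [hF t ht, hlen]; exact (h.le t ht).trans (le_max_left _ _)
    · rw [hFm, hlen]; exact le_max_right _ _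
  · rcases le_total len (p + 1) with hle | hle
    · exact ⟨m, Nat.lt_succ_self m, hm, by rw [hFm, hlen, max_eq_right hle]⟩
    · obtain ⟨t, ht, ha, hFt⟩ := h.top (by omega)
      exact ⟨t, ht.trans (Nat.lt_succ_self m), ha, by rw [hF t ht, hFt, hlen, max_eq_left hle]⟩

/-- `T ℓ` is the position of the least right end of the intervals of height at least `ℓ`. -/
def IsTails (f : ℕ → ℤ) (hi : ℕ → ℤ) (alive : ℕ → Prop) (m : ℕ) (F : ℕ → ℕ) (len : ℕ)
    (T : ℕ → ℕ) : Prop :=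
  ∀ l, 0 < l → ∀ v, (l ≤ len ∧ f (T l) ≤ v) ↔ ∃ t < m, alive t ∧ l ≤ F t ∧ hi t ≤ v

variable {f : ℕ → ℤ} {T T' : ℕ → ℕ}

theorem IsTails.zero : IsTails f hi alive 0 F 0 T := by
  intro l hl v
  simp; omega

theorem IsTails.snoc_dead (h : IsTails f hi alive m F len T) (hm : ¬ alive m)
    (hF : ∀ t < m, F' t = F t) (hT : ∀ l, 0 < l → l ≤ len → T' l = T l) :
    IsTails f hi alive (m + 1) F' len T' := by
  intro l hl v
  rw [show (l ≤ len ∧ f (T' l) ≤ v) ↔ (l ≤ len ∧ f (T l) ≤ v) from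
    and_congr_right fun hle => by rw [hT l hl hle], h l hl v]
  constructor
  · rintro ⟨t, ht, h1, h2, h3⟩
    exact ⟨t, by omega, h1, by rwa [hF t ht], h3⟩
  · rintro ⟨t, ht, h1, h2, h3⟩
    rcases Nat.lt_succ_iff_lt_or_eq.1 ht with ht | rfl
    · exact ⟨t, ht, h1, by rwa [← hF t ht], h3⟩
    · exact absurd h1 hm

/-- Only the tail at `p + 1` can change. Tails at smaller levels are already at most `lo m ≤ hi m`,
and the new interval is too low to matter for greater levels. -/
theorem IsTails.snoc_alive (h : IsTails f hi alive m F len T) (hm : alive m)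
    (hle : lo m ≤ hi m) (hh : IsHeight lo hi alive m F len)
    (hp : p = 0 ∨ ∃ t < m, alive t ∧ p ≤ F t ∧ hi t ≤ lo m)
    (hF : ∀ t < m, F' t = F t) (hFm : F' m = p + 1) (hlen : len' = max len (p + 1))
    (hT : ∀ l, 0 < l → l ≠ p + 1 → T' l = T l)
    (hTp : (f (T' (p + 1)) = hi m ∧ (len < p + 1 ∨ hi m ≤ f (T (p + 1)))) ∨
      (p + 1 ≤ len ∧ f (T (p + 1)) ≤ hi m ∧ T' (p + 1) = T (p + 1))) :
    IsTails f hi alive (m + 1) F' len' T' := by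
  intro l hl v
  have hrhs : (∃ t < m + 1, alive t ∧ l ≤ F' t ∧ hi t ≤ v) ↔
      (l ≤ len ∧ f (T l) ≤ v) ∨ (l ≤ p + 1 ∧ hi m ≤ v) := by
    rw [h l hl v]
    constructor
    · rintro ⟨t, ht, h1, h2, h3⟩
      rcases Nat.lt_succ_iff_lt_or_eq.1 ht with ht | rfl
      · exact Or.inl ⟨t, ht, h1, by rwa [← hF t ht], h3⟩
      · exact Or.inr ⟨hFm ▸ h2, h3⟩
    · rintro (⟨t, ht, h1, h2, h3⟩ | ⟨h1, h2⟩)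
      · exact ⟨t, by omega, h1, by rwa [hF t ht], h3⟩
      · exact ⟨m, by omega, hm, hFm ▸ h1, h2⟩
  rw [hrhs]
  have hplen : p ≤ len := by
    rcases hp with rfl | ⟨t, ht, h1, h2, -⟩
    · exact Nat.zero_le _
    · exact h2.trans (hh.le t ht)
  rcases lt_trichotomy l (p + 1) with hlt | rfl | hlt
  · rw [hT l hl hlt.ne]
    have h1 : l ≤ len := by omega
    have h2 : l ≤ len' := by omega
    refine ⟨fun h' => Or.inl ⟨h1, h'.2⟩, ?_⟩
    rintro (h' | h')
    · exact ⟨h2, h'.2⟩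
    · refine ⟨h2, ((h l hl v).2 ?_).2⟩
      rcases hp with rfl | ⟨t, ht, ha, hpt, hhi⟩
      · omega
      · exact ⟨t, ht, ha, by omega, hhi.trans (hle.trans h'.2)⟩
  · have h2 : p + 1 ≤ len' := by omega
    rcases hTp with ⟨h1, h3⟩ | ⟨h1, h3, h4⟩
    · rw [h1]
      refine ⟨fun h' => Or.inr ⟨le_rfl, h'.2⟩, ?_⟩
      rintro (h' | h')
      · exact ⟨h2, by rcases h3 with h3 | h3; · omega
                      exact h3.trans h'.2⟩
      · exact ⟨h2, h'.2⟩
    · rw [h4]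
      refine ⟨fun h' => Or.inl ⟨h1, h'.2⟩, ?_⟩
      rintro (h' | h')
      · exact ⟨h2, h'.2⟩
      · exact ⟨h2, h3.trans h'.2⟩
  · rw [hT l hl hlt.ne']
    refine ⟨fun h' => Or.inl ⟨by omega, h'.2⟩, ?_⟩
    rintro (h' | h')
    · exact ⟨by omega, h'.2⟩
    · omega

end Snoc

namespace RandomRAM

/-! ### Evaluation of expressions -/

section Eval

variable {n W : ℕ} {A : Fin n → ℤ} {s : Store}

theorem eval_const (k : ℕ) : (Expr.const k).eval W A s = k % W := rfl
theorem eval_var (x : ℕ) : (Expr.var x).eval W A s = s.vars x := rfl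
theorem eval_load (a : ℕ) (e : Expr) :
    (Expr.load a e).eval W A s = s.arrays a (e.eval W A s) := rfl
theorem eval_add (a b : Expr) :
    (Expr.bin .add a b).eval W A s = (a.eval W A s + b.eval W A s) % W := rfl
theorem eval_sub (a b : Expr) :
    (Expr.bin .sub a b).eval W A s = (a.eval W A s - b.eval W A s) % W := rfl
theorem eval_mul (a b : Expr) :
    (Expr.bin .mul a b).eval W A s = (a.eval W A s * b.eval W A s) % W := rfl
theorem eval_div (a b : Expr) :
    (Expr.bin .div a b).eval W A s = (a.eval W A s / b.eval W A s) % W := rfl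
theorem eval_mod (a b : Expr) :
    (Expr.bin .mod a b).eval W A s = (a.eval W A s % b.eval W A s) % W := rfl
theorem eval_lt (a b : Expr) :
    (Expr.bin .lt a b).eval W A s = (if a.eval W A s < b.eval W A s then 1 else 0) % W := rfl
theorem eval_eq (a b : Expr) :
    (Expr.bin .eq a b).eval W A s = (if a.eval W A s = b.eval W A s then 1 else 0) % W := rfl

/-- Negation. -/
def Expr.not (a : Expr) : Expr := .bin .eq a (.const 0)

/-- Conjunction. -/
def Expr.and (a b : Expr) : Expr := .bin .mul (.bin .lt (.const 0) a) (.bin .lt (.const 0) b)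

/-- Disjunction. -/
def Expr.or (a b : Expr) : Expr := .not (.and (.not a) (.not b))

theorem eval_lt_eq_zero (hW : 1 < W) (a b : Expr) :
    (Expr.bin .lt a b).eval W A s = 0 ↔ ¬ a.eval W A s < b.eval W A s := by
  rw [eval_lt]; split_ifs with h <;> simp [h, Nat.mod_eq_of_lt hW]

theorem eval_eq_eq_zero (hW : 1 < W) (a b : Expr) :
    (Expr.bin .eq a b).eval W A s = 0 ↔ ¬ a.eval W A s = b.eval W A s := by
  rw [eval_eq]; split_ifs with h <;> simp [h, Nat.mod_eq_of_lt hW]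

theorem eval_not_eq_zero (hW : 1 < W) (a : Expr) :
    (Expr.not a).eval W A s = 0 ↔ ¬ a.eval W A s = 0 := by
  rw [Expr.not, eval_eq_eq_zero hW, eval_const, Nat.zero_mod]

/-- Both operands are first turned into 0 or 1, since a product of nonzero words may vanish modulo
`W`. -/
theorem eval_and_eq_zero (hW : 1 < W) (a b : Expr) :
    (Expr.and a b).eval W A s = 0 ↔ ¬ (¬ a.eval W A s = 0 ∧ ¬ b.eval W A s = 0) := by
  rw [Expr.and, eval_mul, eval_lt, eval_lt, eval_const, Nat.zero_mod]
  split_ifs with h1 h2 h2 <;> simp [Nat.mod_eq_of_lt hW] <;> omega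

theorem eval_or_eq_zero (hW : 1 < W) (a b : Expr) :
    (Expr.or a b).eval W A s = 0 ↔ ¬ (¬ a.eval W A s = 0 ∨ ¬ b.eval W A s = 0) := by
  rw [Expr.or, eval_not_eq_zero hW, eval_and_eq_zero hW, eval_not_eq_zero hW, eval_not_eq_zero hW]
  tauto

/-- Compares the tie-breaking keys of two positions. -/
def Expr.leKey (a b : Expr) : Expr :=
  .or (.and (.bin .lt a b) (.inputLt a b)) (.and (.not (.bin .lt a b)) (.not (.inputLt b a)))

theorem eval_inputLt_eq_zero {a b : Expr} (ha : a.eval W A s < n) (hb : b.eval W A s < n) :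
    (Expr.inputLt a b).eval W A s = 0 ↔ ¬ A ⟨_, ha⟩ < A ⟨_, hb⟩ := by
  simp [Expr.eval, ha, hb]

theorem eval_leKey_eq_zero (hW : 1 < W) {a b : Expr} (ha : a.eval W A s < n)
    (hb : b.eval W A s < n) : (Expr.leKey a b).eval W A s = 0 ↔
      ¬ tieKey A (a.eval W A s) ≤ tieKey A (b.eval W A s) := by
  rw [Expr.leKey, eval_or_eq_zero hW, eval_and_eq_zero hW, eval_and_eq_zero hW,
    eval_not_eq_zero hW, eval_not_eq_zero hW, eval_lt_eq_zero hW, eval_inputLt_eq_zero ha hb,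
    eval_inputLt_eq_zero hb ha, tieKey_le_iff A ha hb]
  split_ifs with h <;> tauto

end Eval

-- Variables and arrays of the program, and notation for its expressions. Numbers below 16 are
-- reserved for the input, the output, the flag and the parameters of a guess, which
-- `IsParams.congr` exploits. The last three arrays keep the coloured intervals, because the working
-- arrays before them are reused when qualities are computed.

notation "vN" => (0 : ℕ)
notation "vOut" => (1 : ℕ)
notation "vQ" => (2 : ℕ)
notation "vLg" => (3 : ℕ)
notation "vPow" => (4 : ℕ)
notation "vG" => (5 : ℕ)
notation "vFlag" => (6 : ℕ)
notation "vS" => (7 : ℕ)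
notation "vSS" => (8 : ℕ)
notation "vM" => (9 : ℕ)
notation "vX" => (10 : ℕ)
notation "vSamp" => (11 : ℕ)
notation "vThr" => (12 : ℕ)
notation "vTrials" => (13 : ℕ)
notation "vQS" => (14 : ℕ)
notation "vXN" => (15 : ℕ)
notation "vTrial" => (16 : ℕ)
notation "vFillIdx" => (17 : ℕ)
notation "vFillTmp" => (18 : ℕ)
notation "vCnt" => (20 : ℕ)
notation "vLen" => (21 : ℕ)
notation "vT" => (22 : ℕ)
notation "vPos" => (23 : ℕ)
notation "vStep" => (24 : ℕ)
notation "vCell" => (30 : ℕ)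
notation "vCol" => (31 : ℕ)
notation "vRound" => (32 : ℕ)
notation "vBack" => (33 : ℕ)
notation "vU" => (34 : ℕ)
notation "vCur" => (35 : ℕ)
notation "vLast" => (36 : ℕ)
notation "vSave" => (37 : ℕ)
notation "vColour" => (40 : ℕ)
notation "vTotal" => (41 : ℕ)
notation "vY" => (42 : ℕ)
notation "vI" => (43 : ℕ)
notation "vR" => (44 : ℕ)
notation "vIdx" => (45 : ℕ)
notation "vFound" => (46 : ℕ)
notation "vHullLo" => (47 : ℕ)
notation "vHullHi" => (48 : ℕ)
notation "vOff" => (49 : ℕ)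
notation "vP" => (50 : ℕ)
notation "aRand" => (0 : ℕ)
notation "aCols" => (1 : ℕ)
notation "aLo" => (2 : ℕ)
notation "aHi" => (3 : ℕ)
notation "aDead" => (4 : ℕ)
notation "aF" => (5 : ℕ)
notation "aT" => (6 : ℕ)
notation "aCellLo" => (7 : ℕ)
notation "aCellHi" => (8 : ℕ)
notation "aCellCol" => (9 : ℕ)

infixr:30 " ;; " => Cmd.seq
infixl:65 " +' " => Expr.bin BinOp.add
infixl:65 " -' " => Expr.bin BinOp.sub
infixl:70 " *' " => Expr.bin BinOp.mul
infixl:70 " /' " => Expr.bin BinOp.div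
infixl:70 " %' " => Expr.bin BinOp.mod
infix:50 " <' " => Expr.bin BinOp.lt
infix:50 " =' " => Expr.bin BinOp.eq
prefix:max "♯" => Expr.const
prefix:max "↟" => Expr.var
infix:40 " ≔ " => Cmd.assign

/-! ### Longest chains -/

section Patience

/-- One round of binary search among the right ends of chains. -/
def Cmd.bisectBody : Cmd :=
  Cmd.ite (.and (.not (↟vLen <' ↟vPos +' ↟vStep))
      (.leKey (.load aT (↟vPos +' ↟vStep)) (.load aLo ↟vT)))
    (vPos ≔ ↟vPos +' ↟vStep) .skip ;;
  vStep ≔ ↟vStep /' ♯2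

/-- Binary search for the largest height of an interval that can precede the current one. -/
def Cmd.bisect : Cmd := .loop ↟vStep .bisectBody

/-- Computes the height of the current interval. -/
def Cmd.patienceBody : Cmd :=
  Cmd.ite (.load aDead ↟vT) (.store aF ↟vT ♯0)
    (vPos ≔ ♯0 ;; vStep ≔ ↟vPow ;; .bisect ;; vPos ≔ ↟vPos +' ♯1 ;; .store aF ↟vT ↟vPos ;;
      Cmd.ite (↟vLen <' ↟vPos) (vLen ≔ ↟vPos ;; .store aT ↟vPos (.load aHi ↟vT))
        (Cmd.ite (.leKey (.load aHi ↟vT) (.load aT ↟vPos))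
          (.store aT ↟vPos (.load aHi ↟vT)) .skip))

/-- Computes the heights of all intervals (patience sorting). -/
def Cmd.patience : Cmd := vLen ≔ ♯0 ;; .forLt vT vCnt .patienceBody

variable {n W : ℕ} {A : Fin n → ℤ} {s : Store}

/-- By `hanti`, the levels whose tail lies below the left end of the current interval form an
initial segment, and its end is found bit by bit. -/
theorem bisect_spec {t len Lg : ℕ} (ht : s.vars vT = t) (hlen : s.vars vLen = len)
    (hstep : s.vars vStep = 2 ^ Lg) (hpos : s.vars vPos = 0) (hlenPow : len < 2 ^ Lg)
    (hW : 4 * 2 ^ Lg < W) (hlo : s.arrays aLo t < n)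
    (hT : ∀ l, 0 < l → l ≤ len → s.arrays aT l < n)
    (hanti : ∀ l l', 0 < l → l ≤ l' → l' ≤ len →
      tieKey A (s.arrays aT l') ≤ tieKey A (s.arrays aLo t) →
      tieKey A (s.arrays aT l) ≤ tieKey A (s.arrays aLo t)) :
    Runs W A .bisect s ((Lg + 1) * 6 + 1) (fun s' => s'.vars vPos ≤ len ∧
      (s'.vars vPos = 0 ∨
        tieKey A (s.arrays aT (s'.vars vPos)) ≤ tieKey A (s.arrays aLo t)) ∧
      ∀ l, s'.vars vPos < l → l ≤ len →
        ¬ tieKey A (s.arrays aT l) ≤ tieKey A (s.arrays aLo t)) := by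
  have hW1 : 1 < W := by have := Nat.one_le_two_pow (n := Lg); omega
  refine Runs.loop_of_measure (Tb := 5) (m := Lg + 1)
    -- The answer lies in a window of length `2 ^ m` starting at the current position. The step is
    -- written `2 ^ m / 2` so that it vanishes for `m = 0`, which is when the loop ends.
    (I := fun m s' => (∀ z, z ≠ vPos → z ≠ vStep → s'.vars z = s.vars z) ∧
      s'.arrays = s.arrays ∧ m ≤ Lg + 1 ∧ s'.vars vStep = 2 ^ m / 2 ∧ s'.vars vPos ≤ len ∧
      (s'.vars vPos = 0 ∨
        tieKey A (s.arrays aT (s'.vars vPos)) ≤ tieKey A (s.arrays aLo t)) ∧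
      ∀ l, s'.vars vPos + 2 ^ m ≤ l → l ≤ len →
        ¬ tieKey A (s.arrays aT l) ≤ tieKey A (s.arrays aLo t)) ?_ ?_ ?_
  · rintro m s' ⟨hv, ha, hm, hst, hple, hp, hall⟩ hne
    obtain ⟨k, rfl⟩ : ∃ k, m = k + 1 := by
      refine ⟨m - 1, ?_⟩
      rcases Nat.eq_zero_or_pos m with rfl | h
      · simp [eval_var, hst] at hne
      · omega
    have hk : 2 ^ (k + 1) / 2 = 2 ^ k := by rw [pow_succ]; simp
    rw [hk] at hst
    have hkL : 2 ^ k ≤ 2 ^ Lg := Nat.pow_le_pow_right two_pos (by omega)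
    have e1 : (↟vPos +' ↟vStep).eval W A s' = s'.vars vPos + 2 ^ k := by
      rw [eval_add, eval_var, eval_var, hst, Nat.mod_eq_of_lt (by omega)]
    have hvlen : s'.vars vLen = len := by rw [hv _ (by decide) (by decide), hlen]
    have hvT : s'.vars vT = t := by rw [hv _ (by decide) (by decide), ht]
    have hcond : (Expr.and (.not (↟vLen <' ↟vPos +' ↟vStep))
        (.leKey (.load aT (↟vPos +' ↟vStep)) (.load aLo ↟vT))).eval W A s' = 0 ↔
        ¬ (s'.vars vPos + 2 ^ k ≤ len ∧
          tieKey A (s.arrays aT (s'.vars vPos + 2 ^ k)) ≤ tieKey A (s.arrays aLo t)) := by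
      rw [eval_and_eq_zero hW1, eval_not_eq_zero hW1, eval_lt_eq_zero hW1, e1, eval_var, hvlen]
      by_cases h : s'.vars vPos + 2 ^ k ≤ len
      · rw [eval_leKey_eq_zero hW1]
        · simp [eval_load, eval_var, e1, hvT, ha, h]
        · rw [eval_load, e1, ha]
          exact hT _ (by have := Nat.one_le_two_pow (n := k); omega) h
        · rwa [eval_load, eval_var, hvT, ha]
      · simp [h]
    refine (Runs.seq (T₁ := 2) (T₂ := 1) (Runs.ite (T := 1) (fun h => ?_) (fun h => ?_))).mono
      (by omega) (fun _ h => h)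
    · rw [Ne, hcond, not_not] at h
      refine Runs.assign (Runs.assign ⟨k, by omega, ?_, ?_, by omega, ?_, ?_, ?_, ?_⟩)
      · intro z h1 h2; simp [h1, h2, hv z h1 h2]
      · simpa using ha
      · simp [eval_div, eval_var, eval_const, hst, Nat.mod_eq_of_lt (show 2 < W by
          have := Nat.one_le_two_pow (n := Lg); omega)]
        exact Nat.mod_eq_of_lt (by omega)
      · simp [e1, h.1]
      · simp [e1, h.2]
      · simp only [Store.vars_setVar, e1]
        intro l hl hl'
        refine hall l ?_ hl'
        rw [pow_succ]
        simp at hl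
        omega
    · rw [hcond] at h
      refine Runs.skip (Runs.assign ⟨k, by omega, ?_, ?_, by omega, ?_, ?_, ?_, ?_⟩)
      · intro z h1 h2; simp [h2, hv z h1 h2]
      · simpa using ha
      · simp [eval_div, eval_var, eval_const, hst, Nat.mod_eq_of_lt (show 2 < W by
          have := Nat.one_le_two_pow (n := Lg); omega)]
        exact Nat.mod_eq_of_lt (by omega)
      · simpa using hple
      · simpa using hp
      · simp only [Store.vars_setVar]
        intro l hl hl' hle
        simp at hl
        have := Nat.one_le_two_pow (n := k)
        exact h ⟨by omega, hanti _ l (by omega) hl hl' hle⟩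
  · rintro m s' ⟨hv, ha, hm, hst, hple, hp, hall⟩ hz
    have hm0 : m = 0 := by
      rw [eval_var, hst] at hz
      by_contra hne
      obtain ⟨k, rfl⟩ : ∃ k, m = k + 1 := ⟨m - 1, by omega⟩
      have := Nat.one_le_two_pow (n := k)
      rw [pow_succ] at hz
      omega
    subst hm0
    exact ⟨hple, hp, fun l hl => hall l (by simpa using hl)⟩
  · refine ⟨fun _ _ _ => rfl, rfl, le_rfl, ?_, by omega, Or.inl hpos, fun l hl hl' => ?_⟩
    · rw [hstep, pow_succ]; simp
    · rw [pow_succ] at hl; omega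

/-- The array of tails makes the height of each interval available by one binary search, so a pass
costs a logarithmic factor per interval. The same code serves intervals and, with equal ends, single
positions. -/
theorem patience_spec {cnt Lg : ℕ} (hcnt : s.vars vCnt = cnt) (hcn : cnt ≤ n)
    (hpow : s.vars vPow = 2 ^ Lg) (hn : n < 2 ^ Lg) (hW : 4 * 2 ^ Lg < W)
    (hlo : ∀ t < cnt, s.arrays aLo t < n) (hhi : ∀ t < cnt, s.arrays aHi t < n)
    (hle : ∀ t < cnt, s.arrays aDead t = 0 →
      tieKey A (s.arrays aLo t) ≤ tieKey A (s.arrays aHi t)) :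
    Runs W A .patience s (cnt * ((Lg + 1) * 6 + 20) + 5) (fun s' =>
      IsHeight (fun t => tieKey A (s.arrays aLo t)) (fun t => tieKey A (s.arrays aHi t))
        (fun t => s.arrays aDead t = 0) cnt (s'.arrays aF) (s'.vars vLen)) := by
  have hW1 : 1 < W := by have := Nat.one_le_two_pow (n := Lg); omega
  refine (Runs.seq (T₁ := 1) (Runs.assign (Runs.forLt (N := cnt) (Tb := (Lg + 1) * 6 + 17)
    (Inv := fun i s' => s'.vars vLen ≤ i ∧
      IsHeight (fun t => tieKey A (s.arrays aLo t)) (fun t => tieKey A (s.arrays aHi t))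
        (fun t => s.arrays aDead t = 0) i (s'.arrays aF) (s'.vars vLen) ∧
      IsTails (tieKey A) (fun t => tieKey A (s.arrays aHi t))
        (fun t => s.arrays aDead t = 0) i (s'.arrays aF) (s'.vars vLen) (s'.arrays aT) ∧
      ∀ l, 0 < l → l ≤ s'.vars vLen → s'.arrays aT l < n)
    hW1 ?_ ?_ (by decide) rfl rfl ?_ ?_ ?_))).mono (le_of_eq (by ring)) (fun _ h => h)
  · simpa using hcnt
  · omega
  · simp only [eval_const, Nat.zero_mod, Store.vars_setVar, Store.arrays_setVar]
    exact ⟨le_rfl, IsHeight.zero, IsTails.zero, fun l h1 h2 => by simp at h2; omega⟩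
  · rintro i hi s₁ hf hT hC ⟨hlen, hH, hTl, hTn⟩
    have hlo₁ : s₁.arrays aLo = s.arrays aLo := hf.2 _ rfl
    have hhi₁ : s₁.arrays aHi = s.arrays aHi := hf.2 _ rfl
    have hd₁ : s₁.arrays aDead = s.arrays aDead := hf.2 _ rfl
    have hpow₁ : s₁.vars vPow = 2 ^ Lg := by rw [hf.1 _ rfl]; simpa using hpow
    refine (Runs.ite (T := (Lg + 1) * 6 + 16) (fun h => ?_) (fun h => ?_)).mono le_rfl (fun _ h => h)
    · refine (Runs.store ?_).mono (by omega : 1 ≤ _) (fun _ h => h)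
      rw [eval_load, eval_var, hT, hd₁] at h
      have hF : ∀ t, (s₁.setCell aF i 0).arrays aF t = if t = i then 0 else s₁.arrays aF t := by
        simp
      simp only [eval_var, eval_const, hT, Nat.zero_mod]
      refine ⟨?_, ?_, ?_, ?_⟩
      · simp; omega
      · simpa using hH.snoc_dead h (F' := (s₁.setCell aF i 0).arrays aF)
          (fun t ht => by simp [ht.ne]) (by simp)
      · have := hTl.snoc_dead h (F' := (s₁.setCell aF i 0).arrays aF) (T' := s₁.arrays aT)
          (fun t ht => by simp [ht.ne]) (fun _ _ _ => rfl)
        simpa [Store.arrays_setCell_ne] using this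
      · simpa [Store.arrays_setCell_ne] using hTn
    · rw [eval_load, eval_var, hT, hd₁] at h
      set len := s₁.vars vLen with hlen'
      -- An interval of height at least `l'` also has height at least `l`, so the tails are
      -- monotone.
      have hanti : ∀ v l l', 0 < l → l ≤ l' → l' ≤ len →
          tieKey A (s₁.arrays aT l') ≤ v → tieKey A (s₁.arrays aT l) ≤ v := by
        intro v l l' h0 hll hl' hle
        obtain ⟨t, ht, h1, h2, h3⟩ := (hTl l' (by omega) v).1 ⟨hl', hle⟩
        exact ((hTl l h0 v).2 ⟨t, ht, h1, by omega, h3⟩).2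
      refine (Runs.seq (T₁ := 1) (T₂ := (Lg + 1) * 6 + 14) (Runs.assign ?_)).mono (by omega)
        (fun _ h => h)
      refine (Runs.seq (T₁ := 1) (T₂ := (Lg + 1) * 6 + 12) (Runs.assign ?_)).mono (by omega)
        (fun _ h => h)
      refine (Runs.seq (T₁ := (Lg + 1) * 6 + 1) (T₂ := 10) ?_).mono (by omega) (fun _ h => h)
      refine (bisect_spec (t := i) (len := len) (Lg := Lg) ?_ ?_ ?_ ?_ ?_ hW ?_ ?_ ?_).framed.mono
        le_rfl ?_
      · simpa using hT
      · simp [hlen']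
      · simpa [eval_var] using hpow₁
      · simp [eval_const]
      · omega
      · simp [hlo₁, hlo i hi]
      · simpa using hTn
      · simp only [Store.arrays_setVar]
        exact hanti _
      rintro s₂ ⟨⟨hple, hp, hp'⟩, hf₂⟩
      simp only [Store.arrays_setVar] at hp hp' hf₂
      set p := s₂.vars vPos with hpdef
      have ha₂ : s₂.arrays = s₁.arrays := funext fun z => hf₂.2 z rfl
      have hT₂ : s₂.vars vT = i := by rw [hf₂.1 _ rfl]; simpa using hT
      have hlen₂ : s₂.vars vLen = len := by rw [hf₂.1 _ rfl]; simp [hlen']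
      have hp1 : (↟vPos +' ♯1).eval W A s₂ = p + 1 := by
        rw [eval_add, eval_var, eval_const, Nat.mod_eq_of_lt hW1, Nat.mod_eq_of_lt (by omega)]
      have hpH : p = 0 ∨ ∃ t < i, s.arrays aDead t = 0 ∧ p ≤ s₁.arrays aF t ∧
          tieKey A (s.arrays aHi t) ≤ tieKey A (s.arrays aLo i) := by
        rcases hp with hp | hp
        · exact Or.inl hp
        · rcases Nat.eq_zero_or_pos p with h0 | h0
          · exact Or.inl h0
          · rw [hlo₁] at hp
            exact Or.inr ((hTl p h0 _).1 ⟨hple, hp⟩)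
      have hpH' : ∀ t < i, s.arrays aDead t = 0 →
          tieKey A (s.arrays aHi t) ≤ tieKey A (s.arrays aLo i) → s₁.arrays aF t ≤ p := by
        intro t ht hd hle'
        by_contra! hlt
        have := (hTl (p + 1) (by omega) (tieKey A (s.arrays aLo i))).2 ⟨t, ht, hd, hlt, hle'⟩
        rw [← hlo₁] at this
        exact hp' (p + 1) (by omega) this.1 this.2
      refine (Runs.seq (T₁ := 1) (T₂ := 8) (Runs.assign ?_)).mono (by omega) (fun _ h => h)
      rw [hp1]
      refine (Runs.seq (T₁ := 1) (T₂ := 6) (Runs.store ?_)).mono (by omega) (fun _ h => h)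
      have e3 : (↟vPos).eval W A (s₂.setVar vPos (p + 1)) = p + 1 := by simp [eval_var]
      have e4 : (↟vT).eval W A (s₂.setVar vPos (p + 1)) = i := by simp [eval_var, hT₂]
      rw [e3, e4]
      set s₃ := (s₂.setVar vPos (p + 1)).setCell aF i (p + 1) with hs₃
      have hv₃ : s₃.vars vPos = p + 1 := by simp [hs₃]
      have hl₃ : s₃.vars vLen = len := by simp [hs₃, hlen₂]
      have ht₃ : s₃.vars vT = i := by simp [hs₃, hT₂]
      have hF₃ : ∀ t, s₃.arrays aF t = if t = i then p + 1 else s₁.arrays aF t := by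
        intro t; simp [hs₃, ha₂]
      have hT₃ : s₃.arrays aT = s₁.arrays aT := by
        rw [hs₃, Store.arrays_setCell_ne _ _ _ (by decide), Store.arrays_setVar, ha₂]
      have hhi₃ : s₃.arrays aHi = s.arrays aHi := by
        rw [hs₃, Store.arrays_setCell_ne _ _ _ (by decide), Store.arrays_setVar, ha₂, hhi₁]
      -- The three branches of the program (a new tail, an improved tail, no change) differ only in
      -- the tail at `p + 1`, so the invariant is restored once for all of them.
      have finish : ∀ s₄ : Store, s₄.vars vLen = max len (p + 1) → s₄.arrays aF = s₃.arrays aF →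
          (∀ l, l ≠ p + 1 → s₄.arrays aT l = s₁.arrays aT l) →
          ((s₄.arrays aT (p + 1) = s.arrays aHi i ∧ (len < p + 1 ∨
            tieKey A (s.arrays aHi i) ≤ tieKey A (s₁.arrays aT (p + 1)))) ∨
          (p + 1 ≤ len ∧ tieKey A (s₁.arrays aT (p + 1)) ≤ tieKey A (s.arrays aHi i) ∧
            s₄.arrays aT (p + 1) = s₁.arrays aT (p + 1))) →
          (s₄.setVar vT (i + 1)).vars vLen ≤ i + 1 ∧
          IsHeight (fun t => tieKey A (s.arrays aLo t)) (fun t => tieKey A (s.arrays aHi t))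
            (fun t => s.arrays aDead t = 0) (i + 1) ((s₄.setVar vT (i + 1)).arrays aF)
            ((s₄.setVar vT (i + 1)).vars vLen) ∧
          IsTails (tieKey A) (fun t => tieKey A (s.arrays aHi t))
            (fun t => s.arrays aDead t = 0) (i + 1) ((s₄.setVar vT (i + 1)).arrays aF)
            ((s₄.setVar vT (i + 1)).vars vLen) ((s₄.setVar vT (i + 1)).arrays aT) ∧
          ∀ l, 0 < l → l ≤ (s₄.setVar vT (i + 1)).vars vLen →
            (s₄.setVar vT (i + 1)).arrays aT l < n := by
        intro s₄ h1 h2 h3 h4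
        have hv : (s₄.setVar vT (i + 1)).vars vLen = max len (p + 1) := by simpa using h1
        rw [hv, Store.arrays_setVar, h2]
        refine ⟨by omega, ?_, ?_, ?_⟩
        · exact hH.snoc_alive h hpH hpH' (fun t ht => by rw [hF₃, if_neg ht.ne])
            (by rw [hF₃, if_pos rfl]) rfl
        · refine hTl.snoc_alive h (lo := fun t => tieKey A (s.arrays aLo t)) (hle i hi h) hH hpH
            (fun t ht => by rw [hF₃, if_neg ht.ne]) (by rw [hF₃, if_pos rfl]) rfl
            (fun l _ hl => h3 l hl) ?_
          rcases h4 with ⟨h4, h5⟩ | h4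
          · exact Or.inl ⟨by rw [h4], h5⟩
          · exact Or.inr h4
        · intro l hl hl'
          by_cases hlp : l = p + 1
          · subst hlp
            rcases h4 with ⟨h4, -⟩ | ⟨h4, -, h5⟩
            · rw [h4]; exact hhi i hi
            · rw [h5]; exact hTn _ hl h4
          · rw [h3 l hlp]; exact hTn l hl (by omega)
      refine (Runs.ite (T := 3) (fun hc => ?_) (fun hc => ?_)).mono (by omega) (fun _ h => h)
      · rw [Ne, eval_lt_eq_zero hW1, not_not, eval_var, eval_var, hl₃, hv₃] at hc
        refine Runs.seq (T₁ := 1) (T₂ := 1) (Runs.assign (Runs.store ?_))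
        have e1 : (↟vPos).eval W A (s₃.setVar vLen ((↟vPos).eval W A s₃)) = p + 1 := by
          simp [eval_var, hv₃]
        have e2 : (Expr.load aHi ↟vT).eval W A (s₃.setVar vLen ((↟vPos).eval W A s₃)) =
            s.arrays aHi i := by
          simp [eval_var, eval_load, ht₃, hhi₃]
        rw [e1, e2, eval_var, hv₃]
        refine finish _ ?_ ?_ ?_ ?_
        · simp; omega
        · rw [Store.arrays_setCell_ne _ _ _ (by decide), Store.arrays_setVar]
        · intro l hl; simp [hl, hT₃]
        · left; exact ⟨by simp, Or.inl hc⟩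
      · rw [eval_lt_eq_zero hW1, eval_var, eval_var, hl₃, hv₃, not_lt] at hc
        have hcond : (Expr.leKey (.load aHi ↟vT) (.load aT ↟vPos)).eval W A s₃ = 0 ↔
            ¬ tieKey A (s.arrays aHi i) ≤ tieKey A (s₁.arrays aT (p + 1)) := by
          rw [eval_leKey_eq_zero hW1]
          · simp [eval_load, eval_var, ht₃, hv₃, hhi₃, hT₃]
          · simpa [eval_load, eval_var, ht₃, hhi₃] using hhi i hi
          · simpa [eval_load, eval_var, hv₃, hT₃] using hTn (p + 1) (by omega) hc
        refine (Runs.ite (T := 1) (fun hk => ?_) (fun hk => ?_)).mono (by omega) (fun _ h => h)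
        · rw [Ne, hcond, not_not] at hk
          refine Runs.store ?_
          have e2 : (Expr.load aHi ↟vT).eval W A s₃ = s.arrays aHi i := by
            simp [eval_var, eval_load, ht₃, hhi₃]
          rw [e2, eval_var, hv₃]
          refine finish _ ?_ ?_ ?_ ?_
          · rw [Store.vars_setCell, hl₃]; omega
          · rw [Store.arrays_setCell_ne _ _ _ (by decide)]
          · intro l hl; simp [hl, hT₃]
          · left; exact ⟨by simp, Or.inr hk⟩
        · rw [hcond, not_le] at hk
          refine Runs.skip (finish _ ?_ rfl ?_ ?_)
          · rw [hl₃]; omega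
          · intro l _; rw [hT₃]
          · right; exact ⟨hc, hk.le, by rw [hT₃]⟩
  · rintro s' - - - ⟨-, hH, -, -⟩
    exact hH

end Patience

end RandomRAM

namespace RandomRAM

/-! ### Extraction of chains: sequencing rules, backtracking, colouring -/

section Rules

variable {n W : ℕ} {A : Fin n → ℤ} {s : Store} {T : ℕ} {Q : Store → Prop} {c : Cmd} {e : Expr}

theorem Runs.assign_seq {x : ℕ} (h : Runs W A c (s.setVar x (e.eval W A s)) T Q) :
    Runs W A (x ≔ e ;; c) s (T + 2) Q :=
  (Runs.seq (T₁ := 1) (Runs.assign h)).mono (by omega) fun _ h => h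

theorem Runs.store_seq {a : ℕ} {i : Expr}
    (h : Runs W A c (s.setCell a (i.eval W A s) (e.eval W A s)) T Q) :
    Runs W A (.store a i e ;; c) s (T + 2) Q :=
  (Runs.seq (T₁ := 1) (Runs.store h)).mono (by omega) fun _ h => h

end Rules

section Extraction

variable {n W : ℕ} {A : Fin n → ℤ} {s : Store}

/-- Adds an interval to the chain, if possible. -/
def Cmd.backBody : Cmd :=
  vU ≔ ↟vCnt -' ♯1 -' ↟vBack ;;
  Cmd.ite (.and (.and ↟vCur (.load aF ↟vU =' ↟vCur))
      (.or (↟vCur =' ↟vLen) (.leKey (.load aHi ↟vU) (.load aLo ↟vLast))))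
    (.store aDead ↟vU (↟vRound +' ♯1) ;; vLast ≔ ↟vU ;; vCur ≔ ↟vCur -' ♯1) .skip

/-- Colours a longest chain, from its end to its beginning. -/
def Cmd.backtrack : Cmd :=
  vCur ≔ ↟vLen ;; vLast ≔ ♯0 ;; .forLt vBack vCnt .backBody

/-- Scanning from right to left, any interval of the height currently sought that fits below the
last chosen one may be taken: by `pred` it again has a suitable predecessor further left, so the
scan reaches height 0. -/
theorem backtrack_spec {cnt len x : ℕ} (hcnt : s.vars vCnt = cnt) (hcn : cnt ≤ n) (hnW : n < W)
    (hlen : s.vars vLen = len) (hx : s.vars vRound = x) (hxW : x + 1 < W)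
    (hlo : ∀ t < cnt, s.arrays aLo t < n) (hhi : ∀ t < cnt, s.arrays aHi t < n)
    (hle : ∀ t < cnt, s.arrays aDead t = 0 →
      tieKey A (s.arrays aLo t) ≤ tieKey A (s.arrays aHi t))
    (hF : IsHeight (fun t => tieKey A (s.arrays aLo t)) (fun t => tieKey A (s.arrays aHi t))
      (fun t => s.arrays aDead t = 0) cnt (s.arrays aF) len) :
    Runs W A .backtrack s (cnt * 12 + 7) (fun s' => ∃ C : Finset ℕ,
      (∀ t ∈ C, t < cnt ∧ s.arrays aDead t = 0) ∧
      IsIntervalChain (fun t => tieKey A (s.arrays aLo t)) (fun t => tieKey A (s.arrays aHi t)) C ∧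
      C.card = len ∧ ∀ t, s'.arrays aDead t = if t ∈ C then x + 1 else s.arrays aDead t) := by
  have hW1 : 1 < W := by omega
  refine (Runs.assign_seq (Runs.assign_seq (Runs.forLt (N := cnt) (Tb := 9)
    -- While nothing is chosen, the last index is kept at 0, so that the comparison evaluated in the
    -- test still addresses a valid interval. The final clause says that an interval of the sought
    -- height is still ahead.
    (Inv := fun i s' => ∃ C : Finset ℕ,
      (∀ t ∈ C, cnt ≤ t + i ∧ t < cnt ∧ s.arrays aDead t = 0) ∧
      IsIntervalChain (fun t => tieKey A (s.arrays aLo t)) (fun t => tieKey A (s.arrays aHi t)) C ∧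
      C.card + s'.vars vCur = len ∧
      (∀ t, s'.arrays aDead t = if t ∈ C then x + 1 else s.arrays aDead t) ∧
      (s'.vars vCur < len → s'.vars vLast ∈ C ∧ ∀ t ∈ C, s'.vars vLast ≤ t) ∧
      (s'.vars vCur = len → s'.vars vLast = 0) ∧
      (0 < s'.vars vCur → ∃ t, t + i < cnt ∧ s.arrays aDead t = 0 ∧
        s.arrays aF t = s'.vars vCur ∧ (s'.vars vCur < len →
          tieKey A (s.arrays aHi t) ≤ tieKey A (s.arrays aLo (s'.vars vLast)))))
    hW1 ?_ ?_ (by decide) rfl rfl ?_ ?_ ?_))).mono (by omega) (fun _ h => h)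
  · simpa using hcnt
  · omega
  · refine ⟨∅, by simp, by simp [IsIntervalChain], ?_, by simp, ?_, ?_, ?_⟩
    · simp [eval_var, hlen]
    · simp [eval_var, hlen]
    · simp [eval_const]
    · simp only [eval_const, Nat.zero_mod, Store.vars_setVar]
      simp only [eval_var, hlen, if_true]
      intro hpos
      obtain ⟨t, ht, h1, h2⟩ := hF.top (by simpa using hpos)
      exact ⟨t, by omega, h1, by simpa using h2, by simp⟩
  · rintro i hi s₁ hf hI hC ⟨C, hCm, hCc, hcard, hdead, hlast, hlast0, hex⟩
    have hlo₁ : s₁.arrays aLo = s.arrays aLo := hf.2 _ rfl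
    have hhi₁ : s₁.arrays aHi = s.arrays aHi := hf.2 _ rfl
    have hF₁ : s₁.arrays aF = s.arrays aF := hf.2 _ rfl
    have hlen₁ : s₁.vars vLen = len := by rw [hf.1 _ rfl]; simpa using hlen
    have hx₁ : s₁.vars vRound = x := by rw [hf.1 _ rfl]; simpa using hx
    have hu : (↟vCnt -' ♯1 -' ↟vBack).eval W A s₁ = cnt - 1 - i := by
      simp only [eval_sub, eval_var, eval_const, hC, hI]
      rw [Nat.mod_eq_of_lt hW1, Nat.mod_eq_of_lt (show cnt - 1 < W by omega),
        Nat.mod_eq_of_lt (by omega)]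
    refine Runs.assign_seq ?_
    rw [hu]
    obtain ⟨u, hudef⟩ : ∃ u, u = cnt - 1 - i := ⟨_, rfl⟩
    obtain ⟨cur, hcur⟩ : ∃ c, s₁.vars vCur = c := ⟨_, rfl⟩
    rw [← hudef]
    rw [hcur] at hcard hlast hlast0 hex
    replace hex : ∀ _ : Unit, 0 < cur → ∃ t, t + i < cnt ∧ s.arrays aDead t = 0 ∧
        s.arrays aF t = cur ∧ (cur < len → tieKey A (s.arrays aHi t) ≤
          tieKey A (s.arrays aLo (s₁.vars vLast))) := fun _ => hex
    have hlastn : s₁.vars vLast < cnt := by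
      rcases Nat.lt_or_ge cur len with h | h
      · exact (hCm _ (hlast h).1).2.1
      · rw [hlast0 (by omega)]; omega
    have hcond : (Expr.and (.and ↟vCur (.load aF ↟vU =' ↟vCur))
        (.or (↟vCur =' ↟vLen) (.leKey (.load aHi ↟vU) (.load aLo ↟vLast)))).eval W A
          (s₁.setVar vU u) = 0 ↔ ¬ ((0 < cur ∧ s.arrays aF u = cur) ∧ (cur = len ∨
            tieKey A (s.arrays aHi u) ≤ tieKey A (s.arrays aLo (s₁.vars vLast)))) := by
      rw [eval_and_eq_zero hW1, eval_and_eq_zero hW1, eval_or_eq_zero hW1, eval_eq_eq_zero hW1,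
        eval_eq_eq_zero hW1, eval_leKey_eq_zero hW1]
      · simp [eval_load, eval_var, hF₁, hlen₁, hhi₁, hlo₁, hcur, Nat.pos_iff_ne_zero]
      · simpa [eval_load, eval_var, hhi₁] using hhi u (by omega)
      · simpa [eval_load, eval_var, hlo₁] using hlo _ hlastn
    refine Runs.ite (T := 6) (fun h => ?_) (fun h => ?_)
    · rw [Ne, hcond, not_not] at h
      obtain ⟨⟨hcpos, hFu⟩, hor⟩ := h
      -- The program tests only the height: dead intervals have height 0 and the sought height is
      -- positive.
      have hualive : s.arrays aDead u = 0 := by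
        by_contra hne
        have := hF.dead u (by omega) hne
        omega
      have huC : u ∉ C := fun hmem => by have := (hCm u hmem).1; omega
      refine Runs.mono (T₁ := 5) (Runs.store_seq (Runs.assign_seq (Runs.assign
        ⟨insert u C, ?_, ?_, ?_, ?_, ?_, ?_, ?_⟩))) (by omega) (fun _ h => h)
      · intro t ht
        rcases Finset.mem_insert.1 ht with rfl | ht
        · exact ⟨by omega, by omega, hualive⟩
        · have := hCm t ht
          exact ⟨by omega, this.2⟩
      · intro t ht t' ht' htt
        rcases Finset.mem_insert.1 ht with htu | htC
        · rcases Finset.mem_insert.1 ht' with htu' | htC'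
          · omega
          · have hlt : cur < len := by
              have := Finset.card_pos.2 ⟨t', htC'⟩; omega
            obtain ⟨hl1, hl2⟩ := hlast hlt
            rw [htu]
            refine (hor.resolve_left hlt.ne).trans ?_
            rcases (hl2 t' htC').eq_or_lt with h' | h'
            · rw [h']
            · exact (hle _ (hCm _ hl1).2.1 (hCm _ hl1).2.2).trans (hCc _ hl1 _ htC' h')
        · rcases Finset.mem_insert.1 ht' with htu' | htC'
          · have := (hCm t htC).1; omega
          · exact hCc t htC t' htC' htt
      · simp [eval_sub, eval_var, eval_const, hcur, Finset.card_insert_of_notMem huC,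
          Nat.mod_eq_of_lt hW1]
        have := hF.le u (by omega)
        have : cur ≤ len := by omega
        have : len ≤ n := by
          have hc : C.card + cur = len := hcard
          obtain ⟨D, hD, -, hDc⟩ := hF.exists_chain hle
          have := Finset.card_le_card (show D ⊆ Finset.range cnt from fun t ht =>
            Finset.mem_range.2 (hD t ht).1)
          rw [Finset.card_range] at this
          omega
        rw [Nat.mod_eq_of_lt (by omega)]
        omega
      · intro t
        simp only [Store.arrays_setVar, Store.arrays_setCell, eval_var, eval_add, eval_const,
          Store.vars_setVar, if_true, true_and, Finset.mem_insert, hdead]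
        simp only [hx₁, Nat.mod_eq_of_lt hW1]
        by_cases htu : t = u <;> simp [htu, Nat.mod_eq_of_lt hxW]
      · simp only [Store.vars_setVar]
        simp [eval_var]
        intro _ t ht
        have := (hCm t ht).1
        omega
      · simp [eval_sub, eval_var, eval_const, hcur, Nat.mod_eq_of_lt hW1]
        intro h'
        have h2 := Nat.mod_le (cur - 1) W
        omega
      · simp [eval_sub, eval_var, eval_const, hcur, Nat.mod_eq_of_lt hW1]
        intro h'
        have hlen' : len ≤ n := by
          obtain ⟨D, hD, -, hDc⟩ := hF.exists_chain hle
          have := Finset.card_le_card (show D ⊆ Finset.range cnt from fun t ht =>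
            Finset.mem_range.2 (hD t ht).1)
          rw [Finset.card_range] at this
          omega
        -- The bound on `len` keeps the decremented height from being reduced modulo `W`.
        have hm : (cur - 1) % W = cur - 1 := Nat.mod_eq_of_lt (by omega)
        rw [hm] at h' ⊢
        obtain ⟨t', ht', h1, h2, h3⟩ := hF.pred u (by omega) hualive (by omega)
        exact ⟨t', by omega, h1, by omega, fun _ => h2⟩
    · rw [hcond] at h
      refine Runs.mono (T₁ := 1) (Runs.skip ⟨C, ?_, hCc, ?_, ?_, ?_, ?_, ?_⟩) (by omega)
        (fun _ h => h)
      · intro t ht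
        have := hCm t ht
        exact ⟨by omega, this.2⟩
      · simpa [hcur] using hcard
      · simpa using hdead
      · simpa [hcur] using hlast
      · simpa [hcur] using hlast0
      · simp only [Store.vars_setVar]
        simp [hcur]
        intro hpos
        obtain ⟨t, ht, h1, h2, h3⟩ := hex () hpos
        refine ⟨t, ?_, h1, h2, h3⟩
        by_contra hnot
        have htu : t = u := by omega
        subst htu
        refine h ⟨⟨hpos, h2⟩, ?_⟩
        rcases Nat.lt_or_ge cur len with h' | h'
        · exact Or.inr (h3 h')
        · exact Or.inl (by omega)
  · rintro s' - - - ⟨C, hCm, hCc, hcard, hdead, -, -, hex⟩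
    have h0 : s'.vars vCur = 0 := by
      by_contra hne
      obtain ⟨t, ht, -⟩ := hex (Nat.pos_of_ne_zero hne)
      omega
    exact ⟨C, fun t ht => (hCm t ht).2, hCc, by simpa [h0] using hcard, hdead⟩

/-- Extracts longest chains, one for each colour. -/
def Cmd.extract : Cmd := .forLt vRound vX (.patience ;; .backtrack)

theorem extract_spec {cnt X Lg : ℕ} (hcnt : s.vars vCnt = cnt) (hcn : cnt ≤ n)
    (hX : s.vars vX = X) (hXW : X + 1 < W)
    (hpow : s.vars vPow = 2 ^ Lg) (hn : n < 2 ^ Lg) (hW : 4 * 2 ^ Lg < W)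
    (hlo : ∀ t < cnt, s.arrays aLo t < n) (hhi : ∀ t < cnt, s.arrays aHi t < n)
    (hdead : ∀ t < cnt, s.arrays aDead t =
      if tieKey A (s.arrays aLo t) ≤ tieKey A (s.arrays aHi t) then 0 else X + 1) :
    Runs W A .extract s (X * (cnt * ((Lg + 1) * 6 + 32) + 16) + 3) (fun s' =>
      IsColouring (fun t => tieKey A (s.arrays aLo t)) (fun t => tieKey A (s.arrays aHi t))
        cnt X X (s'.arrays aDead)) := by
  have hW1 : 1 < W := by omega
  refine (Runs.forLt (N := X) (Tb := cnt * ((Lg + 1) * 6 + 20) + 5 + (cnt * 12 + 7) + 1)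
    (Inv := fun x s' =>
      IsColouring (fun t => tieKey A (s.arrays aLo t)) (fun t => tieKey A (s.arrays aHi t))
        cnt X x (s'.arrays aDead)) hW1 hX (by omega) (by decide) rfl rfl ?_ ?_ ?_).mono
    (le_of_eq (by ring)) (fun _ h => h)
  · simp only [Store.arrays_setVar]
    refine ⟨fun t ht => ?_, fun t ht => ?_, fun y hy => by omega, fun _ _ _ y hy => by omega⟩
    · rw [hdead t ht]; split_ifs <;> simp
    · rw [hdead t ht]; split_ifs with h <;> simp [h]
  · rintro x hx s₁ hf hx₁ hX₁ hcol
    have hlo₁ : s₁.arrays aLo = s.arrays aLo := hf.2 _ rfl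
    have hhi₁ : s₁.arrays aHi = s.arrays aHi := hf.2 _ rfl
    have hcnt₁ : s₁.vars vCnt = cnt := by rw [hf.1 _ rfl, hcnt]
    have hle₁ : ∀ t < cnt, s₁.arrays aDead t = 0 →
        tieKey A (s₁.arrays aLo t) ≤ tieKey A (s₁.arrays aHi t) := by
      intro t ht h0
      rw [hlo₁, hhi₁]
      by_contra hnot
      have := (hcol.discard t ht).2 hnot
      omega
    have hlon : ∀ t < cnt, s₁.arrays aLo t < n := by rwa [hlo₁]
    have hhin : ∀ t < cnt, s₁.arrays aHi t < n := by rwa [hhi₁]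
    refine Runs.seq ((patience_spec (Lg := Lg) hcnt₁ hcn (by rw [hf.1 _ rfl, hpow]) hn hW hlon hhin
      hle₁).framed.mono le_rfl ?_)
    rintro s₂ ⟨hH, hf₂⟩
    have hlo₂ : s₂.arrays aLo = s₁.arrays aLo := hf₂.2 _ rfl
    have hhi₂ : s₂.arrays aHi = s₁.arrays aHi := hf₂.2 _ rfl
    have hd₂ : s₂.arrays aDead = s₁.arrays aDead := hf₂.2 _ rfl
    refine (backtrack_spec (cnt := cnt) (x := x) (len := s₂.vars vLen) (by rw [hf₂.1 _ rfl, hcnt₁])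
      hcn (by omega) rfl (by rw [hf₂.1 _ rfl, hx₁]) (by omega) (by rwa [hlo₂]) (by rwa [hhi₂])
      (by rwa [hlo₂, hhi₂, hd₂]) (by rwa [hlo₂, hhi₂, hd₂])).mono le_rfl ?_
    rintro s₃ ⟨C, hC, hCc, hcard, hd⟩
    rw [hd₂] at hC hd
    rw [hlo₂, hhi₂, hlo₁, hhi₁] at hCc
    rw [hlo₁, hhi₁] at hH
    rw [Store.arrays_setVar]
    exact hcol.succ hx hH hC hCc hcard fun t _ => hd t
  · rintro s' - - - h
    exact h

/-- Forms the intervals spanned by two samples of the same column. -/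
def Cmd.cells : Cmd := .forLt vCell vM <|
  vCol ≔ ↟vCell /' ↟vSS ;;
  .store aLo ↟vCell (↟vCol *' ↟vQ +' .load aRand (↟vCol *' ↟vS +' (↟vCell /' ↟vS) %' ↟vS)) ;;
  .store aHi ↟vCell (↟vCol *' ↟vQ +' .load aRand (↟vCol *' ↟vS +' ↟vCell %' ↟vS)) ;;
  .ite (.leKey (.load aLo ↟vCell) (.load aHi ↟vCell)) (.store aDead ↟vCell ♯0)
    (.store aDead ↟vCell (↟vX +' ♯1))

theorem cells_spec {q sn X : ℕ} {ω : ℕ → ℕ} (hq : s.vars vQ = q) (hs : s.vars vS = sn)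
    (hss : s.vars vSS = sn * sn) (hM : s.vars vM = q * (sn * sn)) (hX : s.vars vX = X)
    (hXW : X + 1 < W) (hsn : 0 < sn) (hssq : sn * sn ≤ q) (hqn : q * q ≤ n) (hnW : n < W)
    (hω : ∀ j < q * sn, ω j < q) (hrand : ∀ j < q * sn, s.arrays aRand j = ω j) :
    Runs W A .cells s (q * (sn * sn) * 11 + 3) (fun s' => ∀ t < q * (sn * sn),
      s'.arrays aLo t = samplePos q sn ω (t / (sn * sn)) (t / sn % sn) ∧
      s'.arrays aHi t = samplePos q sn ω (t / (sn * sn)) (t % sn) ∧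
      s'.arrays aLo t < n ∧ s'.arrays aHi t < n ∧
      s'.arrays aDead t =
        if tieKey A (s'.arrays aLo t) ≤ tieKey A (s'.arrays aHi t) then 0 else X + 1) := by
  have hW1 : 1 < W := by omega
  have hMq : q * (sn * sn) ≤ q * q := Nat.mul_le_mul_left _ hssq
  have hss0 : 0 < sn * sn := Nat.mul_pos hsn hsn
  have hs_ss : sn ≤ sn * sn := Nat.le_mul_self sn
  have hqsq : q * sn ≤ q * q := Nat.mul_le_mul_left _ (hs_ss.trans hssq)
  refine Runs.forLt (N := q * (sn * sn)) (Tb := 8) (Inv := fun i s' => ∀ t < i,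
      s'.arrays aLo t = samplePos q sn ω (t / (sn * sn)) (t / sn % sn) ∧
      s'.arrays aHi t = samplePos q sn ω (t / (sn * sn)) (t % sn) ∧
      s'.arrays aLo t < n ∧ s'.arrays aHi t < n ∧
      s'.arrays aDead t =
        if tieKey A (s'.arrays aLo t) ≤ tieKey A (s'.arrays aHi t) then 0 else X + 1)
    hW1 hM (by omega) (by decide) rfl rfl (by simp) ?_ (fun s' _ _ _ h => h)
  rintro t ht s₁ hf ht₁ hM₁ hI
  have hq₁ : s₁.vars vQ = q := by rw [hf.1 _ rfl, hq]
  have hs₁ : s₁.vars vS = sn := by rw [hf.1 _ rfl, hs]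
  have hss₁ : s₁.vars vSS = sn * sn := by rw [hf.1 _ rfl, hss]
  have hX₁ : s₁.vars vX = X := by rw [hf.1 _ rfl, hX]
  have hr₁ : s₁.arrays aRand = s.arrays aRand := hf.2 _ rfl
  set i := t / (sn * sn) with hi
  have hiq : i < q := Nat.div_lt_of_lt_mul (by rwa [mul_comm])
  have hiq1 : i * q + q ≤ q * q := by
    calc i * q + q = (i + 1) * q := by ring
      _ ≤ q * q := Nat.mul_le_mul_right _ hiq
  have his : i * sn + sn ≤ q * sn := by
    calc i * sn + sn = (i + 1) * sn := by ring
      _ ≤ q * sn := Nat.mul_le_mul_right _ hiq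
  have hpos : ∀ a < sn, samplePos q sn ω i a < n := by
    intro a ha
    have := hω (i * sn + a) (by omega)
    simp only [samplePos]; omega
  have ha : t / sn % sn < sn := Nat.mod_lt _ hsn
  have hb : t % sn < sn := Nat.mod_lt _ hsn
  have hts : t / sn ≤ t := Nat.div_le_self _ _
  have e0 : (↟vCell /' ↟vSS).eval W A s₁ = i := by
    rw [eval_div, eval_var, eval_var, ht₁, hss₁, ← hi, Nat.mod_eq_of_lt (by omega)]
  refine Runs.assign_seq ?_
  rw [e0]
  have e1 : (↟vCol *' ↟vQ +' .load aRand (↟vCol *' ↟vS +' (↟vCell /' ↟vS) %' ↟vS)).eval W A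
      (s₁.setVar vCol i) = samplePos q sn ω i (t / sn % sn) := by
    simp only [eval_add, eval_mul, eval_load, eval_mod, eval_div, eval_var, Store.vars_setVar,
      Store.arrays_setVar, if_true]
    simp only [Nat.reduceEqDiff, if_false, hq₁, hs₁, ht₁, hr₁]
    rw [Nat.mod_eq_of_lt (show i * q < W by omega), Nat.mod_eq_of_lt (show i * sn < W by omega),
      Nat.mod_eq_of_lt (show t / sn < W by omega), Nat.mod_eq_of_lt (show t / sn % sn < W by omega),
      Nat.mod_eq_of_lt (show i * sn + t / sn % sn < W by omega), hrand _ (by omega)]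
    exact Nat.mod_eq_of_lt ((hpos _ ha).trans hnW)
  refine Runs.store_seq ?_
  rw [e1, eval_var, Store.vars_setVar, if_neg (by decide), ht₁]
  have e2 : (↟vCol *' ↟vQ +' .load aRand (↟vCol *' ↟vS +' ↟vCell %' ↟vS)).eval W A
      ((s₁.setVar vCol i).setCell aLo t (samplePos q sn ω i (t / sn % sn))) =
        samplePos q sn ω i (t % sn) := by
    simp only [eval_add, eval_mul, eval_load, eval_mod, eval_var, Store.vars_setVar,
      Store.vars_setCell, Store.arrays_setCell, Store.arrays_setVar, if_true]
    simp only [Nat.reduceEqDiff, if_false, hq₁, hs₁, ht₁, hr₁, OfNat.zero_ne_ofNat, false_and]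
    rw [Nat.mod_eq_of_lt (show i * q < W by omega), Nat.mod_eq_of_lt (show i * sn < W by omega),
      Nat.mod_eq_of_lt (show t % sn < W by omega),
      Nat.mod_eq_of_lt (show i * sn + t % sn < W by omega), hrand _ (by omega)]
    exact Nat.mod_eq_of_lt ((hpos _ hb).trans hnW)
  refine Runs.store_seq ?_
  rw [e2, eval_var, Store.vars_setCell, Store.vars_setVar, if_neg (by decide), ht₁]
  set s₂ := ((s₁.setVar vCol i).setCell aLo t (samplePos q sn ω i (t / sn % sn))).setCell aHi t
    (samplePos q sn ω i (t % sn)) with hs₂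
  have hlo₂ : ∀ u, s₂.arrays aLo u = if u = t then samplePos q sn ω i (t / sn % sn) else
      s₁.arrays aLo u := by intro u; simp [hs₂]
  have hhi₂ : ∀ u, s₂.arrays aHi u = if u = t then samplePos q sn ω i (t % sn) else
      s₁.arrays aHi u := by intro u; simp [hs₂]
  have hd₂ : ∀ u, s₂.arrays aDead u = s₁.arrays aDead u := by intro u; simp [hs₂]
  have ht₂ : s₂.vars vCell = t := by simp [hs₂, ht₁]
  have hX₂ : s₂.vars vX = X := by simp [hs₂, hX₁]
  have hcond : (Expr.leKey (.load aLo ↟vCell) (.load aHi ↟vCell)).eval W A s₂ = 0 ↔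
      ¬ tieKey A (samplePos q sn ω i (t / sn % sn)) ≤ tieKey A (samplePos q sn ω i (t % sn)) := by
    rw [eval_leKey_eq_zero hW1]
    · simp [eval_load, eval_var, ht₂, hlo₂, hhi₂]
    · simpa [eval_load, eval_var, ht₂, hlo₂] using hpos _ ha
    · simpa [eval_load, eval_var, ht₂, hhi₂] using hpos _ hb
  have finish : ∀ d, d = (if tieKey A (samplePos q sn ω i (t / sn % sn)) ≤
        tieKey A (samplePos q sn ω i (t % sn)) then 0 else X + 1) →
      ∀ u < t + 1,
        ((s₂.setCell aDead t d).setVar vCell (t + 1)).arrays aLo u =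
          samplePos q sn ω (u / (sn * sn)) (u / sn % sn) ∧
        ((s₂.setCell aDead t d).setVar vCell (t + 1)).arrays aHi u =
          samplePos q sn ω (u / (sn * sn)) (u % sn) ∧
        ((s₂.setCell aDead t d).setVar vCell (t + 1)).arrays aLo u < n ∧
        ((s₂.setCell aDead t d).setVar vCell (t + 1)).arrays aHi u < n ∧
        ((s₂.setCell aDead t d).setVar vCell (t + 1)).arrays aDead u =
          if tieKey A (((s₂.setCell aDead t d).setVar vCell (t + 1)).arrays aLo u) ≤
            tieKey A (((s₂.setCell aDead t d).setVar vCell (t + 1)).arrays aHi u)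
          then 0 else X + 1 := by
    intro d hd u hu
    simp only [Store.arrays_setVar, Store.arrays_setCell, Nat.reduceEqDiff, false_and, if_false,
      true_and, hlo₂, hhi₂, hd₂]
    rcases Nat.lt_succ_iff_lt_or_eq.1 hu with hu | rfl
    · simp only [hu.ne, if_false]
      exact hI u hu
    · simp only [if_true]
      exact ⟨rfl, rfl, hpos _ ha, hpos _ hb, hd⟩
  refine Runs.ite (T := 1) (fun h => ?_) (fun h => ?_)
  · rw [Ne, hcond, not_not] at h
    refine Runs.store ?_
    rw [eval_var, ht₂, eval_const, Nat.zero_mod]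
    exact finish 0 (by rw [if_pos h])
  · rw [hcond] at h
    refine Runs.store ?_
    have e3 : (↟vX +' ♯1).eval W A s₂ = X + 1 := by
      rw [eval_add, eval_var, eval_const, hX₂, Nat.mod_eq_of_lt hW1, Nat.mod_eq_of_lt hXW]
    rw [eval_var, ht₂, e3]
    exact finish (X + 1) (by rw [if_neg h])

/-- Saves the intervals and their colours. -/
def Cmd.save : Cmd := .forLt vSave vM <|
  .store aCellLo ↟vSave (.load aLo ↟vSave) ;;
  .store aCellHi ↟vSave (.load aHi ↟vSave) ;;
  .store aCellCol ↟vSave (.load aDead ↟vSave)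

/-- The copies are needed because the evaluation of qualities runs `patience` in the same working
arrays. -/
theorem save_spec {M : ℕ} (hM : s.vars vM = M) (hMW : M < W) (hW1 : 1 < W) :
    Runs W A .save s (M * 8 + 3) (fun s' => ∀ t < M, s'.arrays aCellLo t = s.arrays aLo t ∧
      s'.arrays aCellHi t = s.arrays aHi t ∧ s'.arrays aCellCol t = s.arrays aDead t) := by
  refine Runs.forLt (N := M) (Tb := 5) (Inv := fun i s' => ∀ t < i,
      s'.arrays aCellLo t = s.arrays aLo t ∧
      s'.arrays aCellHi t = s.arrays aHi t ∧ s'.arrays aCellCol t = s.arrays aDead t)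
    hW1 hM hMW (by decide) rfl rfl (by simp) ?_ (fun s' _ _ _ h => h)
  rintro t ht s₁ hf ht₁ hM₁ hI
  have hlo₁ : s₁.arrays aLo = s.arrays aLo := hf.2 _ rfl
  have hhi₁ : s₁.arrays aHi = s.arrays aHi := hf.2 _ rfl
  have hd₁ : s₁.arrays aDead = s.arrays aDead := hf.2 _ rfl
  refine Runs.store_seq (Runs.store_seq (Runs.store fun u hu => ?_))
  simp only [eval_var, eval_load, Store.vars_setCell, Store.arrays_setCell, Store.arrays_setVar,
    ht₁, hlo₁, hhi₁, hd₁]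
  rcases Nat.lt_succ_iff_lt_or_eq.1 hu with hu | rfl
  · simpa [hu.ne] using hI u hu
  · simp

/-- Forms the intervals and partitions them into chains. -/
def Cmd.colouring : Cmd := .cells ;; vCnt ≔ ↟vM ;; .extract ;; .save

theorem colouring_spec {q sn X Lg : ℕ} {ω : ℕ → ℕ} (hq : s.vars vQ = q) (hs : s.vars vS = sn)
    (hss : s.vars vSS = sn * sn) (hM : s.vars vM = q * (sn * sn)) (hX : s.vars vX = X)
    (hXW : X + 1 < W) (hsn : 0 < sn) (hssq : sn * sn ≤ q) (hqn : q * q ≤ n)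
    (hpow : s.vars vPow = 2 ^ Lg) (hn : n < 2 ^ Lg) (hW : 4 * 2 ^ Lg < W)
    (hω : ∀ j < q * sn, ω j < q) (hrand : ∀ j < q * sn, s.arrays aRand j = ω j) :
    Runs W A .colouring s (X * (q * (sn * sn) * ((Lg + 1) * 6 + 32) + 16) +
        q * (sn * sn) * 19 + 13) (fun s' =>
      (∀ t < q * (sn * sn),
        s'.arrays aCellLo t = samplePos q sn ω (t / (sn * sn)) (t / sn % sn) ∧
        s'.arrays aCellHi t = samplePos q sn ω (t / (sn * sn)) (t % sn) ∧
        s'.arrays aCellLo t < n ∧ s'.arrays aCellHi t < n) ∧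
      IsColouring (fun t => tieKey A (s'.arrays aCellLo t)) (fun t => tieKey A (s'.arrays aCellHi t))
        (q * (sn * sn)) X X (s'.arrays aCellCol)) := by
  have hMq : q * (sn * sn) ≤ q * q := Nat.mul_le_mul_left _ hssq
  refine (Runs.seq (T₂ := X * (q * (sn * sn) * ((Lg + 1) * 6 + 32) + 16) + 3 +
    (q * (sn * sn) * 8 + 3) + 1 + 2)
    ((cells_spec hq hs hss hM hX hXW hsn hssq hqn (by omega) hω hrand).framed.mono
    le_rfl ?_)).mono (le_of_eq (by ring)) (fun _ h => h)
  rintro s₁ ⟨hI, hf₁⟩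
  refine Runs.assign_seq (Runs.seq ((extract_spec (cnt := q * (sn * sn)) (X := X) (Lg := Lg)
    ?_ (by omega) ?_ hXW ?_ hn hW ?_ ?_ ?_).framed.mono le_rfl ?_))
  · simp [eval_var, hf₁.1 vM rfl, hM]
  · simp [hf₁.1 vX rfl, hX]
  · simp [hf₁.1 vPow rfl, hpow]
  · exact fun t ht => (hI t ht).2.2.1
  · exact fun t ht => (hI t ht).2.2.2.1
  · exact fun t ht => (hI t ht).2.2.2.2
  rintro s₂ ⟨hcol, hf₂⟩
  simp only [Store.arrays_setVar] at hcol
  have hlo₂ : s₂.arrays aLo = s₁.arrays aLo := hf₂.2 _ rfl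
  have hhi₂ : s₂.arrays aHi = s₁.arrays aHi := hf₂.2 _ rfl
  have hM₂ : s₂.vars vM = q * (sn * sn) := by
    rw [hf₂.1 _ rfl]; simp [hf₁.1 vM rfl, hM]
  refine (save_spec hM₂ (by omega) (by omega)).mono le_rfl ?_
  intro s₃ h₃
  rw [hlo₂, hhi₂] at h₃
  refine ⟨fun t ht => ?_, ?_⟩
  · obtain ⟨h1, h2, -⟩ := h₃ t ht
    obtain ⟨h3, h4, h5, h6, -⟩ := hI t ht
    rw [h1, h2]
    exact ⟨h3, h4, h5, h6⟩
  -- A colouring depends only on the entries below the number of intervals, and there the saved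
  -- arrays agree with the originals.
  · refine ⟨fun t ht => ?_, fun t ht => ?_, fun y hy => ?_, fun C hC hCc y hy => ?_⟩
    · rw [(h₃ t ht).2.2]; exact hcol.le t ht
    · rw [(h₃ t ht).2.2, (h₃ t ht).1, (h₃ t ht).2.1]; exact hcol.discard t ht
    · intro t ht t' ht' htt
      rw [Finset.mem_filter, Finset.mem_range] at ht ht'
      simp only [(h₃ t ht.1).2.1, (h₃ t' ht'.1).1]
      rw [(h₃ _ ht.1).2.2] at ht
      rw [(h₃ _ ht'.1).2.2] at ht'
      exact hcol.chain y hy t (by simpa using ht) t' (by simpa using ht') htt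
    · rw [show (Finset.range (q * (sn * sn))).filter (fun t => s₃.arrays aCellCol t = y + 1) =
        (Finset.range (q * (sn * sn))).filter (fun t => s₂.arrays aDead t = y + 1) from
        Finset.filter_congr fun t ht => by rw [(h₃ t (Finset.mem_range.1 ht)).2.2]]
      refine hcol.card_le C (fun t ht => ?_) (fun t ht t' ht' htt => ?_) y hy
      · rw [← (h₃ t (hC t ht).1).2.2]; exact hC t ht
      · have := hCc t ht t' ht' htt
        simpa only [(h₃ t (hC t ht).1).2.1, (h₃ t' (hC t' ht').1).1] using this

end Extraction

end RandomRAM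

namespace RandomRAM

section Rules

/-! ### Evaluation of colours: hulls, qualities and sampled totals -/

variable {n W : ℕ} {A : Fin n → ℤ} {s : Store} {T : ℕ} {Q : Store → Prop} {c : Cmd} {e b : Expr}

theorem Store.setVar_self (s : Store) (x : ℕ) : s.setVar x (s.vars x) = s := by
  simp [Store.setVar]

theorem Runs.assign_if {x : ℕ}
    (h : Q (s.setVar x (if b.eval W A s = 0 then s.vars x else e.eval W A s))) :
    Runs W A (.ite b (x ≔ e) .skip) s 2 Q := by
  refine Runs.ite (T := 1) (fun hb => Runs.assign ?_) (fun hb => Runs.skip ?_)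
  · rwa [if_neg hb] at h
  · rwa [if_pos hb, Store.setVar_self] at h

theorem Runs.assign_if_seq {x : ℕ}
    (h : Runs W A c (s.setVar x (if b.eval W A s = 0 then s.vars x else e.eval W A s)) T Q) :
    Runs W A (.ite b (x ≔ e) .skip ;; c) s (T + 3) Q :=
  (Runs.seq (T₁ := 2) (Runs.assign_if h)).mono (by omega) fun _ h => h

end Rules

section Evaluation

variable {n W : ℕ} {A : Fin n → ℤ} {s : Store}

/-- Extends the current hull by an interval of the current colour. -/
def Cmd.hullBody : Cmd :=
  vIdx ≔ ↟vI *' ↟vSS +' ↟vR ;;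
  Cmd.ite (.load aCellCol ↟vIdx =' ↟vColour +' ♯1)
    (Cmd.ite (.or (.not ↟vFound) (.leKey (.load aCellLo ↟vIdx) ↟vHullLo))
        (vHullLo ≔ .load aCellLo ↟vIdx) .skip ;;
      Cmd.ite (.or (.not ↟vFound) (.leKey ↟vHullHi (.load aCellHi ↟vIdx)))
        (vHullHi ≔ .load aCellHi ↟vIdx) .skip ;;
      vFound ≔ ♯1) .skip

/-- Computes the hull of the intervals of the current colour in the current column. -/
def Cmd.hull : Cmd :=
  vFound ≔ ♯0 ;; vHullLo ≔ ♯0 ;; vHullHi ≔ ♯0 ;; .forLt vR vSS .hullBody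

/-- The running minimum and maximum are described by the values they cut off. In this form they
match `mem_hullRegion` directly, and columns without an interval of the colour need no separate
case. -/
theorem hull_spec {x i ss q : ℕ} (hi : s.vars vI = i) (hx : s.vars vColour = x)
    (hss : s.vars vSS = ss) (hiq : i < q) (hssW : q * ss < W) (hxW : x + 1 < W)
    (hn : 0 < n)
    (hlo : ∀ t < q * ss, s.arrays aCellLo t < n) (hhi : ∀ t < q * ss, s.arrays aCellHi t < n) :
    Runs W A .hull s (ss * 14 + 9) (fun s' => s'.vars vHullLo < n ∧ s'.vars vHullHi < n ∧
      (∀ v : ℤ, (s'.vars vFound ≠ 0 ∧ tieKey A (s'.vars vHullLo) < v) ↔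
        ∃ r < ss, s.arrays aCellCol (i * ss + r) = x + 1 ∧
          tieKey A (s.arrays aCellLo (i * ss + r)) < v) ∧
      ∀ v : ℤ, (s'.vars vFound ≠ 0 ∧ v ≤ tieKey A (s'.vars vHullHi)) ↔
        ∃ r < ss, s.arrays aCellCol (i * ss + r) = x + 1 ∧
          v ≤ tieKey A (s.arrays aCellHi (i * ss + r))) := by
  have hW1 : 1 < W := by omega
  have hiss : i * ss + ss ≤ q * ss := by
    calc i * ss + ss = (i + 1) * ss := by ring
      _ ≤ q * ss := Nat.mul_le_mul_right _ hiq
  refine (Runs.assign_seq (Runs.assign_seq (Runs.assign_seq (Runs.forLt (N := ss) (Tb := 11)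
    (Inv := fun k s' => s'.vars vHullLo < n ∧ s'.vars vHullHi < n ∧
      (∀ v : ℤ, (s'.vars vFound ≠ 0 ∧ tieKey A (s'.vars vHullLo) < v) ↔
        ∃ r < k, s.arrays aCellCol (i * ss + r) = x + 1 ∧
          tieKey A (s.arrays aCellLo (i * ss + r)) < v) ∧
      ∀ v : ℤ, (s'.vars vFound ≠ 0 ∧ v ≤ tieKey A (s'.vars vHullHi)) ↔
        ∃ r < k, s.arrays aCellCol (i * ss + r) = x + 1 ∧
          v ≤ tieKey A (s.arrays aCellHi (i * ss + r)))
    hW1 ?_ (by omega) (by decide) rfl rfl ?_ ?_ (fun s' _ _ _ h => h))))).mono (by omega)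
      (fun _ h => h)
  · simpa using hss
  · simp [eval_const, hn]
  rintro k hk s₁ hf hR hS ⟨h1, h2, h3, h4⟩
  have hlo₁ : s₁.arrays aCellLo = s.arrays aCellLo := hf.2 _ rfl
  have hhi₁ : s₁.arrays aCellHi = s.arrays aCellHi := hf.2 _ rfl
  have hcol₁ : s₁.arrays aCellCol = s.arrays aCellCol := hf.2 _ rfl
  have hi₁ : s₁.vars vI = i := by rw [hf.1 _ rfl]; simpa using hi
  have hx₁ : s₁.vars vColour = x := by rw [hf.1 _ rfl]; simpa using hx
  have e0 : (↟vI *' ↟vSS +' ↟vR).eval W A s₁ = i * ss + k := by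
    rw [eval_add, eval_mul, eval_var, eval_var, eval_var, hi₁, hS, hR,
      Nat.mod_eq_of_lt (show i * ss < W by omega), Nat.mod_eq_of_lt (by omega)]
  refine Runs.assign_seq ?_
  rw [e0]
  have hlok := hlo (i * ss + k) (by omega)
  have hhik := hhi (i * ss + k) (by omega)
  obtain ⟨s₂, hs₂⟩ : ∃ s₂, s₂ = s₁.setVar vIdx (i * ss + k) := ⟨_, rfl⟩
  rw [← hs₂]
  have hcond : (.load aCellCol ↟vIdx =' ↟vColour +' ♯1).eval W A s₂ = 0 ↔
      ¬ s.arrays aCellCol (i * ss + k) = x + 1 := by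
    rw [eval_eq_eq_zero hW1, eval_load, eval_add, eval_const, eval_var, eval_var,
      Nat.mod_eq_of_lt hW1, hs₂]
    simp [hcol₁, hx₁, Nat.mod_eq_of_lt hxW]
  refine Runs.ite (T := 8) (fun h => ?_) (fun h => ?_)
  · rw [Ne, hcond, not_not] at h
    have hc1 : (Expr.or (.not ↟vFound) (.leKey (.load aCellLo ↟vIdx) ↟vHullLo)).eval W A s₂ = 0 ↔
        s₁.vars vFound ≠ 0 ∧ ¬ tieKey A (s.arrays aCellLo (i * ss + k)) ≤
          tieKey A (s₁.vars vHullLo) := by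
      rw [eval_or_eq_zero hW1, eval_not_eq_zero hW1, eval_leKey_eq_zero hW1]
      · simp [eval_load, eval_var, hs₂, hlo₁]
      · simpa [eval_load, eval_var, hs₂, hlo₁] using hlok
      · simpa [eval_var, hs₂] using h1
    refine Runs.mono (T₁ := 7) (Runs.assign_if_seq (Runs.assign_if_seq (Runs.assign ?_))) (by omega)
      (fun _ h => h)
    obtain ⟨lo, hlo'⟩ : ∃ lo, lo = if (Expr.or (.not ↟vFound)
        (.leKey (.load aCellLo ↟vIdx) ↟vHullLo)).eval W A s₂ = 0 then s₂.vars vHullLo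
        else (Expr.load aCellLo ↟vIdx).eval W A s₂ := ⟨_, rfl⟩
    rw [← hlo']
    have hc2 : (Expr.or (.not ↟vFound) (.leKey ↟vHullHi (.load aCellHi ↟vIdx))).eval W A
        (s₂.setVar vHullLo lo) = 0 ↔ s₁.vars vFound ≠ 0 ∧ ¬ tieKey A (s₁.vars vHullHi) ≤
          tieKey A (s.arrays aCellHi (i * ss + k)) := by
      rw [eval_or_eq_zero hW1, eval_not_eq_zero hW1, eval_leKey_eq_zero hW1]
      · simp [eval_load, eval_var, hs₂, hhi₁]
      · simpa [eval_var, hs₂] using h2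
      · simpa [eval_load, eval_var, hs₂, hhi₁] using hhik
    have hlo2 : lo = if s₁.vars vFound ≠ 0 ∧ ¬ tieKey A (s.arrays aCellLo (i * ss + k)) ≤
        tieKey A (s₁.vars vHullLo) then s₁.vars vHullLo else s.arrays aCellLo (i * ss + k) := by
      rw [hlo', if_congr hc1 rfl rfl]
      simp [eval_load, eval_var, hs₂, hlo₁]
    obtain ⟨hi', hhi'⟩ : ∃ hi', hi' = if (Expr.or (.not ↟vFound)
        (.leKey ↟vHullHi (.load aCellHi ↟vIdx))).eval W A (s₂.setVar vHullLo lo) = 0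
        then (s₂.setVar vHullLo lo).vars vHullHi
        else (Expr.load aCellHi ↟vIdx).eval W A (s₂.setVar vHullLo lo) := ⟨_, rfl⟩
    have hhi2 : hi' = if s₁.vars vFound ≠ 0 ∧ ¬ tieKey A (s₁.vars vHullHi) ≤
          tieKey A (s.arrays aCellHi (i * ss + k)) then s₁.vars vHullHi
        else s.arrays aCellHi (i * ss + k) := by
      rw [hhi', if_congr hc2 rfl rfl]
      simp [eval_load, eval_var, hs₂, hhi₁]
    rw [← hhi']
    simp only [Store.vars_setVar, Nat.reduceEqDiff, if_true, if_false, eval_const,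
      Nat.mod_eq_of_lt hW1, ne_eq, one_ne_zero, not_false_eq_true, true_and,
      Nat.exists_lt_succ_right, ← h3, ← h4, h]
    refine ⟨?_, ?_, fun v => ?_, fun v => ?_⟩
    · rw [hlo2]; split_ifs <;> assumption
    · rw [hhi2]; split_ifs <;> assumption
    · rw [hlo2]
      split_ifs with h'
      · have := not_le.1 h'.2
        constructor
        · exact fun h5 => Or.inl ⟨h'.1, h5⟩
        · rintro (h5 | h5)
          · exact h5.2
          · exact this.trans h5
      · constructor
        · exact Or.inr
        · rintro (h5 | h5)
          · exact (not_not.1 (not_and.1 h' h5.1)).trans_lt h5.2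
          · exact h5
    · rw [hhi2]
      split_ifs with h'
      · have := not_le.1 h'.2
        constructor
        · exact fun h5 => Or.inl ⟨h'.1, h5⟩
        · rintro (h5 | h5)
          · exact h5.2
          · exact h5.trans this.le
      · constructor
        · exact Or.inr
        · rintro (h5 | h5)
          · exact h5.2.trans (not_not.1 (not_and.1 h' h5.1))
          · exact h5
  · rw [hcond] at h
    refine Runs.mono (T₁ := 1) (Runs.skip ?_) (by omega) (fun _ h => h)
    simp only [hs₂, Store.vars_setVar, Nat.reduceEqDiff, if_false, Nat.exists_lt_succ_right, h,
      false_and, or_false]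
    exact ⟨h1, h2, h3, h4⟩

/-- Prepares the positions of the current column for the computation of a longest chain; alive are
those in the hull. -/
def Cmd.copy : Cmd := .forLt vOff vQ <|
  vP ≔ ↟vI *' ↟vQ +' ↟vOff ;; .store aLo ↟vOff ↟vP ;; .store aHi ↟vOff ↟vP ;;
  Cmd.ite (.and ↟vFound (.and (.not (.leKey ↟vP ↟vHullLo)) (.leKey ↟vP ↟vHullHi)))
    (.store aDead ↟vOff ♯0) (.store aDead ↟vOff ♯1)

theorem copy_spec {i q : ℕ} (hi : s.vars vI = i) (hq : s.vars vQ = q) (hiq : i < q)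
    (hqn : q * q ≤ n) (hnW : n < W) (hlo : s.vars vHullLo < n) (hhi : s.vars vHullHi < n) :
    Runs W A .copy s (q * 11 + 3) (fun s' => ∀ t < q, s'.arrays aLo t = i * q + t ∧
      s'.arrays aHi t = i * q + t ∧ (s'.arrays aDead t = 0 ↔ s.vars vFound ≠ 0 ∧
        tieKey A (s.vars vHullLo) < tieKey A (i * q + t) ∧
          tieKey A (i * q + t) ≤ tieKey A (s.vars vHullHi))) := by
  have hW1 : 1 < W := by
    have : 0 < q * q := Nat.mul_pos (by omega) (by omega)
    omega
  have hqq : i * q + q ≤ q * q := by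
    calc i * q + q = (i + 1) * q := by ring
      _ ≤ q * q := Nat.mul_le_mul_right _ hiq
  refine Runs.forLt (N := q) (Tb := 8) (Inv := fun k s' => ∀ t < k, s'.arrays aLo t = i * q + t ∧
      s'.arrays aHi t = i * q + t ∧ (s'.arrays aDead t = 0 ↔ s.vars vFound ≠ 0 ∧
        tieKey A (s.vars vHullLo) < tieKey A (i * q + t) ∧
          tieKey A (i * q + t) ≤ tieKey A (s.vars vHullHi)))
    hW1 hq (by omega) (by decide) rfl rfl (by simp) ?_ (fun s' _ _ _ h => h)
  rintro t ht s₁ hf ht₁ hq₁ hI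
  have hi₁ : s₁.vars vI = i := by rw [hf.1 _ rfl, hi]
  have hlo₁ : s₁.vars vHullLo = s.vars vHullLo := hf.1 _ rfl
  have hhi₁ : s₁.vars vHullHi = s.vars vHullHi := hf.1 _ rfl
  have hf₁ : s₁.vars vFound = s.vars vFound := hf.1 _ rfl
  have e0 : (↟vI *' ↟vQ +' ↟vOff).eval W A s₁ = i * q + t := by
    rw [eval_add, eval_mul, eval_var, eval_var, eval_var, hi₁, hq₁, ht₁,
      Nat.mod_eq_of_lt (show i * q < W by omega), Nat.mod_eq_of_lt (by omega)]
  refine Runs.assign_seq (Runs.store_seq (Runs.store_seq ?_))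
  rw [e0]
  simp only [eval_var, Store.vars_setVar, Store.vars_setCell, Nat.reduceEqDiff, if_true, if_false,
    ht₁]
  obtain ⟨s₂, hs₂⟩ : ∃ s₂, s₂ = ((s₁.setVar vP (i * q + t)).setCell aLo t (i * q + t)).setCell aHi t
    (i * q + t) := ⟨_, rfl⟩
  rw [← hs₂]
  have hcond : (Expr.and ↟vFound (.and (.not (.leKey ↟vP ↟vHullLo)) (.leKey ↟vP ↟vHullHi))).eval
      W A s₂ = 0 ↔ ¬ (s.vars vFound ≠ 0 ∧ tieKey A (s.vars vHullLo) < tieKey A (i * q + t) ∧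
          tieKey A (i * q + t) ≤ tieKey A (s.vars vHullHi)) := by
    rw [eval_and_eq_zero hW1, eval_and_eq_zero hW1, eval_not_eq_zero hW1, eval_leKey_eq_zero hW1,
      eval_leKey_eq_zero hW1]
    · simp [eval_var, hs₂, hlo₁, hhi₁, hf₁]
    · simp [eval_var, hs₂]; omega
    · simpa [eval_var, hs₂, hhi₁] using hhi
    · simp [eval_var, hs₂]; omega
    · simpa [eval_var, hs₂, hlo₁] using hlo
  have finish : ∀ d, (d = 0 ↔ s.vars vFound ≠ 0 ∧ tieKey A (s.vars vHullLo) < tieKey A (i * q + t) ∧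
          tieKey A (i * q + t) ≤ tieKey A (s.vars vHullHi)) → ∀ u < t + 1,
      ((s₂.setCell aDead t d).setVar vOff (t + 1)).arrays aLo u = i * q + u ∧
      ((s₂.setCell aDead t d).setVar vOff (t + 1)).arrays aHi u = i * q + u ∧
      (((s₂.setCell aDead t d).setVar vOff (t + 1)).arrays aDead u = 0 ↔ s.vars vFound ≠ 0 ∧
        tieKey A (s.vars vHullLo) < tieKey A (i * q + u) ∧
          tieKey A (i * q + u) ≤ tieKey A (s.vars vHullHi)) := by
    intro d hd u hu
    rcases Nat.lt_succ_iff_lt_or_eq.1 hu with hu | rfl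
    · simpa [hs₂, hu.ne] using hI u hu
    · simpa [hs₂] using hd
  have ht₂ : s₂.vars vOff = t := by simp [hs₂, ht₁]
  refine Runs.ite (T := 1) (fun h => ?_) (fun h => ?_)
  · rw [Ne, hcond, not_not] at h
    refine Runs.store ?_
    rw [eval_var, ht₂, eval_const, Nat.zero_mod]
    exact finish 0 (iff_of_true rfl h)
  · rw [hcond] at h
    refine Runs.store ?_
    rw [eval_var, ht₂, eval_const, Nat.mod_eq_of_lt hW1]
    exact finish 1 (iff_of_false one_ne_zero h)

/-- Computes the quality of the current colour in the current column. -/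
def Cmd.quality : Cmd := .hull ;; .copy ;; .patience

/-- Each position is treated as an interval whose two ends coincide, alive exactly in the hull; a
longest chain of such intervals is a longest increasing subsequence by `IsHeight.len_eq_maxInc`. -/
theorem quality_spec {x i q sn Lg : ℕ} (hi : s.vars vI = i) (hx : s.vars vColour = x)
    (hss : s.vars vSS = sn * sn) (hq : s.vars vQ = q) (hcnt : s.vars vCnt = q) (hiq : i < q)
    (hssq : sn * sn ≤ q) (hxW : x + 1 < W)
    (hqn : q * q ≤ n) (hpow : s.vars vPow = 2 ^ Lg) (hn : n < 2 ^ Lg) (hW : 4 * 2 ^ Lg < W)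
    (hlo : ∀ t < q * (sn * sn), s.arrays aCellLo t < n)
    (hhi : ∀ t < q * (sn * sn), s.arrays aCellHi t < n) :
    Runs W A .quality s (sn * sn * 14 + q * ((Lg + 1) * 6 + 31) + 19) (fun s' =>
      s'.vars vLen = quality (tieKey A) (s.arrays aCellLo) (s.arrays aCellHi) (s.arrays aCellCol)
        q sn x i) := by
  have hMq : q * (sn * sn) ≤ q * q := Nat.mul_le_mul_left _ hssq
  have hqq : i * q + q ≤ q * q := by
    calc i * q + q = (i + 1) * q := by ring
      _ ≤ q * q := Nat.mul_le_mul_right _ hiq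
  refine (Runs.seq (T₂ := (q * 11 + 3) + (q * ((Lg + 1) * 6 + 20) + 5) + 1)
    ((hull_spec hi hx hss hiq (by omega) hxW (by omega) hlo hhi).framed.mono
    le_rfl ?_)).mono (by ring_nf; omega) (fun _ h => h)
  rintro s₁ ⟨⟨h1, h2, h3, h4⟩, hf₁⟩
  have hq₁ : s₁.vars vQ = q := by rw [hf₁.1 _ rfl, hq]
  have hi₁ : s₁.vars vI = i := by rw [hf₁.1 _ rfl, hi]
  have hc₁ : s₁.vars vCnt = q := by rw [hf₁.1 _ rfl, hcnt]
  have hp₁ : s₁.vars vPow = 2 ^ Lg := by rw [hf₁.1 _ rfl, hpow]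
  refine Runs.seq ((copy_spec hi₁ hq₁ hiq hqn (by omega) h1 h2).framed.mono le_rfl ?_)
  rintro s₂ ⟨hI, hf₂⟩
  have hc₂ : s₂.vars vCnt = q := by rw [hf₂.1 _ rfl, hc₁]
  have hp₂ : s₂.vars vPow = 2 ^ Lg := by rw [hf₂.1 _ rfl, hp₁]
  have hqq0 : q ≤ q * q := Nat.le_mul_self q
  refine (patience_spec hc₂ (by omega) hp₂ hn hW (fun t ht => by rw [(hI t ht).1]; omega)
    (fun t ht => by rw [(hI t ht).2.1]; omega)
    (fun t ht _ => by rw [(hI t ht).1, (hI t ht).2.1])).mono le_rfl ?_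
  intro s₃ hH
  refine IsHeight.len_eq_maxInc (b := i * q) (fun a ha b hb hab => tieKey_ne A (by omega) (by omega))
    (fun t ht => by rw [(hI t ht).1]) (fun t ht => by rw [(hI t ht).2.1]) hH (fun p => ?_)
  rw [mem_hullRegion, ← h3, ← h4]
  constructor
  · rintro ⟨⟨h5, h6⟩, ⟨h7, h8⟩, -, h9⟩
    refine ⟨p - i * q, by omega, (hI _ (by omega)).2.2.2 ?_, by omega⟩
    rw [show i * q + (p - i * q) = p by omega]
    exact ⟨h7, h8, h9⟩
  · rintro ⟨t, ht, ha, rfl⟩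
    obtain ⟨h7, h8, h9⟩ := (hI t ht).2.2.1 ha
    exact ⟨⟨by omega, by omega⟩, ⟨h7, h8⟩, h7, h9⟩

/-- Adds up the qualities of the current colour in the columns sampled for it. -/
def Cmd.total : Cmd := vTotal ≔ ♯0 ;; .forLt vY vSamp
  (vI ≔ .load aCols (↟vColour *' ↟vSamp +' ↟vY) ;; .quality ;; vTotal ≔ ↟vTotal +' ↟vLen)

theorem total_spec {x X N q sn Lg : ℕ} {ρ : ℕ → ℕ} (hx : s.vars vColour = x)
    (hN : s.vars vSamp = N)
    (hss : s.vars vSS = sn * sn) (hq : s.vars vQ = q) (hcnt : s.vars vCnt = q)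
    (hssq : sn * sn ≤ q) (hxX : x < X) (hXN : X * N < W) (hXW : X + 1 < W) (hNq : N * q < W)
    (hqn : q * q ≤ n) (hpow : s.vars vPow = 2 ^ Lg) (hn : n < 2 ^ Lg) (hW : 4 * 2 ^ Lg < W)
    (hlo : ∀ t < q * (sn * sn), s.arrays aCellLo t < n)
    (hhi : ∀ t < q * (sn * sn), s.arrays aCellHi t < n)
    (hρ : ∀ y < N, s.arrays aCols (x * N + y) = ρ (x * N + y) ∧ ρ (x * N + y) < q) :
    Runs W A .total s (N * (sn * sn * 14 + q * ((Lg + 1) * 6 + 31) + 26) + 5) (fun s' =>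
      s'.vars vTotal = ∑ y ∈ Finset.range N, quality (tieKey A) (s.arrays aCellLo)
        (s.arrays aCellHi) (s.arrays aCellCol) q sn x (ρ (x * N + y))) := by
  have hW1 : 1 < W := by have := Nat.one_le_two_pow (n := Lg); omega
  have hxN : x * N + N ≤ X * N := by
    calc x * N + N = (x + 1) * N := by ring
      _ ≤ X * N := Nat.mul_le_mul_right _ hxX
  refine (Runs.assign_seq (Runs.forLt (N := N)
    (Tb := sn * sn * 14 + q * ((Lg + 1) * 6 + 31) + 19 + 1 + 1 + 2)
    (Inv := fun k s' => s'.vars vTotal = ∑ y ∈ Finset.range k, quality (tieKey A)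
      (s.arrays aCellLo) (s.arrays aCellHi) (s.arrays aCellCol) q sn x (ρ (x * N + y)))
    hW1 ?_ (by omega) (by decide) rfl rfl ?_ ?_ (fun s' _ _ _ h => h))).mono (by ring_nf; omega)
      (fun _ h => h)
  · simpa using hN
  · simp [eval_const]
  rintro y hy s₁ hf hy₁ hN₁ hI
  have hx₁ : s₁.vars vColour = x := by rw [hf.1 _ rfl]; simpa using hx
  have hlo₁ : s₁.arrays aCellLo = s.arrays aCellLo := hf.2 _ rfl
  have hhi₁ : s₁.arrays aCellHi = s.arrays aCellHi := hf.2 _ rfl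
  have hcol₁ : s₁.arrays aCellCol = s.arrays aCellCol := hf.2 _ rfl
  have hcols₁ : s₁.arrays aCols = s.arrays aCols := hf.2 _ rfl
  have e0 : (Expr.load aCols (↟vColour *' ↟vSamp +' ↟vY)).eval W A s₁ = ρ (x * N + y) := by
    rw [eval_load, eval_add, eval_mul, eval_var, eval_var, eval_var, hx₁, hN₁, hy₁, hcols₁,
      Nat.mod_eq_of_lt (show x * N < W by omega), Nat.mod_eq_of_lt (by omega), (hρ y hy).1]
  refine Runs.assign_seq ?_
  rw [e0]
  refine Runs.seq (T₁ := sn * sn * 14 + q * ((Lg + 1) * 6 + 31) + 19) (T₂ := 1)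
    ((quality_spec (x := x) (i := ρ (x * N + y)) (q := q) (sn := sn) (Lg := Lg)
    ?_ ?_ ?_ ?_ ?_ (hρ y hy).2 hssq (by omega) hqn ?_ hn hW ?_ ?_).framed.mono le_rfl ?_)
  · simp
  · simpa using hx₁
  · simp [hf.1 vSS rfl, hss]
  · simp [hf.1 vQ rfl, hq]
  · simp [hf.1 vCnt rfl, hcnt]
  · simp [hf.1 vPow rfl, hpow]
  · simpa [hlo₁] using hlo
  · simpa [hhi₁] using hhi
  rintro s₂ ⟨hlen, hf₂⟩
  refine Runs.assign ?_
  have ht₂ : s₂.vars vTotal = s₁.vars vTotal := by rw [hf₂.1 _ rfl]; simp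
  simp only [Store.arrays_setVar, hlo₁, hhi₁, hcol₁] at hlen
  simp only [Store.vars_setVar, Nat.reduceEqDiff, if_true, if_false, eval_add, eval_var]
  rw [ht₂, hlen, hI, Finset.sum_range_succ, Nat.mod_eq_of_lt]
  -- Each quality is at most `q`, so the partial totals stay below `N * q` and do not overflow.
  rw [← Finset.sum_range_succ (fun y => quality (tieKey A)
      (s.arrays aCellLo) (s.arrays aCellHi) (s.arrays aCellCol) q sn x (ρ (x * N + y)))]
  refine lt_of_le_of_lt (Finset.sum_le_card_nsmul _ _ q fun y _ => quality_le _) ?_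
  rw [Finset.card_range, smul_eq_mul]
  exact lt_of_le_of_lt (Nat.mul_le_mul_right _ hy) hNq

/-- Raises the flag if the estimate for some colour is large. -/
def Cmd.evaluate : Cmd := .forLt vColour vX
  (.total ;; Cmd.ite (.not (↟vTotal <' ↟vThr)) (vFlag ≔ ♯1) .skip)

open Classical in
theorem evaluate_spec {X N q sn Lg thr : ℕ} {ρ : ℕ → ℕ} (hX : s.vars vX = X)
    (hN : s.vars vSamp = N) (hthr : s.vars vThr = thr)
    (hss : s.vars vSS = sn * sn) (hq : s.vars vQ = q) (hcnt : s.vars vCnt = q)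
    (hssq : sn * sn ≤ q) (hXN : X * N < W) (hXW : X + 1 < W) (hNq : N * q < W)
    (hqn : q * q ≤ n) (hpow : s.vars vPow = 2 ^ Lg) (hn : n < 2 ^ Lg) (hW : 4 * 2 ^ Lg < W)
    (hlo : ∀ t < q * (sn * sn), s.arrays aCellLo t < n)
    (hhi : ∀ t < q * (sn * sn), s.arrays aCellHi t < n)
    (hρ : ∀ j < X * N, s.arrays aCols j = ρ j ∧ ρ j < q) :
    Runs W A .evaluate s (X * (N * (sn * sn * 14 + q * ((Lg + 1) * 6 + 31) + 26) + 11) + 3)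
      (fun s' => s'.vars vFlag = if ∃ x < X, thr ≤ ∑ y ∈ Finset.range N, quality (tieKey A)
        (s.arrays aCellLo) (s.arrays aCellHi) (s.arrays aCellCol) q sn x (ρ (x * N + y))
        then 1 else s.vars vFlag) := by
  have hW1 : 1 < W := by omega
  refine (Runs.forLt (N := X)
    (Tb := N * (sn * sn * 14 + q * ((Lg + 1) * 6 + 31) + 26) + 5 + 2 + 1)
    (Inv := fun k s' => s'.vars vFlag = if ∃ x < k, thr ≤ ∑ y ∈ Finset.range N, quality (tieKey A)
        (s.arrays aCellLo) (s.arrays aCellHi) (s.arrays aCellCol) q sn x (ρ (x * N + y))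
        then 1 else s.vars vFlag)
    hW1 hX (by omega) (by decide) rfl rfl (by simp) ?_ (fun s' _ _ _ h => h)).mono
      (le_of_eq (by ring)) (fun _ h => h)
  rintro x hx s₁ hf hx₁ hX₁ hI
  have hlo₁ : s₁.arrays aCellLo = s.arrays aCellLo := hf.2 _ rfl
  have hhi₁ : s₁.arrays aCellHi = s.arrays aCellHi := hf.2 _ rfl
  have hcol₁ : s₁.arrays aCellCol = s.arrays aCellCol := hf.2 _ rfl
  have hcols₁ : s₁.arrays aCols = s.arrays aCols := hf.2 _ rfl
  have hxN : x * N + N ≤ X * N := by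
    calc x * N + N = (x + 1) * N := by ring
      _ ≤ X * N := Nat.mul_le_mul_right _ hx
  refine Runs.seq (T₁ := N * (sn * sn * 14 + q * ((Lg + 1) * 6 + 31) + 26) + 5) (T₂ := 2)
    ((total_spec (x := x) (X := X) (N := N) (q := q) (sn := sn) (Lg := Lg) (ρ := ρ)
    hx₁ (by rw [hf.1 _ rfl, hN]) (by rw [hf.1 _ rfl, hss]) (by rw [hf.1 _ rfl, hq])
    (by rw [hf.1 _ rfl, hcnt]) hssq hx hXN hXW hNq hqn (by rw [hf.1 _ rfl, hpow]) hn hW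
    (by rwa [hlo₁]) (by rwa [hhi₁])
    (fun y hy => by rw [hcols₁]; exact hρ _ (by omega))).framed.mono le_rfl ?_)
  rintro s₂ ⟨htot, hf₂⟩
  rw [hlo₁, hhi₁, hcol₁] at htot
  have hthr₂ : s₂.vars vThr = thr := by rw [hf₂.1 _ rfl, hf.1 _ rfl, hthr]
  have hflag₂ : s₂.vars vFlag = s₁.vars vFlag := hf₂.1 _ rfl
  refine Runs.assign_if ?_
  rw [if_congr (eval_not_eq_zero hW1 _) rfl rfl, if_congr (not_congr (eval_lt_eq_zero hW1 _ _)) rfl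
    rfl]
  simp only [eval_var, htot, hthr₂, hflag₂, eval_const, Nat.mod_eq_of_lt hW1, Store.vars_setVar,
    Nat.reduceEqDiff, if_true, if_false, Nat.exists_lt_succ_right, hI, not_not]
  rcases lt_or_ge (∑ y ∈ Finset.range N, quality (tieKey A) (s.arrays aCellLo) (s.arrays aCellHi)
    (s.arrays aCellCol) q sn x (ρ (x * N + y))) thr with h | h
  · simp only [h, not_le.2 h, or_false, if_true]
  · simp only [h, not_lt.2 h, or_true, if_true, if_false]

end Evaluation

end RandomRAM

open Finset in
/-- If the sample does not lose too many elements of a longest increasing subsequence, then some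
colour has large total quality. -/
theorem exists_large_quality {n q g : ℕ} (A : Fin n → ℤ) (hq : q * q ≤ n)
    (hq' : n < (q + 1) * (q + 1)) (hg : 0 < g) (hgq : 256 * (g * g) ≤ q) (hlis : n ≤ g * lis A) :
    ∃ O ⊆ range (q * q), ∀ ω clo chi col : ℕ → ℕ, (∀ j < q * (16 * g), ω j < q) →
      (∀ t < q * (16 * g * (16 * g)),
        clo t = samplePos q (16 * g) ω (t / (16 * g * (16 * g))) (t / (16 * g) % (16 * g))) →
      (∀ t < q * (16 * g * (16 * g)),
        chi t = samplePos q (16 * g) ω (t / (16 * g * (16 * g))) (t % (16 * g))) →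
      IsColouring (fun t => tieKey A (clo t)) (fun t => tieKey A (chi t))
        (q * (16 * g * (16 * g))) (2048 * (g * g * g)) (2048 * (g * g * g)) col →
      ¬ q * q ≤ 2 * g * (O \ retained q (16 * g) ω O).card →
      ∃ x < 2048 * (g * g * g), q * q ≤
        8192 * (g * g * g * g) * ∑ i ∈ range q, quality (tieKey A) clo chi col q (16 * g) x i := by
  classical
  obtain ⟨O', hO', hOf', hOc'⟩ := exists_card_eq_maxInc (tieKey A) (range n)
  rw [← lis_eq_maxInc] at hOc'
  refine ⟨O' ∩ range (q * q), inter_subset_right, ?_⟩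
  intro ω clo chi col hω hclo hchi hcol hlost
  -- Restricting to the columns loses at most `2 * q` elements, as `n - q * q ≤ 2 * q`.
  obtain ⟨O, hO⟩ : ∃ O, O = O' ∩ range (q * q) := ⟨_, rfl⟩
  rw [← hO] at hlost
  have hOsub : O ⊆ range (q * q) := hO ▸ inter_subset_right
  have hOf : StrictMonoOn (tieKey A) (O : Set ℕ) := hOf'.mono (by
    rw [hO, coe_inter]; exact Set.inter_subset_left)
  have hOcard : lis A ≤ O.card + 2 * q := by
    rw [← hOc', hO]
    have h1 : O' ⊆ (O' ∩ range (q * q)) ∪ Ico (q * q) n := by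
      intro p hp
      have := mem_range.1 (hO' hp)
      simp only [mem_union, mem_inter, mem_range, mem_Ico, hp, true_and]
      omega
    refine (card_le_card h1).trans ((card_union_le _ _).trans ?_)
    rw [Nat.card_Ico]
    have : n - q * q ≤ 2 * q := by
      have : (q + 1) * (q + 1) = q * q + 2 * q + 1 := by ring
      omega
    omega
  have hret : retained q (16 * g) ω O ⊆ O := fun p hp => (mem_retained.1 hp).1
  have hsd := card_sdiff_add_card_eq_card hret
  by_contra! hno
  have hg4 : 0 < 8192 * (g * g * g * g) := by positivity
  -- Under the contrary assumption every total quality times 8192g⁴ is less than q², which is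
  -- exactly the bound by this integer quotient.
  obtain ⟨l, hl, hcard⟩ := card_retained_le hω hOsub hOf hclo hchi hcol
    (v := (q * q - 1) / (8192 * (g * g * g * g))) (fun x hx => by
      rw [Nat.le_div_iff_mul_le hg4, mul_comm]
      have := hno x hx
      omega)
  obtain ⟨v, hv⟩ : ∃ v, v = (q * q - 1) / (8192 * (g * g * g * g)) := ⟨_, rfl⟩
  have hv1 : 8192 * (g * g * g * g) * v ≤ q * q := by
    have := Nat.mul_div_le (q * q - 1) (8192 * (g * g * g * g))
    rw [← hv] at this
    omega
  rw [← hv] at hcard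
  -- The 256g²q intervals shared among 2048g³ colours leave an uncoloured chain of length at most
  -- q/(8g).
  have hl1 : 8 * g * l ≤ q := by
    have h1 : 256 * (g * g) * (8 * g * l) ≤ 256 * (g * g) * q := by
      calc 256 * (g * g) * (8 * g * l) = l * (2048 * (g * g * g)) := by ring
        _ ≤ q * (16 * g * (16 * g)) := hl
        _ = 256 * (g * g) * q := by ring
    exact Nat.le_of_mul_le_mul_left h1 (by positivity)
  have hl2 : 8 * g * l * q ≤ q * q := Nat.mul_le_mul_right _ hl1
  have h2 : 2 * g * (retained q (16 * g) ω O).card ≤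
      2 * g * (l * q + 2048 * (g * g * g) * v) := Nat.mul_le_mul_left _ hcard
  have h3 : 2 * g * (l * q + 2048 * (g * g * g) * v) =
      2 * (g * l * q) + 4096 * (g * g * g * g * v) := by ring
  have h4 : 8 * g * l * q = 8 * (g * l * q) := by ring
  have h5 : 8192 * (g * g * g * g) * v = 8192 * (g * g * g * g * v) := by ring
  have h6 : 2 * g * lis A ≤ 2 * g * (O.card + 2 * q) := Nat.mul_le_mul_left _ hOcard
  have h7 : 2 * g * (O.card + 2 * q) = 2 * g * (O \ retained q (16 * g) ω O).card +
      2 * g * (retained q (16 * g) ω O).card + 4 * (g * q) := by rw [← hsd]; ring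
  have h8 : 2 * g * lis A = 2 * (g * lis A) := by ring
  have h9 : 256 * (g * q) ≤ q * q := by
    calc 256 * (g * q) = 256 * (g * 1) * q := by ring
      _ ≤ 256 * (g * g) * q := by gcongr; exact hg
      _ ≤ q * q := Nat.mul_le_mul_right _ hgq
  -- Twice `g` times the optimum is at least 2q². The lost elements account for less than q² of it,
  -- uncoloured columns for at most q²/4, coloured ones for at most q²/2, and the positions outside
  -- the columns for at most q²/64.
  omega

namespace RandomRAM

open scoped ENNReal
open Finset

/-! ### Acceptance probabilities -/

section Acceptance

variable {f : ℕ → ℤ} {clo chi col : ℕ → ℕ} {q s X N E : ℕ}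

/-- Some colour has large total quality in the columns sampled for it. -/
def Accepts (f : ℕ → ℤ) (clo chi col : ℕ → ℕ) (q s X N thr : ℕ) (l : List ℕ) : Prop :=
  ∃ x < X, thr ≤ ∑ y ∈ range N, quality f clo chi col q s x (l.getD (x * N + y) 0)

theorem mul_add_le_mul {x X : ℕ} (hx : x < X) (N : ℕ) : x * N + N ≤ X * N := by
  calc x * N + N = (x + 1) * N := by ring
    _ ≤ X * N := Nat.mul_le_mul_right _ hx

open Classical in
-- Union bound over the colours: by `sum_quality_le` the hypothesis on the optimum makes the mean of
-- every sampled total at most a quarter of the threshold. `p₁` and `p₀` are the failure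
-- probabilities after acceptance and rejection.
theorem avgList_accepts_le_add (hq : 0 < q)
    (h : IsColouring (fun t => f (clo t)) (fun t => f (chi t)) (q * (s * s)) X X col)
    (hS : 2 * (N * maxInc f (range (q * q))) ≤ q * q * E) {p₀ p₁ : ℝ≥0∞} (hp₁ : p₁ ≤ 1) :
    avgList q (X * N) (fun l => if Accepts f clo chi col q s X N (2 * E * q) l then p₁ else p₀) ≤
      p₀ + X * ENNReal.ofReal ((1 / 2) ^ E) := by
  calc avgList q (X * N) (fun l =>
          if Accepts f clo chi col q s X N (2 * E * q) l then p₁ else p₀)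
      ≤ avgList q (X * N) (fun l => p₀ + ∑ x ∈ range X, if 2 * E * q ≤ ∑ y ∈ range N,
          quality f clo chi col q s x (l.getD (x * N + y) 0) then 1 else 0) := by
        refine avgList_mono _ fun l _ _ => ?_
        split_ifs with hacc
        · obtain ⟨x, hx, hle⟩ := hacc
          refine le_add_left (le_trans ?_ (single_le_sum (fun _ _ => zero_le) (mem_range.2 hx)))
          rwa [if_pos hle]
        · exact le_self_add
    _ = p₀ + ∑ x ∈ range X, avgList q (X * N) (fun l => if 2 * E * q ≤ ∑ y ∈ range N,
          quality f clo chi col q s x (l.getD (x * N + y) 0) then 1 else 0) := by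
        rw [avgList_add, avgList_const hq, avgList_sum]
    _ ≤ p₀ + ∑ x ∈ range X, ENNReal.ofReal ((1 / 2) ^ E) := by
        gcongr with x hx
        refine avgList_large_le hq (mul_add_le_mul (mem_range.1 hx) N) (fun v _ => quality_le v) ?_
        refine le_trans ?_ hS
        gcongr
        exact sum_quality_le h (mem_range.1 hx)
    _ = _ := by rw [sum_const, card_range, nsmul_eq_mul]

open Classical in
-- One colour of large total quality is enough: rejection requires its own estimate to miss the
-- threshold.
theorem avgList_accepts_le_mul (hq : 0 < q) (hE : 0 < E) {x : ℕ} (hx : x < X)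
    (hS : 8 * (q * q * E) ≤ N * ∑ i ∈ range q, quality f clo chi col q s x i) (p₀ : ℝ≥0∞) :
    avgList q (X * N) (fun l => if Accepts f clo chi col q s X N (2 * E * q) l then 0 else p₀) ≤
      p₀ * ENNReal.ofReal (1 / 4) := by
  calc avgList q (X * N) (fun l =>
          if Accepts f clo chi col q s X N (2 * E * q) l then 0 else p₀)
      ≤ avgList q (X * N) (fun l => p₀ * if 2 * E * q ≤ ∑ y ∈ range N,
          quality f clo chi col q s x (l.getD (x * N + y) 0) then 0 else 1) := by
        refine avgList_mono _ fun l _ _ => ?_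
        split_ifs with hacc h1 h1
        · exact zero_le
        · exact zero_le
        · exact absurd ⟨x, hx, h1⟩ hacc
        · rw [mul_one]
    _ = p₀ * avgList q (X * N) (fun l => if 2 * E * q ≤ ∑ y ∈ range N,
          quality f clo chi col q s x (l.getD (x * N + y) 0) then 0 else 1) :=
        avgList_const_mul _ _ _
    _ ≤ _ := by
        gcongr
        exact avgList_small_le hq (mul_add_le_mul hx N) (fun v _ => quality_le v) hE hS

end Acceptance

/-! ### Weakest preconditions for the failure probability -/

section WeakestPre

variable {n : ℕ} {W : ℕ} {A : Fin n → ℤ} {S : Set ℕ} {c c₁ c₂ : Cmd} {e : Expr} {s : Store}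
  {T T₁ T₂ : ℕ} {post : Store → ℝ≥0∞} {r : ℝ≥0∞}

/-- The least `r` such that `Trans W A S c s T post r`. -/
noncomputable def wp (W : ℕ) (A : Fin n → ℤ) (S : Set ℕ) (c : Cmd) (T : ℕ) (post : Store → ℝ≥0∞)
    (s : Store) : ℝ≥0∞ :=
  ⨆ (k : List Cmd) (t : ℕ) (_ : ∀ s', loss W A S t (k, s') ≤ post s'), loss W A S (T + t) (c :: k, s)

theorem Trans.wp : Trans W A S c s T post (wp W A S c T post s) := fun k t hp =>
  le_iSup_of_le k (le_iSup_of_le t (le_iSup_of_le hp le_rfl))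

theorem Trans.wp_le (h : Trans W A S c s T post r) : RandomRAM.wp W A S c T post s ≤ r :=
  iSup_le fun k => iSup_le fun t => iSup_le fun hp => h k t hp

/-- Using the weakest precondition as the intermediate bound avoids writing it as an explicit
function on all stores; it need only be estimated at the stores that the first command reaches. -/
theorem Trans.seq_wp (h : Trans W A S c₁ s T₁ (RandomRAM.wp W A S c₂ T₂ post) r) :
    Trans W A S (.seq c₁ c₂) s (T₁ + T₂ + 1) post r :=
  Trans.seq h fun _ => Trans.wp

theorem Trans.loop_wp (he : e.eval W A s ≠ 0)
    (h : Trans W A S c s T₁ (RandomRAM.wp W A S (.loop e c) T₂ post) r) :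
    Trans W A S (.loop e c) s (T₁ + T₂ + 1) post r :=
  Trans.loop_true he h fun _ => Trans.wp

theorem Trans.fill_seq {a x y z w N q : ℕ} {p : List ℕ → ℝ≥0∞} (hW : 1 < W) (hN : s.vars y = N)
    (hNW : N < W) (hq : s.vars z = q) (hq0 : 0 < q) (hxy : x ≠ y) (hxz : x ≠ z) (hxw : x ≠ w)
    (hwy : w ≠ y) (hwz : w ≠ z)
    (hp : ∀ l s', l.length = N → (∀ v ∈ l, v < q) → Filled a x w l s s' →
      Trans W A S c s' T post (p l)) :
    Trans W A S (.seq (Cmd.fill a x y z w) c) s (N * 6 + 3 + T + 1) post (avgList q N p) :=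
  Trans.seq_wp (Trans.fill hW hN hNW hq hq0 hxy hxz hxw hwy hwz fun l s' hl hv hf =>
    (hp l s' hl hv hf).wp_le)

end WeakestPre

end RandomRAM

namespace RandomRAM

open scoped ENNReal
open Finset

/-! ### One trial -/

section Trial

variable {n : ℕ} {W : ℕ} {A : Fin n → ℤ} {S : Set ℕ} {s : Store} {q g Lg X N E : ℕ}

/-- The parameters of the algorithm are stored in their variables. -/
structure IsParams (q g Lg X N E : ℕ) (s : Store) : Prop where
  q_eq : s.vars vQ = q
  pow_eq : s.vars vPow = 2 ^ Lg
  lg_eq : s.vars vLg = Lg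
  g_eq : s.vars vG = g
  s_eq : s.vars vS = 16 * g
  ss_eq : s.vars vSS = 16 * g * (16 * g)
  m_eq : s.vars vM = q * (16 * g * (16 * g))
  x_eq : s.vars vX = X
  samp_eq : s.vars vSamp = N
  thr_eq : s.vars vThr = 2 * E * q
  trials_eq : s.vars vTrials = 3 * E
  qs_eq : s.vars vQS = q * (16 * g)
  xn_eq : s.vars vXN = X * N

theorem IsParams.congr (h : IsParams q g Lg X N E s) {s' : Store}
    (hs : ∀ z < 16, z ≠ vFlag → s'.vars z = s.vars z) : IsParams q g Lg X N E s' := by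
  constructor <;> rw [hs _ (by decide) (by decide)]
  exacts [h.q_eq, h.pow_eq, h.lg_eq, h.g_eq, h.s_eq, h.ss_eq, h.m_eq, h.x_eq, h.samp_eq, h.thr_eq, h.trials_eq, h.qs_eq, h.xn_eq]

theorem IsParams.frame (h : IsParams q g Lg X N E s) {s' : Store} {c : Cmd} (hf : Frame c s s')
    (hc : ∀ z < 16, z ≠ vFlag → c.writesVar z = false) : IsParams q g Lg X N E s' :=
  h.congr fun z hz hz' => hf.1 z (hc z hz hz')

/-- One trial: samples and colours intervals and evaluates the colours. -/
def Cmd.trial : Cmd :=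
  .fill aRand vFillIdx vQS vQ vFillTmp ;; .colouring ;; .fill aCols vFillIdx vXN vQ vFillTmp ;;
    vCnt ≔ ↟vQ ;; .evaluate

/-- A bound for the running time of a trial. -/
def trialTime (q g Lg X N : ℕ) : ℕ :=
  q * (16 * g) * 6 + 3 + (X * (q * (16 * g * (16 * g)) * ((Lg + 1) * 6 + 32) + 16) +
    q * (16 * g * (16 * g)) * 19 + 13 + (X * N * 6 + 3 +
      (X * (N * (16 * g * (16 * g) * 14 + q * ((Lg + 1) * 6 + 31) + 26) + 11) + 3 + 2) + 1) + 1) + 1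

open Classical in
-- The colouring is determined by the first block of draws, so `R` bounds the conditional failure
-- probability given the sampled positions, averaged over the columns drawn afterwards. The two
-- estimates below differ only in the choice of `R`.
theorem trial_trans (hp : IsParams q g Lg X N E s) (hflag : s.vars vFlag = 0)
    (hg : 0 < g) (hgq : 256 * (g * g) ≤ q) (hqn : q * q ≤ n) (hn : n < 2 ^ Lg)
    (hW : 4 * 2 ^ Lg < W) (hXW : X + 1 < W) (hXN : X * N < W) (hNq : N * q < W)
    {post : Store → ℝ≥0∞} {p₀ p₁ : ℝ≥0∞}
    (h₀ : ∀ s', IsParams q g Lg X N E s' → s'.vars vTrial = s.vars vTrial →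
      s'.vars vFlag = 0 → post s' ≤ p₀)
    (h₁ : ∀ s', IsParams q g Lg X N E s' → s'.vars vTrial = s.vars vTrial →
      s'.vars vFlag = 1 → post s' ≤ p₁)
    {R : List ℕ → ℝ≥0∞}
    (hR : ∀ (l : List ℕ) (clo chi col : ℕ → ℕ), (∀ j, l.getD j 0 < q) →
      (∀ t < q * (16 * g * (16 * g)), clo t = samplePos q (16 * g) (fun j => l.getD j 0)
        (t / (16 * g * (16 * g))) (t / (16 * g) % (16 * g))) →
      (∀ t < q * (16 * g * (16 * g)), chi t = samplePos q (16 * g) (fun j => l.getD j 0)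
        (t / (16 * g * (16 * g))) (t % (16 * g))) →
      IsColouring (fun t => tieKey A (clo t)) (fun t => tieKey A (chi t))
        (q * (16 * g * (16 * g))) X X col →
      avgList q (X * N) (fun l' => if Accepts (tieKey A) clo chi col q (16 * g) X N (2 * E * q) l'
        then p₁ else p₀) ≤ R l) :
    Trans W A S .trial s (trialTime q g Lg X N) post (avgList q (q * (16 * g)) R) := by
  have hW1 : 1 < W := by omega
  have hssq : 16 * g * (16 * g) ≤ q := by
    calc 16 * g * (16 * g) = 256 * (g * g) := by ring
      _ ≤ q := hgq
  have hg16 : 16 * g ≤ 16 * g * (16 * g) := Nat.le_mul_self _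
  have hq0 : 0 < q := by omega
  have hqsn : q * (16 * g) ≤ q * q := Nat.mul_le_mul_left _ (hg16.trans hssq)
  refine Trans.fill_seq hW1 hp.qs_eq (by omega) hp.q_eq hq0 (by decide) (by decide) (by decide)
    (by decide) (by decide) fun l s₁ hl hlq hs₁ => ?_
  have hp₁ : IsParams q g Lg X N E s₁ := hp.congr fun z hz _ => hs₁.1 z (by omega) (by omega)
  have hlq' : ∀ j, l.getD j 0 < q := by
    intro j
    rcases lt_or_ge j l.length with h | h
    · rw [List.getD_eq_getElem _ _ h]; exact hlq _ (List.getElem_mem h)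
    · rw [List.getD_eq_default _ _ h]; exact hq0
  refine Trans.seq_runs (colouring_spec (ω := fun j => l.getD j 0) (q := q) (sn := 16 * g)
    (X := X) (Lg := Lg) hp₁.q_eq hp₁.s_eq hp₁.ss_eq hp₁.m_eq hp₁.x_eq hXW (by omega) hssq hqn hp₁.pow_eq hn hW
    (fun j _ => hlq' j) (fun j hj => ?_)).framed ?_
  · rw [hs₁.2.2 j (by omega), List.getD_eq_getElem]
  rintro s₂ ⟨⟨hpos, hcol⟩, hf₂⟩
  have hp₂ : IsParams q g Lg X N E s₂ := hp₁.frame hf₂ (by decide)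
  have hfl₂ : s₂.vars vFlag = 0 := by rw [hf₂.1 _ rfl, hs₁.1 _ (by decide) (by decide), hflag]
  have htr₂ : s₂.vars vTrial = s.vars vTrial := by
    rw [hf₂.1 _ rfl, hs₁.1 _ (by decide) (by decide)]
  refine Trans.mono (Trans.fill_seq hW1 hp₂.xn_eq hXN hp₂.q_eq hq0 (by decide) (by decide) (by decide)
    (by decide) (by decide) fun l' s₃ hl' hlq' hs₃ => ?_) le_rfl
    (hR l (s₂.arrays aCellLo) (s₂.arrays aCellHi) (s₂.arrays aCellCol) hlq'
      (fun t ht => (hpos t ht).1) (fun t ht => (hpos t ht).2.1) hcol)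
  have hp₃ : IsParams q g Lg X N E s₃ := hp₂.congr fun z hz _ => hs₃.1 z (by omega) (by omega)
  have hfl₃ : s₃.vars vFlag = 0 := by rw [hs₃.1 _ (by decide) (by decide), hfl₂]
  have htr₃ : s₃.vars vTrial = s.vars vTrial := by rw [hs₃.1 _ (by decide) (by decide), htr₂]
  have hlo₃ : s₃.arrays aCellLo = s₂.arrays aCellLo := hs₃.2.1 _ (by decide)
  have hhi₃ : s₃.arrays aCellHi = s₂.arrays aCellHi := hs₃.2.1 _ (by decide)
  have hcol₃ : s₃.arrays aCellCol = s₂.arrays aCellCol := hs₃.2.1 _ (by decide)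
  refine Trans.of_runs (Runs.assign_seq ((evaluate_spec (X := X) (N := N) (q := q) (sn := 16 * g)
    (Lg := Lg) (thr := 2 * E * q) (ρ := fun j => l'.getD j 0) ?_ ?_ ?_ ?_ ?_ ?_ hssq hXN hXW hNq hqn
    ?_ hn hW ?_ ?_ ?_).framed)) ?_
  · simpa using hp₃.x_eq
  · simpa using hp₃.samp_eq
  · simpa using hp₃.thr_eq
  · simpa using hp₃.ss_eq
  · simpa using hp₃.q_eq
  · simpa [eval_var] using hp₃.q_eq
  · simpa using hp₃.pow_eq
  · intro t ht
    simpa [hlo₃] using (hpos t ht).2.2.1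
  · intro t ht
    simpa [hhi₃] using (hpos t ht).2.2.2
  · intro j hj
    have hjl : j < l'.length := by omega
    simp only [Store.arrays_setVar, hs₃.2.2 j hjl, List.getD_eq_getElem _ _ hjl, true_and]
    exact hlq' _ (List.getElem_mem hjl)
  rintro s₄ ⟨hacc, hf₄⟩
  have hp₄ : IsParams q g Lg X N E s₄ := hp₃.congr fun z hz hz' => by
    rw [hf₄.1 z (by revert z; decide), Store.vars_setVar, if_neg (by omega)]
  have htr₄ : s₄.vars vTrial = s.vars vTrial := by rw [hf₄.1 _ rfl]; simpa using htr₃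
  simp only [Store.arrays_setVar, hlo₃, hhi₃, hcol₃, Store.vars_setVar, Nat.reduceEqDiff, if_false,
    hfl₃] at hacc
  split_ifs with h
  · exact h₁ s₄ hp₄ htr₄ (hacc.trans (if_pos h))
  · exact h₀ s₄ hp₄ htr₄ (hacc.trans (if_neg h))

/-- Unless acceptance is welcome, a trial accepts with small probability. -/
theorem trial_trans_add (hp : IsParams q g Lg X N E s) (hflag : s.vars vFlag = 0)
    (hg : 0 < g) (hgq : 256 * (g * g) ≤ q) (hqn : q * q ≤ n) (hn : n < 2 ^ Lg)
    (hW : 4 * 2 ^ Lg < W) (hXW : X + 1 < W) (hXN : X * N < W) (hNq : N * q < W)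
    {post : Store → ℝ≥0∞} {p₀ p₁ : ℝ≥0∞}
    (h₀ : ∀ s', IsParams q g Lg X N E s' → s'.vars vTrial = s.vars vTrial →
      s'.vars vFlag = 0 → post s' ≤ p₀)
    (h₁ : ∀ s', IsParams q g Lg X N E s' → s'.vars vTrial = s.vars vTrial →
      s'.vars vFlag = 1 → post s' ≤ p₁)
    (hS : p₁ = 0 ∨ p₁ ≤ 1 ∧ 2 * (N * lis A) ≤ q * q * E) :
    Trans W A S .trial s (trialTime q g Lg X N) post
      (p₀ + X * ENNReal.ofReal ((1 / 2) ^ E)) := by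
  classical
  have hq0 : 0 < q := by
    have : 0 < g * g := Nat.mul_pos hg hg
    omega
  refine (trial_trans hp hflag hg hgq hqn hn hW hXW hXN hNq h₀ h₁
    (R := fun _ => p₀ + X * ENNReal.ofReal ((1 / 2) ^ E)) ?_).mono le_rfl
    (le_of_eq (avgList_const hq0 _ _))
  intro l clo chi col hl hclo hchi hcol
  rcases hS with rfl | ⟨hp1, hS⟩
  · refine le_trans (avgList_mono (p' := fun _ => p₀) _ fun l' _ _ => ?_) ?_
    · split_ifs
      exacts [zero_le, le_rfl]
    · rw [avgList_const hq0]
      exact le_self_add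
  · refine avgList_accepts_le_add hq0 hcol (le_trans ?_ hS) hp1
    rw [lis_eq_maxInc]
    gcongr
    exact maxInc_mono (range_subset_range.2 hqn)

/-- With a large guess, a trial accepts with probability at least a quarter. -/
theorem trial_trans_mul (hp : IsParams q g Lg X N E s) (hflag : s.vars vFlag = 0)
    (hg : 0 < g) (hgq : 256 * (g * g) ≤ q) (hqn : q * q ≤ n) (hn : n < 2 ^ Lg)
    (hW : 4 * 2 ^ Lg < W) (hXW : X + 1 < W) (hXN : X * N < W) (hNq : N * q < W)
    (hqn' : n < (q + 1) * (q + 1)) (hX : X = 2048 * (g * g * g))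
    (hN : N = 65536 * (E * (g * g * g * g))) (hE : 0 < E) (hlis : n ≤ g * lis A)
    {post : Store → ℝ≥0∞} {p₀ : ℝ≥0∞}
    (h₀ : ∀ s', IsParams q g Lg X N E s' → s'.vars vTrial = s.vars vTrial →
      s'.vars vFlag = 0 → post s' ≤ p₀)
    (h₁ : ∀ s', IsParams q g Lg X N E s' → s'.vars vTrial = s.vars vTrial →
      s'.vars vFlag = 1 → post s' ≤ 0) :
    Trans W A S .trial s (trialTime q g Lg X N) post (p₀ * ENNReal.ofReal (3 / 4)) := by
  classical
  have hq0 : 0 < q := by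
    have : 0 < g * g := Nat.mul_pos hg hg
    omega
  obtain ⟨O, hO, hex⟩ := exists_large_quality A hqn hqn' hg hgq hlis
  -- If the sample loses too much of `O`, which has probability at most 1/2, nothing is gained;
  -- otherwise rejection has probability at most 1/4. Together this gives 3/4.
  refine (trial_trans hp hflag hg hgq hqn hn hW hXW hXN hNq h₀ h₁ (R := fun l =>
    p₀ * (if q * q ≤ 2 * g * (O \ retained q (16 * g) (fun j => l.getD j 0) O).card then 1 else 0) +
      p₀ * ENNReal.ofReal (1 / 4)) ?_).mono le_rfl ?_
  · intro l clo chi col hl hclo hchi hcol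
    by_cases hlost : q * q ≤ 2 * g * (O \ retained q (16 * g) (fun j => l.getD j 0) O).card
    · simp only [hlost, if_true, mul_one]
      refine le_trans (avgList_mono (p' := fun _ => p₀) _ fun l' _ _ => ?_) ?_
      · split_ifs
        exacts [zero_le, le_rfl]
      · rw [avgList_const hq0]
        exact le_self_add
    · simp only [hlost, if_false, mul_zero, zero_add]
      obtain ⟨x, hx, hle⟩ := hex (fun j => l.getD j 0) clo chi col (fun j _ => hl j) hclo hchi
        (hX ▸ hcol) hlost
      refine avgList_accepts_le_mul hq0 hE (hX ▸ hx) ?_ p₀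
      calc 8 * (q * q * E) = q * q * (8 * E) := by ring
        _ ≤ 8192 * (g * g * g * g) *
            (∑ i ∈ range q, quality (tieKey A) clo chi col q (16 * g) x i) * (8 * E) :=
          Nat.mul_le_mul_right _ hle
        _ = _ := by rw [hN]; ring
  · rw [avgList_add, avgList_const_mul, avgList_const hq0, ← mul_add]
    gcongr
    refine (add_le_add_left (avgList_lost_le hg hgq rfl hO) _).trans ?_
    rw [← ENNReal.ofReal_add (by norm_num) (by norm_num)]
    norm_num

end Trial

end RandomRAM

namespace RandomRAM

open scoped ENNReal
open Finset

/-! ### Repeated trials and the search for the guess -/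

section Guess

variable {n : ℕ} {W : ℕ} {A : Fin n → ℤ} {S : Set ℕ} {s : Store} {q g Lg X N E κ : ℕ}

/-- Computes the parameters for the current guess. -/
def Cmd.params (κ : ℕ) : Cmd :=
  vS ≔ ♯16 *' ↟vG ;; vSS ≔ ↟vS *' ↟vS ;; vM ≔ ↟vQ *' ↟vSS ;;
  vX ≔ ♯2048 *' (↟vG *' ↟vG *' ↟vG) ;;
  vSamp ≔ ♯65536 *' (♯κ *' ↟vLg *' (↟vG *' ↟vG *' ↟vG *' ↟vG)) ;;
  vThr ≔ ♯2 *' (♯κ *' ↟vLg) *' ↟vQ ;; vTrials ≔ ♯3 *' (♯κ *' ↟vLg) ;;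
  vQS ≔ ↟vQ *' ↟vS ;; vXN ≔ ↟vX *' ↟vSamp ;; vTrial ≔ ♯0

/-- The state before a guess. -/
structure IsGuess (q g Lg : ℕ) (s : Store) : Prop where
  q_eq : s.vars vQ = q
  pow_eq : s.vars vPow = 2 ^ Lg
  lg_eq : s.vars vLg = Lg
  g_eq : s.vars vG = g
  flag_eq : s.vars vFlag = 0

theorem params_spec (h : IsGuess q g Lg s) (hκ : 0 < κ) (hLg : 0 < Lg) (hg : 0 < g) (hq : 0 < q)
    (hX : X = 2048 * (g * g * g)) (hN : N = 65536 * (E * (g * g * g * g))) (hE : E = κ * Lg)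
    (hW : X * N * q < W) :
    Runs W A (.params κ) s 19 (fun s' => IsParams q g Lg X N E s' ∧ s'.vars vTrial = 0 ∧
      s'.vars vFlag = 0) := by
  -- Apart from `3 * (κ * Lg)`, which is bounded through `4 * (κ * Lg)`, the values bounded below
  -- divide `X * N * q`, so a single inequality excludes overflow.
  have key : ∀ a b : ℕ, 0 < b → a * b = X * N * q → a < W := fun a b hb hab =>
    (Nat.le_mul_of_pos_right a hb).trans_lt (hab ▸ hW)
  subst hX hN hE
  have k1 : 16 < W := key _ (8388608 * (κ * Lg * g * g * g * g * g * g * g * q)) (by positivity)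
    (by ring)
  have k2 : 16 * g < W := key _ (8388608 * (κ * Lg * g * g * g * g * g * g * q)) (by positivity)
    (by ring)
  have k3 : 16 * g * (16 * g) < W := key _ (524288 * (κ * Lg * g * g * g * g * g * q))
    (by positivity) (by ring)
  have k4 : q * (16 * g * (16 * g)) < W := key _ (524288 * (κ * Lg * g * g * g * g * g))
    (by positivity) (by ring)
  have k5 : 2048 < W := key _ (65536 * (κ * Lg * g * g * g * g * g * g * g * q)) (by positivity)
    (by ring)
  have k6 : g * g < W := key _ (134217728 * (κ * Lg * g * g * g * g * g * q)) (by positivity)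
    (by ring)
  have k7 : g * g * g < W := key _ (134217728 * (κ * Lg * g * g * g * g * q)) (by positivity)
    (by ring)
  have k8 : 2048 * (g * g * g) < W := key _ (65536 * (κ * Lg * g * g * g * g * q)) (by positivity)
    (by ring)
  have k9 : 65536 < W := key _ (2048 * (κ * Lg * g * g * g * g * g * g * g * q)) (by positivity)
    (by ring)
  have k10 : κ < W := key _ (134217728 * (Lg * g * g * g * g * g * g * g * q)) (by positivity)
    (by ring)
  have k11 : κ * Lg < W := key _ (134217728 * (g * g * g * g * g * g * g * q)) (by positivity)
    (by ring)
  have k12 : g * g * g * g < W := key _ (134217728 * (κ * Lg * g * g * g * q)) (by positivity)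
    (by ring)
  have k13 : κ * Lg * (g * g * g * g) < W := key _ (134217728 * (g * g * g * q)) (by positivity)
    (by ring)
  have k14 : 65536 * (κ * Lg * (g * g * g * g)) < W := key _ (2048 * (g * g * g * q))
    (by positivity) (by ring)
  have k15 : 2 * (κ * Lg) < W := key _ (67108864 * (g * g * g * g * g * g * g * q)) (by positivity)
    (by ring)
  have k16 : 2 * (κ * Lg) * q < W := key _ (67108864 * (g * g * g * g * g * g * g)) (by positivity)
    (by ring)
  have k17 : 3 * (κ * Lg) < W := by
    have : 4 * (κ * Lg) < W := key _ (33554432 * (g * g * g * g * g * g * g * q)) (by positivity)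
      (by ring)
    omega
  have k18 : q * (16 * g) < W := key _ (8388608 * (κ * Lg * g * g * g * g * g * g)) (by positivity)
    (by ring)
  have k19 : 2048 * (g * g * g) * (65536 * (κ * Lg * (g * g * g * g))) < W :=
    key _ q hq (by ring)
  refine Runs.assign_seq (Runs.assign_seq (Runs.assign_seq (Runs.assign_seq (Runs.assign_seq
    (Runs.assign_seq (Runs.assign_seq (Runs.assign_seq (Runs.assign_seq (Runs.assign ?_)))))))))
  simp only [eval_mul, eval_var, eval_const, Store.vars_setVar, Nat.reduceEqDiff, if_true, if_false,
    h.q_eq, h.lg_eq, h.g_eq, Nat.mod_eq_of_lt k1, Nat.mod_eq_of_lt k2, Nat.mod_eq_of_lt k3,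
    Nat.mod_eq_of_lt k4, Nat.mod_eq_of_lt k5, Nat.mod_eq_of_lt k6, Nat.mod_eq_of_lt k7,
    Nat.mod_eq_of_lt k8, Nat.mod_eq_of_lt k9, Nat.mod_eq_of_lt k10, Nat.mod_eq_of_lt k11,
    Nat.mod_eq_of_lt k12, Nat.mod_eq_of_lt k13, Nat.mod_eq_of_lt k14, Nat.mod_eq_of_lt k15,
    Nat.mod_eq_of_lt k16, Nat.mod_eq_of_lt k17, Nat.mod_eq_of_lt k18, Nat.mod_eq_of_lt k19,
    Nat.mod_eq_of_lt (show 2 < W by omega), Nat.mod_eq_of_lt (show 3 < W by omega), Nat.zero_mod]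
  refine ⟨?_, trivial, h.flag_eq⟩
  constructor <;> simp [h.q_eq, h.lg_eq, h.g_eq, h.pow_eq]

/-- Repeats trials until one of them accepts. -/
def Cmd.trials : Cmd := .loop (.and (↟vTrial <' ↟vTrials) (.not ↟vFlag))
  (.trial ;; vTrial ≔ ↟vTrial +' ♯1)

/-- `V m` bounds the failure probability with `m` trials left. It is kept abstract because small
guesses need an additive recursion (each trial may wrongly accept) and the final one a
multiplicative recursion (all trials may reject). -/
theorem trials_trans {m : ℕ} (hp : IsParams q g Lg X N E s) (hflag : s.vars vFlag = 0)
    (hm : s.vars vTrial + m = 3 * E) (hEW : 3 * E < W) {T : ℕ}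
    {post : Store → ℝ≥0∞} {V : ℕ → ℝ≥0∞} {p₁ : ℝ≥0∞}
    (h₀ : ∀ s', IsParams q g Lg X N E s' → s'.vars vFlag = 0 → post s' ≤ V 0)
    (h₁ : ∀ s', IsParams q g Lg X N E s' → s'.vars vFlag = 1 → post s' ≤ p₁)
    (hstep : ∀ (m : ℕ) (s : Store) (post : Store → ℝ≥0∞), IsParams q g Lg X N E s →
      s.vars vFlag = 0 →
      (∀ s', IsParams q g Lg X N E s' → s'.vars vTrial = s.vars vTrial → s'.vars vFlag = 0 →
        post s' ≤ V m) →
      (∀ s', IsParams q g Lg X N E s' → s'.vars vTrial = s.vars vTrial → s'.vars vFlag = 1 →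
        post s' ≤ p₁) →
      Trans W A S .trial s T post (V (m + 1))) :
    Trans W A S .trials s (m * (T + 3) + 1) post (V m) := by
  have hcond : 0 < E → ∀ s : Store, IsParams q g Lg X N E s →
      ((Expr.and (↟vTrial <' ↟vTrials) (.not ↟vFlag)).eval W A s = 0 ↔
        ¬ (s.vars vTrial < 3 * E ∧ s.vars vFlag = 0)) := by
    intro hE s hp
    have hW1 : 1 < W := by omega
    rw [eval_and_eq_zero hW1, eval_lt_eq_zero hW1, eval_not_eq_zero hW1, eval_var, eval_var,
      eval_var, hp.trials_eq, not_not, not_not]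
  induction m generalizing s with
  | zero =>
    refine (Trans.loop_false ?_ (h₀ s hp hflag)).mono (by omega) le_rfl
    rw [Expr.and, eval_mul, eval_lt, eval_lt, eval_const, Nat.zero_mod, eval_lt, eval_var, eval_var,
      hp.trials_eq, if_neg (show ¬ s.vars vTrial < 3 * E by omega)]
    simp
  | succ m ih =>
    have hE : 0 < E := by omega
    have hW1 : 1 < W := by omega
    refine (Trans.loop_wp (T₁ := T + 1 + 1) (T₂ := m * (T + 3) + 1) ?_ (Trans.seq_wp ?_)).mono
      (le_of_eq (by ring)) le_rfl
    · rw [Ne, hcond hE s hp, not_not]; exact ⟨by omega, hflag⟩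
    have step : ∀ s', IsParams q g Lg X N E s' → s'.vars vTrial = s.vars vTrial →
        IsParams q g Lg X N E (s'.setVar vTrial ((↟vTrial +' ♯1).eval W A s')) ∧
        (s'.setVar vTrial ((↟vTrial +' ♯1).eval W A s')).vars vFlag = s'.vars vFlag ∧
        (s'.setVar vTrial ((↟vTrial +' ♯1).eval W A s')).vars vTrial + m = 3 * E := by
      intro s' hp' ht
      refine ⟨hp'.congr fun z hz _ => ?_, by simp, ?_⟩
      · rw [Store.vars_setVar, if_neg (by omega)]
      · rw [Store.vars_setVar, if_pos rfl, eval_add, eval_var, eval_const, Nat.mod_eq_of_lt hW1, ht,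
          Nat.mod_eq_of_lt (by omega)]
        omega
    refine hstep m s _ hp hflag (fun s' hp' ht hfl => ?_) (fun s' hp' ht hfl => ?_)
    · obtain ⟨hp2, hf2, ht2⟩ := step s' hp' ht
      refine (Trans.of_runs (Runs.assign (Q := fun s'' => s'' = _) rfl) ?_).wp_le
      rintro _ rfl
      exact (ih hp2 (hf2.trans hfl) ht2).wp_le
    · obtain ⟨hp2, hf2, ht2⟩ := step s' hp' ht
      refine (Trans.of_runs (Runs.assign (Q := fun s'' => s'' = _) rfl) ?_).wp_le
      rintro _ rfl
      refine ((Trans.loop_false ?_ (h₁ _ hp2 (hf2.trans hfl))).mono (by omega) le_rfl).wp_le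
      rw [hcond hE _ hp2, hf2, hfl]
      omega

/-- Tests the current guess; doubles it unless a trial accepts. -/
def Cmd.guess (κ : ℕ) : Cmd :=
  .params κ ;; .trials ;; Cmd.ite ↟vFlag .skip (vG ≔ ♯2 *' ↟vG)

/-- A bound for the running time of a guess. -/
def guessTime (q g Lg κ : ℕ) : ℕ :=
  3 * (κ * Lg) * (trialTime q g Lg (2048 * (g * g * g))
    (65536 * (κ * Lg * (g * g * g * g))) + 3) + 24

theorem guess_trans (h : IsGuess q g Lg s) (hκ : 0 < κ) (hLg : 0 < Lg) (hg : 0 < g) (hq : 0 < q)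
    (hX : X = 2048 * (g * g * g)) (hN : N = 65536 * (E * (g * g * g * g))) (hE : E = κ * Lg)
    (hW : X * N * q < W) {post : Store → ℝ≥0∞} {V : ℕ → ℝ≥0∞} {p₁ : ℝ≥0∞}
    (h₀ : ∀ s', IsGuess q (2 * g) Lg s' → post s' ≤ V 0)
    (h₁ : ∀ s', s'.vars vQ = q → s'.vars vG = g → s'.vars vFlag = 1 → post s' ≤ p₁)
    (hstep : ∀ (m : ℕ) (s : Store) (post : Store → ℝ≥0∞), IsParams q g Lg X N E s →
      s.vars vFlag = 0 →
      (∀ s', IsParams q g Lg X N E s' → s'.vars vTrial = s.vars vTrial → s'.vars vFlag = 0 →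
        post s' ≤ V m) →
      (∀ s', IsParams q g Lg X N E s' → s'.vars vTrial = s.vars vTrial → s'.vars vFlag = 1 →
        post s' ≤ p₁) →
      Trans W A S .trial s (trialTime q g Lg X N) post (V (m + 1))) :
    Trans W A S (.guess κ) s (guessTime q g Lg κ) post (V (3 * E)) := by
  have hE0 : 0 < E := hE ▸ Nat.mul_pos hκ hLg
  have hEW : 3 * E < W ∧ 2 * g < W := by
    constructor
    · calc 3 * E ≤ 4 * E := Nat.mul_le_mul_right _ (by omega)
        _ ≤ 4 * E * (33554432 * (g * g * g * g * g * g * g * q)) :=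
          Nat.le_mul_of_pos_right _ (by positivity)
        _ = X * N * q := by rw [hX, hN]; ring
        _ < W := hW
    refine lt_of_le_of_lt ?_ hW
    calc 2 * g ≤ 2 * g * (67108864 * (E * (g * g * g * g * g * g * q))) :=
          Nat.le_mul_of_pos_right _ (by positivity)
      _ = X * N * q := by rw [hX, hN]; ring
  have hW1 : 1 < W := by omega
  obtain ⟨T, hT⟩ : ∃ T, T = trialTime q g Lg X N := ⟨_, rfl⟩
  rw [← hT] at hstep
  have htime : 19 + (3 * E * (T + 3) + 1 + 2 + 1) + 1 ≤ guessTime q g Lg κ := by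
    rw [hT, guessTime, hX, hN, hE]
    exact le_of_eq (by ring)
  refine (Trans.seq_runs (T₁ := 19) (T₂ := 3 * E * (T + 3) + 1 + 2 + 1)
    (params_spec (A := A) h hκ hLg hg hq hX hN hE hW) ?_).mono htime le_rfl
  rintro s₁ ⟨hp, ht, hfl⟩
  refine Trans.seq_wp (T₁ := 3 * E * (T + 3) + 1) (T₂ := 2) (trials_trans hp hfl (by omega) hEW.1 (p₁ := p₁) ?_ ?_ hstep)
  · intro s₂ hp₂ hfl₂
    refine (Trans.ite (T := 1) (fun h' => ?_) (fun _ => Trans.of_runs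
      (Runs.assign (Q := fun s'' => s'' = _) rfl) ?_)).wp_le
    · exact absurd hfl₂ h'
    rintro _ rfl
    refine h₀ _ ⟨by simpa using hp₂.q_eq, by simpa using hp₂.pow_eq, by simpa using hp₂.lg_eq, ?_,
      by simpa using hfl₂⟩
    rw [Store.vars_setVar, if_pos rfl, eval_mul, eval_const, eval_var, hp₂.g_eq,
      Nat.mod_eq_of_lt (show 2 < W by omega), Nat.mod_eq_of_lt hEW.2]
  · intro s₂ hp₂ hfl₂
    refine (Trans.ite (T := 1) (fun _ => Trans.of_runs
      (Runs.skip (Q := fun s'' => s'' = _) rfl) ?_) (fun h' => ?_)).wp_le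
    · rintro _ rfl
      exact h₁ _ hp₂.q_eq hp₂.g_eq hfl₂
    · rw [eval_var, hfl₂] at h'
      exact absurd h' one_ne_zero

/-- Doubles the guess until a trial accepts or the guess is too large. -/
def Cmd.search (κ : ℕ) : Cmd :=
  .loop (.and (.not ↟vFlag) (.not (↟vQ <' ♯256 *' (↟vG *' ↟vG)))) (.guess κ)

/-- Induction on the number `d` of doublings that remain until `G`. Below `G` rejection is harmless
and the only danger is an acceptance with an inadmissible output; at `G` acceptance is always
admissible and the only danger is that all trials reject. Leaving the loop because the guess is too
large for `q` also gives an admissible output. -/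
theorem search_trans {d G T : ℕ} (h : IsGuess q g Lg s) (hκ : 0 < κ) (hLg : 0 < Lg) (hg : 0 < g)
    (hq : 0 < q) (hd : g * 2 ^ d = G) (hqn : q * q ≤ n) (hqn' : n < (q + 1) * (q + 1))
    (hn : n < 2 ^ Lg) (hW : 4 * 2 ^ Lg < W) (hGW : 256 * (G * G) < W)
    (hWg : ∀ g, 256 * (g * g) ≤ q →
      2048 * (g * g * g) * (65536 * (κ * Lg * (g * g * g * g))) * q < W)
    (hlis : n ≤ G * lis A)
    (hT : ∀ g ≤ G, 0 < g → 256 * (g * g) ≤ q → guessTime q g Lg κ ≤ T)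
    {post : Store → ℝ≥0∞} (hpost : ∀ s', post s' ≤ 1)
    (hout : ∀ s' g, s'.vars vQ = q → s'.vars vG = g → 0 < g → g ≤ G →
      (q * q < 131072 * (g * g * g * g * lis A) ∨ q < 256 * (g * g)) → post s' = 0) :
    Trans W A S (.search κ) s ((d + 1) * (T + 1) + 1) post
      (d * ((3 * (κ * Lg) : ℕ) * ((2048 * n : ℕ) * ENNReal.ofReal ((1 / 2) ^ (κ * Lg)))) +
        ENNReal.ofReal (3 / 4) ^ (3 * (κ * Lg))) := by
  have hE0 : 0 < κ * Lg := Nat.mul_pos hκ hLg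
  have hW1 : 1 < W := by omega
  have hcond : ∀ s : Store, s.vars vQ = q → ∀ g ≤ G, s.vars vG = g →
      ((Expr.and (.not ↟vFlag) (.not (↟vQ <' ♯256 *' (↟vG *' ↟vG)))).eval W A s = 0 ↔
        ¬ (s.vars vFlag = 0 ∧ 256 * (g * g) ≤ q)) := by
    intro s hq' g hgG hg'
    have hgg : 256 * (g * g) < W := lt_of_le_of_lt (by gcongr) hGW
    have h256 : 256 < W := by
      rcases Nat.eq_zero_or_pos G with rfl | hG
      · simp at hd; omega
      · have : 0 < G * G := Nat.mul_pos hG hG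
        omega
    rw [eval_and_eq_zero hW1, eval_not_eq_zero hW1, eval_not_eq_zero hW1, eval_lt_eq_zero hW1,
      eval_mul, eval_mul, eval_var, eval_var, eval_var, eval_const, hq', hg',
      Nat.mod_eq_of_lt h256, Nat.mod_eq_of_lt (show g * g < W by omega),
      Nat.mod_eq_of_lt hgg, not_not, not_not, not_lt]
  have hlis0 : 0 < lis A := by
    rcases Nat.eq_zero_or_pos (lis A) with h0 | h0
    · have : 0 < q * q := Nat.mul_pos hq hq
      rw [h0] at hlis
      omega
    · exact h0
  induction d generalizing s g with
  | zero =>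
    rw [pow_zero, mul_one] at hd
    subst hd
    by_cases hgq : 256 * (g * g) ≤ q
    · have hWX := hWg g hgq
      refine (Trans.loop_wp (T₁ := T) (T₂ := 1) ?_ ((guess_trans h hκ hLg hg hq rfl rfl rfl hWX
        -- After the last rejection `V 0 = 1`, so nothing has to be shown about guesses beyond `G`.
        (V := fun m => ENNReal.ofReal (3 / 4) ^ m) (p₁ := 0) ?_ ?_ ?_).mono
          (hT g le_rfl hg hgq) le_rfl)).mono (by omega) ?_
      · rw [Ne, hcond s h.q_eq g le_rfl h.g_eq, not_not]
        exact ⟨h.flag_eq, hgq⟩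
      · intro s' hs'
        rw [pow_zero]
        exact Trans.one.wp_le
      · intro s' hq' hg' hfl
        refine (Trans.loop_false ?_ (le_of_eq (hout s' g hq' hg' hg le_rfl (Or.inl ?_)))).wp_le
        · rw [hcond s' hq' g le_rfl hg', hfl]; omega
        -- Acceptance at `g = G` is admissible because `g` times the optimum is already at least
        -- `n`.
        · calc q * q ≤ g * lis A := hqn.trans hlis
            _ < 131072 * (g * lis A) := by
              have : 0 < g * lis A := Nat.mul_pos hg hlis0
              omega
            _ = 131072 * (1 * 1 * 1 * g * lis A) := by ring
            _ ≤ _ := by gcongr <;> exact hg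
      · intro m s' post' hp hfl h0 h1
        have hXq : 2048 * (g * g * g) * (65536 * (κ * Lg * (g * g * g * g))) < W :=
          lt_of_le_of_lt (Nat.le_mul_of_pos_right _ hq) hWX
        rw [pow_succ]
        refine trial_trans_mul hp hfl hg hgq hqn hn hW ?_ hXq ?_ hqn' rfl rfl hE0 hlis h0 h1
        · refine lt_of_le_of_lt ?_ hXq
          have : 0 < g * g * g := by positivity
          have : 0 < κ * Lg * (g * g * g * g) := by positivity
          nlinarith
        · refine lt_of_le_of_lt ?_ hWX
          exact Nat.mul_le_mul_right _ (Nat.le_mul_of_pos_left _ (by positivity))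
      · simp
    · refine (Trans.loop_false ?_ (le_of_eq (hout s g h.q_eq h.g_eq hg le_rfl (Or.inr
        (by omega))))).mono (by omega) zero_le
      rw [hcond s h.q_eq g le_rfl h.g_eq]
      omega
  | succ d ih =>
    have hgG : g ≤ G := by rw [← hd]; exact Nat.le_mul_of_pos_right _ (by positivity)
    by_cases hgq : 256 * (g * g) ≤ q
    · have hWX := hWg g hgq
      have hXn : 2048 * (g * g * g) ≤ 2048 * n := by
        refine Nat.mul_le_mul_left _ (le_trans ?_ hqn)
        have : g ≤ g * g := Nat.le_mul_self g
        exact Nat.mul_le_mul (by omega) (by omega)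
      obtain ⟨r, hr⟩ : ∃ r, r = (d * ((3 * (κ * Lg) : ℕ) *
          ((2048 * n : ℕ) * ENNReal.ofReal ((1 / 2) ^ (κ * Lg)))) +
        ENNReal.ofReal (3 / 4) ^ (3 * (κ * Lg))) := ⟨_, rfl⟩
      classical
      refine (Trans.loop_wp (T₁ := T) (T₂ := (d + 1) * (T + 1) + 1) ?_
        ((guess_trans h hκ hLg hg hq rfl rfl rfl hWX
        -- Each trial adds at most the probability of a wrong acceptance, with the number of colours
        -- bounded by `2048 * n` uniformly in `g`. If acceptance would be admissible it costs 0;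
        -- otherwise the optimum is so small that it is rare.
        (V := fun m => r + m * ((2048 * n : ℕ) * ENNReal.ofReal ((1 / 2) ^ (κ * Lg))))
        (p₁ := if q * q < 131072 * (g * g * g * g * lis A) then 0 else 1) ?_ ?_ ?_).mono
          (hT g hgG hg hgq) le_rfl)).mono (le_of_eq (by ring)) ?_
      · rw [Ne, hcond s h.q_eq g hgG h.g_eq, not_not]
        exact ⟨h.flag_eq, hgq⟩
      · intro s' hs'
        simp only [Nat.cast_zero, zero_mul, add_zero]
        rw [hr]
        exact (ih hs' (by omega) (by rw [← hd]; ring)).wp_le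
      · intro s' hq' hg' hfl
        refine ((Trans.loop_false ?_ (r := if q * q < 131072 * (g * g * g * g * lis A) then 0 else 1)
          ?_).mono (by omega) le_rfl).wp_le
        · rw [hcond s' hq' g hgG hg', hfl]; omega
        · split_ifs with hbad
          · exact le_of_eq (hout s' g hq' hg' hg hgG (Or.inl hbad))
          · exact hpost s'
      · intro m s' post' hp hfl h0 h1
        have hXq : 2048 * (g * g * g) * (65536 * (κ * Lg * (g * g * g * g))) < W :=
          lt_of_le_of_lt (Nat.le_mul_of_pos_right _ hq) hWX
        refine (trial_trans_add hp hfl hg hgq hqn hn hW ?_ hXq ?_ h0 h1 ?_).mono le_rfl ?_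
        · refine lt_of_le_of_lt ?_ hXq
          have : 0 < g * g * g := by positivity
          have : 0 < κ * Lg * (g * g * g * g) := by positivity
          nlinarith
        · refine lt_of_le_of_lt ?_ hWX
          exact Nat.mul_le_mul_right _ (Nat.le_mul_of_pos_left _ (by positivity))
        · split_ifs with hbad
          · exact Or.inl rfl
          · refine Or.inr ⟨le_rfl, ?_⟩
            calc 2 * (65536 * (κ * Lg * (g * g * g * g)) * lis A)
                = 131072 * (g * g * g * g * lis A) * (κ * Lg) := by ring
              _ ≤ q * q * (κ * Lg) := Nat.mul_le_mul_right _ (not_lt.1 hbad)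
        · rw [add_assoc]
          push_cast
          rw [add_mul, one_mul]
          gcongr
          exact_mod_cast Nat.le_of_mul_le_mul_left hXn (by norm_num)
      · rw [hr]
        push_cast
        apply le_of_eq
        ring
    · refine (Trans.loop_false ?_ (le_of_eq (hout s g h.q_eq h.g_eq hg hgG (Or.inr
        (by omega))))).mono (by omega) zero_le
      rw [hcond s h.q_eq g hgG h.g_eq]
      omega

end Guess

end RandomRAM

namespace RandomRAM

open scoped ENNReal
open Finset

/-! ### Square root and binary length of the input length -/

section Initialization

variable {n : ℕ} {W : ℕ} {A : Fin n → ℤ} {s : Store}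

/-- Computes the square root of the input length, rounded down. -/
def Cmd.root : Cmd :=
  .loop (.not (↟vN <' (↟vQ +' ♯1) *' (↟vQ +' ♯1))) (vQ ≔ ↟vQ +' ♯1)

/-- Counting upwards takes time proportional to √n, which the time bound allows. The hypothesis `4 *
n < W` covers the square of √n + 1 in the last test. -/
theorem root_spec (hN : s.vars vN = n) (hQ : s.vars vQ = 0) (hn : 0 < n) (hW : 4 * n < W) :
    Runs W A .root s (n.sqrt * 2 + 1) (fun s' => s'.vars vQ = n.sqrt) := by
  have hW1 : 1 < W := by omega
  have hr : 0 < n.sqrt := Nat.sqrt_pos.2 hn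
  have hr1 : (n.sqrt + 1) * (n.sqrt + 1) < W := by
    have h1 := Nat.sqrt_le n
    have h2 : (n.sqrt + 1) * (n.sqrt + 1) ≤ 4 * (n.sqrt * n.sqrt) := by
      calc (n.sqrt + 1) * (n.sqrt + 1) ≤ (2 * n.sqrt) * (2 * n.sqrt) := by
            gcongr <;> omega
        _ = _ := by ring
    omega
  have hr2 : n.sqrt + 1 ≤ (n.sqrt + 1) * (n.sqrt + 1) := Nat.le_mul_self _
  have hcond : ∀ s' : Store, s'.vars vN = n → s'.vars vQ ≤ n.sqrt →
      ((Expr.not (↟vN <' (↟vQ +' ♯1) *' (↟vQ +' ♯1))).eval W A s' = 0 ↔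
        n < (s'.vars vQ + 1) * (s'.vars vQ + 1)) := by
    intro s' hN' hQ'
    have h3 : (s'.vars vQ + 1) * (s'.vars vQ + 1) ≤ (n.sqrt + 1) * (n.sqrt + 1) := by gcongr
    rw [eval_not_eq_zero hW1, eval_lt_eq_zero hW1, eval_mul, eval_add, eval_var, eval_var,
      eval_const, hN', Nat.mod_eq_of_lt hW1, Nat.mod_eq_of_lt (show s'.vars vQ + 1 < W by omega),
      Nat.mod_eq_of_lt (by omega), not_not]
  refine Runs.loop_of_measure (Tb := 1)
    (I := fun m s' => s'.vars vN = n ∧ s'.vars vQ + m = n.sqrt) ?_ ?_ ⟨hN, by omega⟩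
  · rintro m s' ⟨hN', hQ'⟩ he
    rw [Ne, hcond s' hN' (by omega), not_lt] at he
    have h4 : s'.vars vQ + 1 ≤ n.sqrt := Nat.le_sqrt.2 he
    refine Runs.assign ⟨m - 1, by omega, by simpa using hN', ?_⟩
    rw [Store.vars_setVar, if_pos rfl, eval_add, eval_var, eval_const, Nat.mod_eq_of_lt hW1,
      Nat.mod_eq_of_lt (by omega)]
    omega
  · rintro m s' ⟨hN', hQ'⟩ he
    rw [hcond s' hN' (by omega)] at he
    have := Nat.sqrt_lt.2 he
    omega

/-- Computes the number of binary digits of the input length and the corresponding power of two. -/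
def Cmd.digits : Cmd :=
  .loop (.not (↟vN <' ↟vPow)) (vLg ≔ ↟vLg +' ♯1 ;; vPow ≔ ♯2 *' ↟vPow)

theorem digits_spec (hN : s.vars vN = n) (hL : s.vars vLg = 0) (hP : s.vars vPow = 1)
    (hn : 0 < n) (hW : 4 * 2 ^ (Nat.log 2 n + 1) < W) :
    Runs W A .digits s ((Nat.log 2 n + 1) * 4 + 1) (fun s' =>
      s'.vars vLg = Nat.log 2 n + 1 ∧ s'.vars vPow = 2 ^ (Nat.log 2 n + 1)) := by
  have hlt : Nat.log 2 n + 1 < 2 ^ (Nat.log 2 n + 1) := Nat.lt_two_pow_self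
  have hW1 : 2 < W := by omega
  have hcond : ∀ s' : Store, s'.vars vN = n →
      ((Expr.not (↟vN <' ↟vPow)).eval W A s' = 0 ↔ n < s'.vars vPow) := by
    intro s' hN'
    rw [eval_not_eq_zero (by omega), eval_lt_eq_zero (by omega), eval_var, eval_var, hN', not_not]
  refine Runs.loop_of_measure (Tb := 3)
    (I := fun m s' => s'.vars vN = n ∧ s'.vars vPow = 2 ^ s'.vars vLg ∧
      s'.vars vLg + m = Nat.log 2 n + 1) ?_ ?_ ⟨hN, by rw [hP, hL, pow_zero], by omega⟩
  · rintro m s' ⟨hN', hP', hL'⟩ he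
    rw [Ne, hcond s' hN', not_lt, hP'] at he
    have h4 : s'.vars vLg ≤ Nat.log 2 n := Nat.le_log_of_pow_le (by norm_num) he
    refine Runs.assign_seq (Runs.assign ⟨m - 1, by omega, by simpa using hN', ?_, ?_⟩)
    · simp only [Store.vars_setVar, Nat.reduceEqDiff, if_true, if_false, eval_mul, eval_add,
        eval_var, eval_const, Nat.mod_eq_of_lt hW1, Nat.mod_eq_of_lt (show 1 < W by omega),
        Nat.mod_eq_of_lt (show s'.vars vLg + 1 < W by omega), hP']
      have h5 : 2 ^ s'.vars vLg ≤ 2 ^ (Nat.log 2 n + 1) := Nat.pow_le_pow_right (by norm_num)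
        (by omega)
      rw [Nat.mod_eq_of_lt (by omega), pow_succ]
      ring
    · simp only [Store.vars_setVar, Nat.reduceEqDiff, if_true, if_false, eval_add,
        eval_var, eval_const, Nat.mod_eq_of_lt (show 1 < W by omega),
        Nat.mod_eq_of_lt (show s'.vars vLg + 1 < W by omega)]
      omega
  · rintro m s' ⟨hN', hP', hL'⟩ he
    rw [hcond s' hN', hP'] at he
    have h4 := Nat.log_lt_of_lt_pow (by omega) he
    have h5 : s'.vars vLg = Nat.log 2 n + 1 := by omega
    exact ⟨h5, by rw [hP', h5]⟩

end Initialization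

/-! ### The complete program -/

section Main

variable {n : ℕ} {W : ℕ} {A : Fin n → ℤ} {S : Set ℕ}

/-- The program. -/
def Cmd.estimate (κ : ℕ) : Cmd :=
  .root ;; vPow ≔ ♯1 ;; .digits ;; vG ≔ ♯1 ;; .search κ ;;
    vOut ≔ ↟vQ *' ↟vQ /' (↟vG *' ↟vG *' ↟vG *' ↟vG) +' ♯1

theorem estimate_trans {q J Lg κ T : ℕ} (hn0 : 0 < n) (hq : q = n.sqrt)
    (hLg : Lg = Nat.log 2 n + 1) (hκ : 0 < κ) (hW : 4 * 2 ^ Lg < W)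
    (hGW : 256 * (2 ^ J * 2 ^ J) < W) (hGW' : 2 ^ J * 2 ^ J * 2 ^ J * 2 ^ J < W)
    (hWg : ∀ g, 256 * (g * g) ≤ q →
      2048 * (g * g * g) * (65536 * (κ * Lg * (g * g * g * g))) * q < W)
    (hlis : n ≤ 2 ^ J * lis A)
    (hT : ∀ g ≤ 2 ^ J, 0 < g → 256 * (g * g) ≤ q → guessTime q g Lg κ ≤ T)
    (hout : ∀ g, 0 < g → g ≤ 2 ^ J →
      (q * q < 131072 * (g * g * g * g * lis A) ∨ q < 256 * (g * g)) →
      q * q / (g * g * g * g) + 1 ∈ S) :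
    loss W A S (q * 2 + Lg * 4 + (J + 1) * (T + 1) + 13) ([.estimate κ], initStore n) ≤
      (J * ((3 * (κ * Lg) : ℕ) * ((2048 * n : ℕ) * ENNReal.ofReal ((1 / 2) ^ (κ * Lg)))) +
        ENNReal.ofReal (3 / 4) ^ (3 * (κ * Lg))) := by
  classical
  have hn : n < 2 ^ Lg := hLg ▸ Nat.lt_pow_succ_log_self (by norm_num) n
  have hq0 : 0 < q := hq ▸ Nat.sqrt_pos.2 hn0
  have hqn : q * q ≤ n := hq ▸ Nat.sqrt_le n
  have hqn' : n < (q + 1) * (q + 1) := hq ▸ Nat.lt_succ_sqrt n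
  have hW1 : 1 < W := by omega
  have main : Trans W A S (.estimate κ) (initStore n)
      (q * 2 + Lg * 4 + (J + 1) * (T + 1) + 13) (fun s => if s.vars 1 ∈ S then 0 else 1)
      (J * ((3 * (κ * Lg) : ℕ) * ((2048 * n : ℕ) * ENNReal.ofReal ((1 / 2) ^ (κ * Lg)))) +
        ENNReal.ofReal (3 / 4) ^ (3 * (κ * Lg))) := by
    refine (Trans.seq_runs (root_spec (A := A) (n := n) (W := W) (s := initStore n) rfl rfl hn0
      (by omega)).framed (T₂ := 1 + (Lg * 4 + 1 + (1 + ((J + 1) * (T + 1) + 1 + 1 + 1) + 1) + 1) + 1)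
      ?_).mono (by omega) le_rfl
    rintro s₁ ⟨hQ₁, hf₁⟩
    refine Trans.seq_runs (Runs.assign (Q := fun s' => s' = s₁.setVar vPow (1 % W)) rfl) ?_
    rintro _ rfl
    refine Trans.seq_runs (T₁ := Lg * 4 + 1) (((digits_spec (A := A) (n := n) (W := W) ?_ ?_ ?_ hn0
      (hLg ▸ hW)).framed).mono (hLg ▸ le_rfl) fun _ h => h) ?_
    · rw [Store.vars_setVar, if_neg (by decide), hf₁.1 _ rfl]; rfl
    · rw [Store.vars_setVar, if_neg (by decide), hf₁.1 _ rfl]; rfl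
    · rw [Store.vars_setVar, if_pos rfl, Nat.mod_eq_of_lt hW1]
    rintro s₂ ⟨⟨hL₂, hP₂⟩, hf₂⟩
    refine Trans.seq_runs (Runs.assign (Q := fun s' => s' = s₂.setVar vG (1 % W)) rfl) ?_
    rintro _ rfl
    refine Trans.seq_wp (T₁ := (J + 1) * (T + 1) + 1) (T₂ := 1) (search_trans (q := q) (g := 1) (Lg := Lg) (d := J) (G := 2 ^ J) ?_ hκ
      (by omega) one_pos hq0 (one_mul _) hqn hqn' hn hW hGW hWg hlis hT
      (fun s' => Trans.one.wp_le) ?_)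
    · refine ⟨?_, ?_, ?_, ?_, ?_⟩
      · rw [Store.vars_setVar, if_neg (by decide), hf₂.1 _ rfl, Store.vars_setVar,
          if_neg (by decide), hQ₁, hq]
      · rw [Store.vars_setVar, if_neg (by decide), hP₂, hLg]
      · rw [Store.vars_setVar, if_neg (by decide), hL₂, hLg]
      · rw [Store.vars_setVar, if_pos rfl, Nat.mod_eq_of_lt hW1]
      · rw [Store.vars_setVar, if_neg (by decide), hf₂.1 _ rfl, Store.vars_setVar,
          if_neg (by decide), hf₁.1 _ rfl]
        rfl
    · intro s' g hq' hg' hg0 hgG hok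
      refine le_antisymm ((Trans.of_runs (Runs.assign (Q := fun s'' => s'' = _) rfl) ?_).wp_le)
        zero_le
      rintro _ rfl
      have h4 : g * g * g * g < W := lt_of_le_of_lt (by gcongr) hGW'
      have h3 : g * g * g ≤ g * g * g * g := Nat.le_mul_of_pos_right _ hg0
      have h2 : g * g ≤ g * g * g := Nat.le_mul_of_pos_right _ hg0
      have hdiv : q * q / (g * g * g * g) ≤ q * q := Nat.div_le_self _ _
      rw [Store.vars_setVar, if_pos rfl, eval_add, eval_div, eval_mul, eval_mul, eval_mul, eval_mul,
        eval_var, eval_var, eval_const, hq', hg', Nat.mod_eq_of_lt hW1,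
        Nat.mod_eq_of_lt (show q * q < W by omega), Nat.mod_eq_of_lt (show g * g < W by omega),
        Nat.mod_eq_of_lt (show g * g * g < W by omega), Nat.mod_eq_of_lt h4,
        Nat.mod_eq_of_lt (show q * q / (g * g * g * g) < W by omega),
        Nat.mod_eq_of_lt (by omega), if_pos (hout g hg0 hgG hok)]
  -- With nothing left to execute, the failure probability is the indicator of an output outside
  -- `S`.
  exact main [] 0 fun s' => le_of_eq (loss_halted W A S 0 s')

end Main

end RandomRAM

namespace RandomRAM

/-! ### Numerical bounds for time, output, failure probability and word size -/

section Bounds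

/-- The dominant term of a trial is the evaluation: colours times sampled columns times `q` times
`Lg`, of order `κ * Lg ^ 2 * g ^ 7 * q`. The number of trials contributes another factor `κ * Lg`.
-/
theorem guessTime_le {q g Lg κ : ℕ} (hκ : 0 < κ) (hLg : 0 < Lg) (hg : 0 < g)
    (hgq : 256 * (g * g) ≤ q) :
    guessTime q g Lg κ ≤ 40000000000 * (κ ^ 2 * Lg ^ 3 * g ^ 7 * q) := by
  have hq : 0 < q := by
    have : 0 < g * g := Nat.mul_pos hg hg
    omega
  obtain ⟨U, hU⟩ : ∃ U, U = κ * Lg ^ 2 * g ^ 7 * q := ⟨_, rfl⟩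
  have key : ∀ a b : ℕ, 0 < b → a * b = U → a ≤ U := fun a b hb hab =>
    hab ▸ Nat.le_mul_of_pos_right a hb
  have k0 : 1 ≤ U := hU ▸ Nat.succ_le_of_lt (by positivity)
  have k1 : q * g ≤ U := key _ (κ * Lg ^ 2 * g ^ 6) (by positivity) (by rw [hU]; ring)
  have k2 : g ^ 5 * q * Lg ≤ U := key _ (κ * Lg * g ^ 2) (by positivity) (by rw [hU]; ring)
  have k3 : g ^ 5 * q ≤ U := key _ (κ * Lg ^ 2 * g ^ 2) (by positivity) (by rw [hU]; ring)
  have k4 : g ^ 3 ≤ U := key _ (κ * Lg ^ 2 * g ^ 4 * q) (by positivity) (by rw [hU]; ring)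
  have k5 : q * g ^ 2 ≤ U := key _ (κ * Lg ^ 2 * g ^ 5) (by positivity) (by rw [hU]; ring)
  have k6 : κ * Lg * g ^ 7 ≤ U := key _ (Lg * q) (by positivity) (by rw [hU]; ring)
  have k7 : κ * Lg * g ^ 7 * q ≤ U := key _ Lg (by positivity) (by rw [hU]; ring)
  have k8 : κ * Lg ^ 2 * g ^ 7 * q ≤ U := hU.ge
  have h1 : trialTime q g Lg (2048 * (g * g * g)) (65536 * (κ * Lg * (g * g * g * g))) ≤
      12000000000 * U := by
    have h2 : 16 * g * (16 * g) * 14 ≤ q * 14 := by nlinarith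
    calc _ ≤ q * (16 * g) * 6 + 3 + (2048 * (g * g * g) * (q * (16 * g * (16 * g)) *
            ((Lg + 1) * 6 + 32) + 16) + q * (16 * g * (16 * g)) * 19 + 13 +
          (2048 * (g * g * g) * (65536 * (κ * Lg * (g * g * g * g))) * 6 + 3 +
          (2048 * (g * g * g) * (65536 * (κ * Lg * (g * g * g * g)) * (q * 14 +
            q * ((Lg + 1) * 6 + 31) + 26) + 11) + 3 + 2) + 1) + 1) + 1 := by
          rw [trialTime]; gcongr
      _ = 96 * (q * g) + 3145728 * (g ^ 5 * q * Lg) + 19922944 * (g ^ 5 * q) + 55296 * g ^ 3 +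
          4864 * (q * g ^ 2) + 4294967296 * (κ * Lg * g ^ 7) +
          6845104128 * (κ * Lg * g ^ 7 * q) + 805306368 * (κ * Lg ^ 2 * g ^ 7 * q) + 27 := by ring
      _ ≤ _ := by omega
  have k9 : 1 ≤ κ * Lg := Nat.succ_le_of_lt (by positivity)
  calc guessTime q g Lg κ ≤ 3 * (κ * Lg) * (12000000000 * U + 3) + 24 := by
        rw [guessTime]; gcongr
    _ ≤ 3 * (κ * Lg) * (12000000000 * U + 3 * U) + 24 * (κ * Lg * U) := by
        gcongr
        · omega
        · exact Nat.le_mul_of_pos_right _ (Nat.mul_pos k9 k0)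
    _ = 36000000033 * (κ * Lg * U) := by ring
    _ ≤ 40000000000 * (κ * Lg * U) := by gcongr; norm_num
    _ = _ := by rw [hU]; ring

/-- The first alternative is admissible acceptance; in the second the quotient is below 256², and a
positive optimum absorbs the constant. -/
theorem output_le {q g l : ℕ} (hg : 0 < g) (hl : 0 < l)
    (h : q * q < 131072 * (g * g * g * g * l) ∨ q < 256 * (g * g)) :
    q * q / (g * g * g * g) + 1 ≤ 131072 * l := by
  have hg4 : 0 < g * g * g * g := by positivity
  rcases h with h | h
  · exact (Nat.div_lt_iff_lt_mul hg4).2 (h.trans_eq (by ring))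
  · have h1 : q * q / (g * g * g * g) < 65536 := by
      rw [Nat.div_lt_iff_lt_mul hg4]
      calc q * q < 256 * (g * g) * (256 * (g * g)) := Nat.mul_lt_mul'' h h
        _ = _ := by ring
    omega

/-- Since g ≤ 2/λ and n ≤ 4q², the quotient q²/g⁴ is at least nλ⁴/64, and nλ⁴ is λ³ times the
optimum. The added 1 compensates for rounding down. -/
theorem le_output {n q g l : ℕ} {lam : ℝ} (hn : 0 < n) (hlam : (l : ℝ) = n * lam)
    (hq0 : 0 < q) (hq : n < (q + 1) * (q + 1)) (hg : 0 < g) (hgl : g * l ≤ 2 * n) :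
    1 / 64 * (lam ^ 3 * l) ≤ (q * q / (g * g * g * g) + 1 : ℕ) := by
  have hg4 : 0 < g * g * g * g := by positivity
  obtain ⟨e, he⟩ : ∃ e, e = q * q / (g * g * g * g) + 1 := ⟨_, rfl⟩
  have h1 : q * q ≤ e * (g * g * g * g) := by
    rw [he]
    have := Nat.lt_div_mul_add (a := q * q) hg4
    rw [add_mul, one_mul]
    exact this.le
  have h2 : n ≤ 4 * (q * q) := by
    calc n ≤ (q + 1) * (q + 1) := hq.le
      _ ≤ (2 * q) * (2 * q) := by gcongr <;> omega
      _ = _ := by ring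
  have h3 : n * l ^ 4 ≤ 64 * e * n ^ 4 := by
    calc n * l ^ 4 ≤ 4 * (e * (g * g * g * g)) * l ^ 4 := by gcongr; omega
      _ = 4 * e * (g * l) ^ 4 := by ring
      _ ≤ 4 * e * (2 * n) ^ 4 := by gcongr
      _ = _ := by ring
  have h4 : (n : ℝ) * (l : ℝ) ^ 4 ≤ 64 * e * (n : ℝ) ^ 4 := by exact_mod_cast h3
  have hn' : (0 : ℝ) < n := by exact_mod_cast hn
  rw [← he, hlam]
  rw [hlam] at h4
  have h5 : (n : ℝ) ^ 4 * (n * lam ^ 4) ≤ (n : ℝ) ^ 4 * (64 * e) := by nlinarith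
  have h6 := le_of_mul_le_mul_left h5 (by positivity)
  nlinarith

theorem failure_le {n J Lg c κ : ℕ} (hn : 0 < n) (hLg : 0 < Lg) (hnL : n ≤ 2 ^ Lg) (hJ : J ≤ Lg)
    (hκ : κ = 2 * c + 32) :
    (J * ((3 * (κ * Lg) : ℕ) * ((2048 * n : ℕ) * ENNReal.ofReal ((1 / 2) ^ (κ * Lg)))) +
        ENNReal.ofReal (3 / 4) ^ (3 * (κ * Lg))) ≤ ENNReal.ofReal (1 / (n : ℝ) ^ c) := by
  -- All factors are bounded by powers of p = 2^Lg. The `c` in the exponent is needed twice, for `n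
  -- ^ c` and for the factor `c` hidden in κ ≤ const·2^c, and 32 covers the constants.
  have hnat : (J * (3 * (κ * Lg) * (2048 * n)) + 1) * n ^ c ≤ 2 ^ (κ * Lg) := by
    obtain ⟨p, hp⟩ : ∃ p, p = 2 ^ Lg := ⟨_, rfl⟩
    have hLp : Lg ≤ p := hp ▸ Nat.lt_two_pow_self.le
    have h2p : 2 ≤ p := hp ▸ Nat.le_self_pow hLg.ne' 2
    have hp0 : 0 < p := by omega
    have hc : c + 1 ≤ 2 ^ c := Nat.lt_two_pow_self
    have h1 : 3 * κ ≤ 128 * 2 ^ c := by omega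
    rw [← hp] at hnL
    calc (J * (3 * (κ * Lg) * (2048 * n)) + 1) * n ^ c
        = (3 * κ * J * Lg * n * 2048 + 1) * n ^ c := by ring
      _ ≤ (128 * 2 ^ c * p * p * p * 2048 + 1 * (2 ^ c * p * p * p)) * p ^ c := by
          gcongr
          · exact hJ.trans hLp
          · exact Nat.succ_le_of_lt (by positivity)
      _ = 262145 * 2 ^ c * p ^ (c + 3) := by ring
      _ ≤ 2 ^ 19 * 2 ^ c * p ^ (c + 3) := by gcongr; norm_num
      _ ≤ p ^ 19 * p ^ c * p ^ (c + 3) := by gcongr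
      _ = p ^ (2 * c + 22) := by ring
      _ ≤ p ^ κ := Nat.pow_le_pow_right hp0 (by omega)
      _ = 2 ^ (κ * Lg) := by rw [hp, ← pow_mul, mul_comm]
  have hpow : (0 : ℝ) < 2 ^ (κ * Lg) := by positivity
  have hnc : (0 : ℝ) < (n : ℝ) ^ c := by
    have : (0 : ℝ) < n := by exact_mod_cast hn
    positivity
  -- Three times as many trials as `κ * Lg` suffice because (3/4)³ = 27/64 ≤ 1/2.
  have h34 : ENNReal.ofReal (3 / 4) ^ (3 * (κ * Lg)) ≤ ENNReal.ofReal ((1 / 2) ^ (κ * Lg)) := by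
    rw [← ENNReal.ofReal_pow (by norm_num)]
    refine ENNReal.ofReal_le_ofReal ?_
    rw [pow_mul]
    exact pow_le_pow_left₀ (by norm_num) (by norm_num) _
  calc _ ≤ J * ((3 * (κ * Lg) : ℕ) * ((2048 * n : ℕ) * ENNReal.ofReal ((1 / 2) ^ (κ * Lg)))) +
        ENNReal.ofReal ((1 / 2) ^ (κ * Lg)) := by gcongr
    _ = ((J * (3 * (κ * Lg) * (2048 * n)) + 1 : ℕ) : ENNReal) *
        ENNReal.ofReal ((1 / 2) ^ (κ * Lg)) := by push_cast; ring
    _ = ENNReal.ofReal (((J * (3 * (κ * Lg) * (2048 * n)) + 1 : ℕ) : ℝ) *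
        (1 / 2) ^ (κ * Lg)) := by
        rw [ENNReal.ofReal_mul (by positivity), ENNReal.ofReal_natCast]
    _ ≤ ENNReal.ofReal (1 / (n : ℝ) ^ c) := by
        refine ENNReal.ofReal_le_ofReal ?_
        rw [one_div_pow, mul_one_div, div_le_div_iff₀ hpow hnc, one_mul]
        exact_mod_cast hnat

/-- With p = 2^Lg, everything is at most a power of p with exponent below κ + 64: numerical
constants are powers of 2 ≤ p, and κ ≤ 2^κ ≤ p^κ. -/
theorem word_bounds {n q J Lg κ W : ℕ} (hLg : 0 < Lg) (hnL : n ≤ 2 ^ Lg) (hq : q ≤ n) (hJ : J ≤ Lg)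
    (hW : W = 2 ^ ((κ + 64) * Lg)) :
    4 * 2 ^ Lg < W ∧ 256 * (2 ^ J * 2 ^ J) < W ∧ 2 ^ J * 2 ^ J * 2 ^ J * 2 ^ J < W ∧
      ∀ g, 256 * (g * g) ≤ q →
        2048 * (g * g * g) * (65536 * (κ * Lg * (g * g * g * g))) * q < W := by
  obtain ⟨p, hp⟩ : ∃ p, p = 2 ^ Lg := ⟨_, rfl⟩
  have hLp : Lg ≤ p := hp ▸ Nat.lt_two_pow_self.le
  have h2p : 2 ≤ p := hp ▸ Nat.le_self_pow hLg.ne' 2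
  have hJp : 2 ^ J ≤ p := hp ▸ Nat.pow_le_pow_right (by norm_num) hJ
  have hWp : W = p ^ (κ + 64) := by rw [hW, hp, ← pow_mul, mul_comm]
  have hlt : ∀ k, k < κ + 64 → p ^ k < W := fun k hk => hWp ▸ Nat.pow_lt_pow_right (by omega) hk
  rw [← hp] at hnL ⊢
  have hpow : ∀ k, 2 ^ k ≤ p ^ k := fun k => Nat.pow_le_pow_left h2p k
  refine ⟨?_, ?_, ?_, fun g hg => ?_⟩
  · calc 4 * p = 2 ^ 2 * p := by norm_num
      _ ≤ p ^ 2 * p := by gcongr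
      _ = p ^ 3 := by ring
      _ < W := hlt _ (by omega)
  · calc 256 * (2 ^ J * 2 ^ J) = 2 ^ 8 * (2 ^ J * 2 ^ J) := by norm_num
      _ ≤ p ^ 8 * (p * p) := by gcongr
      _ = p ^ 10 := by ring
      _ < W := hlt _ (by omega)
  · calc 2 ^ J * 2 ^ J * 2 ^ J * 2 ^ J ≤ p * p * p * p := by gcongr
      _ = p ^ 4 := by ring
      _ < W := hlt _ (by omega)
  · have hgp : g ≤ p := by
      have := Nat.le_mul_self g
      omega
    calc 2048 * (g * g * g) * (65536 * (κ * Lg * (g * g * g * g))) * q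
        = 2 ^ 27 * κ * (Lg * (g * g * g) * (g * g * g * g) * q) := by ring
      _ ≤ 2 ^ 27 * 2 ^ κ * (p * (p * p * p) * (p * p * p * p) * p) := by
          gcongr
          · exact Nat.lt_two_pow_self.le
          · omega
      _ ≤ p ^ 27 * p ^ κ * (p * (p * p * p) * (p * p * p * p) * p) := by
          gcongr
      _ = p ^ (κ + 36) := by ring
      _ < W := hlt _ (by omega)

/-- The substitutions G ≤ 2/λ and Lg ≤ 2(1 + log n) contribute the factors 2⁷ and 2⁴ to the
constant. The fourth power of the logarithm consists of the three in the time of a guess and one for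
the number of guesses. -/
theorem time_le {n q G J Lg κ l : ℕ} {lam : ℝ} (hn : 0 < n) (hlam : (l : ℝ) = n * lam) (hl : 0 < l)
    (hG : 0 < G) (hGl : G * l ≤ 2 * n) (hq : q = n.sqrt) (hLg : Lg = Nat.log 2 n + 1)
    (hJ : J ≤ Lg) (hκ : 0 < κ) :
    ((q * 2 + Lg * 4 + (J + 1) * (40000000000 * (κ ^ 2 * Lg ^ 3 * G ^ 7 * q) + 1) + 13 : ℕ) : ℝ) ≤
      204800000000000 * κ ^ 2 * ((lam ^ 7)⁻¹ * Real.sqrt n * (1 + Real.log n) ^ 4) := by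
  have hq0 : 0 < q := hq ▸ Nat.sqrt_pos.2 hn
  have hL0 : 0 < Lg := by omega
  have h1 : q * 2 + Lg * 4 + (J + 1) * (40000000000 * (κ ^ 2 * Lg ^ 3 * G ^ 7 * q) + 1) + 13 ≤
      100000000000 * (κ ^ 2 * Lg ^ 4 * G ^ 7 * q) := by
    obtain ⟨U, hU⟩ : ∃ U, U = κ ^ 2 * Lg ^ 4 * G ^ 7 * q := ⟨_, rfl⟩
    have key : ∀ a b : ℕ, 0 < b → a * b = U → a ≤ U := fun a b hb hab =>
      hab ▸ Nat.le_mul_of_pos_right a hb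
    have k0 : 1 ≤ U := hU ▸ Nat.succ_le_of_lt (by positivity)
    have k1 : q ≤ U := key _ (κ ^ 2 * Lg ^ 4 * G ^ 7) (by positivity) (by rw [hU]; ring)
    have k2 : Lg ≤ U := key _ (κ ^ 2 * Lg ^ 3 * G ^ 7 * q) (by positivity) (by rw [hU]; ring)
    have k3 : (J + 1) * (40000000000 * (κ ^ 2 * Lg ^ 3 * G ^ 7 * q) + 1) ≤
        80000000000 * U + 2 * Lg := by
      calc (J + 1) * (40000000000 * (κ ^ 2 * Lg ^ 3 * G ^ 7 * q) + 1)
          ≤ (2 * Lg) * (40000000000 * (κ ^ 2 * Lg ^ 3 * G ^ 7 * q) + 1) := by gcongr; omega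
        _ = _ := by rw [hU]; ring
    rw [← hU]
    omega
  have hn' : (0 : ℝ) < n := by exact_mod_cast hn
  have hl' : (0 : ℝ) < l := by exact_mod_cast hl
  have hlam0 : 0 < lam := by
    rw [hlam] at hl'
    exact (mul_pos_iff_of_pos_left hn').1 hl'
  have hGr : (G : ℝ) ≤ 2 / lam := by
    rw [le_div_iff₀ hlam0]
    have h2 : (G : ℝ) * l ≤ 2 * n := by exact_mod_cast hGl
    rw [hlam] at h2
    nlinarith
  have hqr : (q : ℝ) ≤ Real.sqrt n := hq ▸ Real.nat_sqrt_le_real_sqrt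
  have hlogn : 0 ≤ Real.log n := Real.log_natCast_nonneg n
  have hLr : (Lg : ℝ) ≤ 2 * (1 + Real.log n) := by
    have h2 : (Nat.log 2 n : ℝ) ≤ Real.logb 2 n := by exact_mod_cast Real.natLog_le_logb n 2
    have h3 : Real.logb 2 n ≤ 2 * Real.log n := by
      have h4 := Real.log_two_gt_d9
      rw [Real.logb, div_le_iff₀ (by linarith)]
      nlinarith
    rw [hLg]
    push_cast
    linarith
  calc ((q * 2 + Lg * 4 + (J + 1) * (40000000000 * (κ ^ 2 * Lg ^ 3 * G ^ 7 * q) + 1) + 13 : ℕ) : ℝ)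
      ≤ ((100000000000 * (κ ^ 2 * Lg ^ 4 * G ^ 7 * q) : ℕ) : ℝ) := by exact_mod_cast h1
    _ = 100000000000 * (κ ^ 2 * (Lg : ℝ) ^ 4 * (G : ℝ) ^ 7 * q) := by push_cast; ring
    _ ≤ 100000000000 * (κ ^ 2 * (2 * (1 + Real.log n)) ^ 4 * (2 / lam) ^ 7 * Real.sqrt n) := by
        gcongr
    _ = _ := by
        field_simp
        ring

end Bounds

end RandomRAM

/-! ### The main theorem -/

theorem mainTheorem4 :
    ∃ a b : ℝ, 0 < a ∧ 0 < b ∧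
      ∀ c : ℕ, ∃ (P : RandomRAM.Cmd) (γ : ℕ) (K : ℝ) (d : ℕ), 0 < γ ∧ 0 < K ∧
        ∀ (n : ℕ), 0 < n → ∀ (A : Fin n → ℤ) (lam : ℝ), (lis A : ℝ) = n * lam →
          ∀ t : ℕ, K * ((lam ^ 7)⁻¹ * Real.sqrt n * (1 + Real.log n) ^ d) ≤ t →
            1 - 1 / (n : ℝ) ^ c ≤
              RandomRAM.successProb P γ A t
                {est : ℕ | a * (lam ^ 3 * lis A) ≤ est ∧ (est : ℝ) ≤ b * lis A} := by
  refine ⟨1 / 64, 131072, by norm_num, by norm_num, fun c => ?_⟩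
  obtain ⟨κ, hκ⟩ : ∃ κ, κ = 2 * c + 32 := ⟨_, rfl⟩
  refine ⟨.estimate κ, κ + 64, 204800000000000 * κ ^ 2, 4, by omega, ?_, ?_⟩
  · have : 0 < κ := by omega
    positivity
  intro n hn A lam hlam t ht
  have hl : 0 < lis A := lis_pos hn A
  have hln : lis A ≤ n := lis_le A
  obtain ⟨Lg, hLg⟩ : ∃ Lg, Lg = Nat.log 2 n + 1 := ⟨_, rfl⟩
  obtain ⟨q, hq⟩ : ∃ q, q = n.sqrt := ⟨_, rfl⟩
  have hnL : n < 2 ^ Lg := hLg ▸ Nat.lt_pow_succ_log_self (by norm_num) n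
  -- `2 ^ J` is the least power of two that is at least 1/λ, the guess by which the search ends with
  -- high probability. It exists only in the analysis; by minimality it is at most 2/λ, which
  -- controls both time and output.
  obtain ⟨J, hJ, hJ2, hJL⟩ : ∃ J, n ≤ 2 ^ J * lis A ∧ 2 ^ J * lis A ≤ 2 * n ∧ J ≤ Lg := by
    have hex : ∃ J, n ≤ 2 ^ J * lis A := ⟨Lg, hnL.le.trans (Nat.le_mul_of_pos_right _ hl)⟩
    classical
    refine ⟨Nat.find hex, Nat.find_spec hex, ?_, Nat.find_min' hex
      (hnL.le.trans (Nat.le_mul_of_pos_right _ hl))⟩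
    rcases Nat.eq_zero_or_pos (Nat.find hex) with h0 | h0
    · rw [h0, pow_zero, one_mul]; omega
    · have h1 := Nat.find_min hex (Nat.sub_lt h0 one_pos)
      obtain ⟨j, hj⟩ : ∃ j, Nat.find hex = j + 1 := ⟨Nat.find hex - 1, by omega⟩
      rw [hj, Nat.add_sub_cancel, not_le] at h1
      rw [hj, pow_succ]
      linarith
  have hqn : q ≤ n := hq ▸ Nat.sqrt_le_self n
  obtain ⟨w1, w2, w3, w4⟩ := RandomRAM.word_bounds (κ := κ) (by omega) hnL.le hqn hJL
    (W := RandomRAM.wordBound (κ + 64) n) (by rw [RandomRAM.wordBound, hLg])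
  have hn' : (0 : ℝ) < n := by exact_mod_cast hn
  refine RandomRAM.one_sub_loss_le_successProb A _ t (one_div_nonneg.2 (pow_nonneg hn'.le c)) ?_
  have htime : q * 2 + Lg * 4 + (J + 1) * (40000000000 * (κ ^ 2 * Lg ^ 3 * (2 ^ J) ^ 7 * q) + 1) +
      13 ≤ t := by
    have h := (RandomRAM.time_le (κ := κ) (G := 2 ^ J) hn hlam hl (Nat.two_pow_pos J) hJ2 hq hLg hJL
      (by omega)).trans ht
    exact_mod_cast h
  refine (RandomRAM.loss_antitone _ A _ _ htime).trans ((RandomRAM.estimate_trans hn hq hLg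
    (by omega) w1 w2 w3 w4 hJ ?_ ?_).trans (RandomRAM.failure_le hn (by omega) hnL.le hJL hκ))
  · intro g hgG hg hgq
    refine (RandomRAM.guessTime_le (by omega) (by omega) hg hgq).trans ?_
    gcongr
  · intro g hg hgG hok
    refine ⟨RandomRAM.le_output hn hlam (hq ▸ Nat.sqrt_pos.2 hn) (hq ▸ Nat.lt_succ_sqrt n) hg
      (le_trans ?_ hJ2), ?_⟩
    · gcongr
    · exact_mod_cast RandomRAM.output_le hg hl hok
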